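/- **Setting.** Let $a_1,a_2,a_4,a_5\in\mathbb R$. For real $r,e,l$ consider the vector field $$f_{r,e,l}(x,y)=\bigl(-y+x^2+r(e\,a_1x-a_2xy),\; e\,(x-l+r(a_4x^2+a_5y))\bigr),$$ and for a step size $h$ its Kahan map $z\mapsto z+h\,(\mathrm{Id}-\tfrac h2 Df(z))^{-1}f(z)$, defined where the matrix is invertible. (For $r=1,e=\epsilon,l=\lambda$ this is the fast-slow canard model; the general case is its quasi-homogeneous rescaling.) *Rescaling chart $K_2$:* coordinates $(x,y)$ with fixed $r,\lambda,h$; the map is the Kahan map of $f_{r,1,\lambda}$ with step $h$. Let $\mu=\lambda$ with $r=0$, $\mu\in I=\mathbb R$, or $\mu=r$ with $\lambda=0$, $\mu\in I=[0,\infty)$. Write the resulting map as $F(z)+\mu\,G(z,\mu)$ with $F$ independent of $\mu$. Put $\hat\gamma(t)=\bigl(\tfrac{ht}2,\tfrac{h^2t^2}4-\tfrac12-\tfrac{h^2}8\bigr)$, $\gamma_h(n)=\hat\gamma(n)$ for $n\in\mathbb Z$, and $\Sigma=\{z:\langle z,\hat\gamma'(0)\rangle=0\}$. *Chart $K_1$:*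 coordinates $(x_1,r_1,\epsilon_1,\lambda_1,h_1)$. If $(X,Y)$, $Y>0$, is the image of $(x_1,1)$ under the Kahan map of $f_{r_1,\epsilon_1,\lambda_1}$ with step $h_1$, the map of this chart sends the point to $(X/\sqrt Y,\,r_1\sqrt Y,\,\epsilon_1/Y,\,\lambda_1/\sqrt Y,\,h_1\sqrt Y)$. The coordinate change $\kappa_{21}=\kappa_{12}^{-1}$ from $K_2$ (where $y>0$) is $(x,y,r,\lambda,h)\mapsto(x/\sqrt y,\,r\sqrt y,\,1/y,\,\lambda/\sqrt y,\,h\sqrt y)$. Let $\rho,\delta,\kappa>0$, $0<\nu<1$, let $k\ge1$ be an integer, and let $D$ be the set of $(r_1,\epsilon_1,\lambda_1,h_1)$ with $0\le r_1\le\rho$, $0\le\epsilon_1\le\delta$, $|\lambda_1|\le\kappa$, $0<h_1\le\nu$. A *center-stable manifold* $\hat M_{a,1}$ is a $C^k$ graph $x_1=\hat g_a(r_1,\epsilon_1,\lambda_1,h_1)$ over $D$ which, over $D$ and in $\{x_1<0\}$, is locally invariant under the map and its inverse, contains the fixed points of the map in $\{\epsilon_1=\lambda_1=0\}$, and contains the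 branch $N_{a,1}$ of all points with $r_1=\lambda_1=0$, $\epsilon_1,h_1>0$ that have a backward orbit in $K_1$ along which $x_1\to-1$ and $\epsilon_1\to0$. A *center-unstable manifold* $\hat M_{r,1}$ is defined in the same way with $x_1>0$, forward orbits and $x_1\to1$. Put $\hat M_{a,2}=\kappa_{12}(\hat M_{a,1})$ and $\hat M_{r,2}=\kappa_{12}(\hat M_{r,1})$, continued by the iterates of the map of $K_2$ and of its inverse. Let $h>0$ be such that $h^2(2n-1)\ne4$ for all $n\in\mathbb N$ (no $\gamma_h(n)$ is a pole of $F$) and that the second coordinate $y$ of some $\gamma_h(n)$ satisfies $1/\delta<y$ and $h^2y<\nu^2$ (true for all sufficiently small $h$). Let $(\psi(n))_{n\in\mathbb Z}$ solve the adjoint equation $\psi(n+1)=(DF(\gamma_h(n))^{\top})^{-1}\psi(n)$ with $\|\psi(0)\|=1$ and $\langle\psi(0),\hat\gamma'(0)\rangle=0$. **Proposition.** For all such manifolds the following holds. 1. For $\mu=0$, both $\hat M_{a,2}$ and $\hat M_{r,2}$ contain $\gamma_h(n)$ for every $n\in\mathbb Z$. 2. For $\mu\in I$ close to $0$, the sheet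 of $\hat M_{a,2}$ obtained by following orbits forward through $\{x<0\}$ up to the first point outside meets $\Sigma$ in exactly one point $\Delta_-(\mu)\psi(0)$, and the sheet of $\hat M_{r,2}$ obtained by following orbits backward through $\{x>0\}$ up to the first point outside meets $\Sigma$ in exactly one point $\Delta_+(\mu)\psi(0)$. The functions $\Delta_\pm$ are $C^k$ on a neighbourhood of $0$ in $I$, and $\Delta_\pm(0)\psi(0)=\gamma_h(0)$. Let $d_\mu=\frac{d}{d\mu}(\Delta_--\Delta_+)(0)$ (one-sided if $\mu=r$). 3. Let $w_+$ on $\mathbb Z_{\ge0}$ and $w_-$ on $\mathbb Z_{\le0}$ solve $w(n+1)=DF(\gamma_h(n))w(n)+G(\gamma_h(n),0)$ with $w_\pm(0)=\Delta_\pm'(0)\psi(0)$. Then for every $N\ge1$ $$d_\mu=\sum_{n=-N}^{N-1}\langle\psi(n+1),G(\gamma_h(n),0)\rangle+\langle\psi(-N),w_-(-N)\rangle-\langle\psi(N),w_+(N)\rangle .$$ If $\|\psi(\pm N)\|\,\|w_\pm(\pm N)\|\to0$ as $N\to\infty$, then $d_\mu=\lim_{N\to\infty}\sum_{n=-N}^{N-1}\langle\psi(n+1),G(\gamma_h(n),0)\rangle$.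 4. If $\psi$ decays exponentially at $\pm\infty$, then the series below converges absolutely and $$d_\mu=\sum_{n=-\infty}^{\infty}\langle\psi(n+1),G(\gamma_h(n),0)\rangle .$$ -/

import Mathlib

open Filter Topology Matrix

noncomputable section

namespace KahanCanard

/-- Points of the plane, written as pairs `![x, y]`. -/
abbrev Plane : Type := Fin 2 → ℝ

/-! ### The Kahan discretization of a planar quadratic vector field -/

/-- The Jacobian matrix of a map of the plane. -/
def jacobian (f : Plane → Plane) (z : Plane) : Matrix (Fin 2) (Fin 2) ℝ :=
  LinearMap.toMatrix' (fderiv ℝ f z : Plane →ₗ[ℝ] Plane)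

/-- The matrix `Id - (h/2) Df(z)`. -/
def kahanMatrix (f : Plane → Plane) (h : ℝ) (z : Plane) : Matrix (Fin 2) (Fin 2) ℝ :=
  1 - (h / 2) • jacobian f z

/-- The Kahan map `z ↦ z + h (Id - (h/2) Df(z))⁻¹ f(z)`, meaningful where the matrix is
invertible. -/
def kahan (f : Plane → Plane) (h : ℝ) (z : Plane) : Plane :=
  z + h • ((kahanMatrix f h z)⁻¹ *ᵥ f z)

/-- `z'` is the image of `z` under the (rational) Kahan map, and `z` is not a pole. -/
def KahanStep (f : Plane → Plane) (h : ℝ) (z z' : Plane) : Prop :=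
  (kahanMatrix f h z).det ≠ 0 ∧ z' = kahan f h z

/-! ### The canard model and its two blow-up charts -/

/-- The coefficients of the model. -/
structure Coeffs where
  a1 : ℝ
  a2 : ℝ
  a4 : ℝ
  a5 : ℝ

/-- The quasi-homogeneously rescaled model vector field
`x' = -y + x² + r (e a₁ x - a₂ x y)`, `y' = e (x - l + r (a₄ x² + a₅ y))`.
For `r = 1`, `e = ε`, `l = λ` it is the model
`x' = -y + x² + ε a₁ x - a₂ x y`, `y' = ε (x - λ) + ε a₅ y + ε a₄ x²` itself; substituting
`x = r X`, `y = r² Y`, `ε = r² e`, `λ = r l` and rescaling time by `r` gives the general case.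
The rescaling chart `K₂` is `e = 1`. -/
def field (a : Coeffs) (r e l : ℝ) (z : Plane) : Plane :=
  ![-z 1 + z 0 ^ 2 + r * (e * a.a1 * z 0 - a.a2 * z 0 * z 1),
    e * (z 0 - l + r * (a.a4 * z 0 ^ 2 + a.a5 * z 1))]

/-- A point `(x₁, r₁, ε₁, λ₁, h₁)` of the entering and exiting chart `K₁`:
`x = r₁ x₁`, `y = r₁²`, `ε = r₁² ε₁`, `λ = r₁ λ₁`, `h = h₁ / r₁`. -/
@[ext] structure ChartPoint where
  x : ℝ
  r : ℝ
  e : ℝ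
  l : ℝ
  h : ℝ

/-- The center coordinates `(r₁, ε₁, λ₁, h₁)`. -/
def ChartPoint.base (p : ChartPoint) : ℝ × ℝ × ℝ × ℝ := (p.r, p.e, p.l, p.h)

/-- The desingularized Kahan map in chart `K₁`. In the coordinates rescaled by `r₁` the point is
`(X, Y) = (x₁, 1)` and the step size is `h₁`; the image `(X', Y')`, `Y' > 0`, is then written in
the coordinates of `K₁` again. -/
def ChartOneStep (a : Coeffs) (p q : ChartPoint) : Prop :=
  ∃ w : Plane, KahanStep (field a p.r p.e p.l) p.h ![p.x, 1] w ∧ 0 < w 1 ∧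
    q = ⟨w 0 / √(w 1), p.r * √(w 1), p.e / w 1, p.l / √(w 1), p.h * √(w 1)⟩

/-- The range of the center coordinates in chart `K₁`:
`0 ≤ r₁ ≤ ρ`, `0 ≤ ε₁ ≤ δ`, `|λ₁| ≤ κ`, `0 < h₁ ≤ ν`. -/
def baseDomain (ρ δ κ ν : ℝ) : Set (ℝ × ℝ × ℝ × ℝ) :=
  {b | (0 ≤ b.1 ∧ b.1 ≤ ρ) ∧ (0 ≤ b.2.1 ∧ b.2.1 ≤ δ) ∧ |b.2.2.1| ≤ κ ∧
    (0 < b.2.2.2 ∧ b.2.2.2 ≤ ν)}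

/-- The branch `N_{a,1}` on `{r₁ = λ₁ = 0, ε₁ > 0, h₁ > 0}`: the points having a backward orbit
along which `x₁ → -1` and `ε₁ → 0`. -/
def attractingBranch (a : Coeffs) : Set ChartPoint :=
  {q | q.r = 0 ∧ q.l = 0 ∧ 0 < q.e ∧ 0 < q.h ∧ ∃ p : ℕ → ChartPoint, p 0 = q ∧
    (∀ n, ChartOneStep a (p (n + 1)) (p n)) ∧
    Tendsto (fun n => (p n).x) atTop (𝓝 (-1)) ∧ Tendsto (fun n => (p n).e) atTop (𝓝 0)}

/-- The branch `N_{r,1}` on `{r₁ = λ₁ = 0, ε₁ > 0, h₁ > 0}`: the points having a forward orbit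
along which `x₁ → 1` and `ε₁ → 0`. -/
def repellingBranch (a : Coeffs) : Set ChartPoint :=
  {q | q.r = 0 ∧ q.l = 0 ∧ 0 < q.e ∧ 0 < q.h ∧ ∃ p : ℕ → ChartPoint, p 0 = q ∧
    (∀ n, ChartOneStep a (p n) (p (n + 1))) ∧
    Tendsto (fun n => (p n).x) atTop (𝓝 1) ∧ Tendsto (fun n => (p n).e) atTop (𝓝 0)}

/-- The common part of the definitions of the manifolds of chart `K₁`: `M` is a `C^k` graph
`x₁ = g(r₁, ε₁, λ₁, h₁)` over the given range; `M` is locally invariant (under the map and its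
inverse) on the side `s x₁ > 0`; and `M` contains the curves of fixed points of the map in
`{ε₁ = λ₁ = 0}` on that side, which start at `x₁ = s` for `r₁ = 0`. -/
def IsInvariantGraph (a : Coeffs) (k : ℕ) (ρ δ κ ν s : ℝ) (M : Set ChartPoint) : Prop :=
  (∃ g : ℝ × ℝ × ℝ × ℝ → ℝ, ContDiffOn ℝ k g (baseDomain ρ δ κ ν) ∧
    M = {p | p.base ∈ baseDomain ρ δ κ ν ∧ p.x = g p.base}) ∧
  (∀ p q : ChartPoint, p.base ∈ baseDomain ρ δ κ ν → q.base ∈ baseDomain ρ δ κ ν →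
    0 < s * p.x → 0 < s * q.x → ChartOneStep a p q → (p ∈ M ↔ q ∈ M)) ∧
  (∀ p : ChartPoint, p.base ∈ baseDomain ρ δ κ ν → p.e = 0 → p.l = 0 → 0 < s * p.x →
    ChartOneStep a p p → p ∈ M)

/-- `M` is a center-stable manifold `M̂_{a,1}`. -/
def IsCenterStable (a : Coeffs) (k : ℕ) (ρ δ κ ν : ℝ) (M : Set ChartPoint) : Prop :=
  IsInvariantGraph a k ρ δ κ ν (-1) M ∧
    ∀ p ∈ attractingBranch a, p.base ∈ baseDomain ρ δ κ ν → p ∈ M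

/-- `M` is a center-unstable manifold `M̂_{r,1}`. -/
def IsCenterUnstable (a : Coeffs) (k : ℕ) (ρ δ κ ν : ℝ) (M : Set ChartPoint) : Prop :=
  IsInvariantGraph a k ρ δ κ ν 1 M ∧
    ∀ p ∈ repellingBranch a, p.base ∈ baseDomain ρ δ κ ν → p ∈ M

/-- The coordinate change `κ₂₁` from `K₂` to `K₁` (for `y₂ > 0`). -/
def kappa21 (r l h : ℝ) (z : Plane) : ChartPoint :=
  ⟨z 0 / √(z 1), √(z 1) * r, 1 / z 1, l / √(z 1), h * √(z 1)⟩

/-- The slice of `κ₁₂(M)`, `κ₁₂ = κ₂₁⁻¹`, at fixed values `r₂ = r`, `λ₂ = l`, `h₂ = h`. -/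
def chartTwo (M : Set ChartPoint) (r l h : ℝ) : Set Plane :=
  {z | 0 < z 1 ∧ kappa21 r l h z ∈ M}

/-! ### Continuation in chart `K₂` -/

/-- The continuation of a set by the iterates of the Kahan map and of its inverse. -/
def orbitHull (f : Plane → Plane) (h : ℝ) (M : Set Plane) : Set Plane :=
  {z | ∃ m ∈ M, Relation.ReflTransGen (KahanStep f h) m z ∨
    Relation.ReflTransGen (KahanStep f h) z m}

/-- The sheet of the continuation obtained by following `M` forward as long as the orbits stay in
`{x < 0}`, including the first point outside. -/
def forwardSheet (f : Plane → Plane) (h : ℝ) (M : Set Plane) : Set Plane :=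
  {z | ∃ m ∈ M, Relation.ReflTransGen (fun u v => u 0 < 0 ∧ KahanStep f h u v) m z}

/-- The sheet of the continuation obtained by following `M` backward as long as the orbits stay in
`{x > 0}`, including the first point outside. -/
def backwardSheet (f : Plane → Plane) (h : ℝ) (M : Set Plane) : Set Plane :=
  {z | ∃ m ∈ M, Relation.ReflTransGen (fun u v => 0 < v 0 ∧ KahanStep f h u v) z m}

/-! ### The special trajectory and the one-parameter families -/

/-- The curve `γ̂` through the special trajectory: `γ_h(n)` is its value at the integer `n`. -/
def gammaCurve (h t : ℝ) : Plane := ![h * t / 2, h ^ 2 * t ^ 2 / 4 - 1 / 2 - h ^ 2 / 8]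

/-- The special trajectory `γ_h`. -/
def gamma (h : ℝ) (n : ℤ) : Plane := gammaCurve h n

/-- The section `Σ`: the line orthogonal to `γ̂'(0)`. -/
def crossSection (h : ℝ) : Set Plane := {z | z ⬝ᵥ deriv (gammaCurve h) 0 = 0}

/-- The choice of the bifurcation parameter: `μ = λ` (with `r = 0`) or `μ = r` (with `λ = 0`). -/
inductive Unfolding where
  | lambda
  | radius

/-- The value of `r`. -/
def Unfolding.r : Unfolding → ℝ → ℝ
  | .lambda, _ => 0
  | .radius, μ => μ

/-- The value of `λ`. -/
def Unfolding.l : Unfolding → ℝ → ℝ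
  | .lambda, μ => μ
  | .radius, _ => 0

/-- The admissible values of `μ`: all reals for `μ = λ`, and `μ ≥ 0` for `μ = r`. -/
def Unfolding.range : Unfolding → Set ℝ
  | .lambda => Set.univ
  | .radius => Set.Ici 0

/-- The vector field in chart `K₂` for the parameter value `μ`. -/
def unfoldedField (a : Coeffs) (c : Unfolding) (μ : ℝ) : Plane → Plane :=
  field a (c.r μ) 1 (c.l μ)

/-- The Kahan map in chart `K₂` for the parameter value `μ`. -/
def kahanTwo (a : Coeffs) (c : Unfolding) (h μ : ℝ) : Plane → Plane :=
  kahan (unfoldedField a c μ) h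

/-- The unperturbed map `F`. -/
def mapF (a : Coeffs) (c : Unfolding) (h : ℝ) : Plane → Plane := kahanTwo a c h 0

/-- The perturbation `G(z, μ)` in `kahanTwo a c h μ z = F(z) + μ G(z, μ)`: the difference quotient
in `μ`, and the derivative in `μ` at `μ = 0`. -/
def mapG (a : Coeffs) (c : Unfolding) (h : ℝ) (z : Plane) (μ : ℝ) : Plane :=
  dslope (fun m => kahanTwo a c h m z) 0 μ

/-- `ψ` is a trajectory of the adjoint map `ψ(n+1) = (DF(γ(n))ᵀ)⁻¹ ψ(n)`. -/
def IsAdjointSolution (a : Coeffs) (c : Unfolding) (h : ℝ) (ψ : ℤ → Plane) : Prop :=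
  ∀ n : ℤ, ψ (n + 1) = ((jacobian (mapF a c h) (gamma h n))ᵀ)⁻¹ *ᵥ ψ n

/-- `w` solves `w(n+1) = DF(γ(n)) w(n) + G(γ(n), 0)` for the integers `n` in `I`. -/
def IsVariationalSolution (a : Coeffs) (c : Unfolding) (h : ℝ) (I : Set ℤ) (w : ℤ → Plane) :
    Prop :=
  ∀ n ∈ I, w (n + 1) = jacobian (mapF a c h) (gamma h n) *ᵥ w n + mapG a c h (gamma h n) 0

/-- Exponential decay at `±∞`. -/
def DecaysExponentially (ψ : ℤ → Plane) : Prop :=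
  ∃ C c : ℝ, 0 < c ∧ ∀ n : ℤ, ‖ψ n‖ ≤ C * Real.exp (-c * |(n : ℝ)|)

end KahanCanard

end

noncomputable section
namespace KahanCanard

/-! ### The Kahan map in coordinates -/

/-! Three facts about the Kahan map carry the proof. It is equivalent to a bilinear relation
`Implicit` between consecutive points, which is unchanged when the points are swapped and `h`
becomes `-h` (`Implicit.symm`); so near the trajectory the inverse map is the Kahan map with step
`-h`. For `μ = 0` it sends `γ̂(t)` to `γ̂(t+1)` for every real `t` off the pole, so that a whole
parabola is invariant. The rescaling `kappa21` conjugates it to the map of chart `K₁`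
(`chartOneStep_kappa21`).

In `K₁` the orbits of `γ̂(t)` tend to `x₁ = ∓1`, `ε₁ = 0`. The arcs of `γ̂` in the range of the
chart therefore belong to the branches which the manifolds contain, and at `μ = 0` the slices of the
manifolds are exactly these arcs. On the repelling side an orbit may run into the pole; this
excludes only countably many times, which the continuity of the graph restores. Iterating the map
along `γ_h` gives item 1.

For item 2 both sides are treated at once through `IsSide`, with `η = h` or `η = -h`. The slices are
parametrized by the time `t` of `γ̂` at the same height. After `n` steps the slice at `μ = 0` is
`γ̂(t+n)`, which crosses `Σ` transversally at `t = -n`; an implicit function theorem, valid also at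
the endpoint of `[0, ∞)`, yields a smooth crossing (`IsSide.exists_hit`). It is the only one:
starting times with `t + j ≠ 0` for all `j` miss `Σ`, different starting times `-n` produce the same
point by local invariance (`IsSide.eventually_hit_eq`), and the range of times is compact.

Items 3 and 4 are linear algebra. By the adjoint equation `⟨ψ(n), w(n)⟩` changes in one step exactly
by `⟨ψ(n+1), G⟩`, so the sum telescopes; since `w_±(0) = Δ_±'(0) ψ(0)` and `ψ(0)` is a unit vector,
the difference of the pairings at `n = 0` is `d_μ`. The linearization along `γ_h` tends to a
diagonal matrix with entries `±1` and `G` grows at most polynomially, so `w_±` grow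
subexponentially, and exponential decay of `ψ` removes the boundary terms and makes the series
converge absolutely. -/

theorem hasFDerivAt_coord (i : Fin 2) (z : Plane) :
    HasFDerivAt (fun w : Plane => w i) (ContinuousLinearMap.proj (R := ℝ) i) z :=
  (ContinuousLinearMap.proj (R := ℝ) (φ := fun _ : Fin 2 => ℝ) i).hasFDerivAt

theorem jacobian_field (a : Coeffs) (r e l : ℝ) (z : Plane) :
    jacobian (field a r e l) z =
      !![2 * z 0 + r * (e * a.a1 - a.a2 * z 1), -1 - r * a.a2 * z 0;
        e * (1 + 2 * r * a.a4 * z 0), e * r * a.a5] := by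
  have h0 := hasFDerivAt_coord 0 z
  have h1 := hasFDerivAt_coord 1 z
  obtain ⟨L0, k0, e0⟩ : ∃ L : Plane →L[ℝ] ℝ, HasFDerivAt (fun w => field a r e l w 0) L z ∧
      ∀ v, L v = (2 * z 0 + r * (e * a.a1 - a.a2 * z 1)) * v 0 + (-1 - r * a.a2 * z 0) * v 1 :=
    ⟨_, (h1.neg.add (h0.pow 2)).add
      (((h0.const_mul (e * a.a1)).sub ((h0.const_mul a.a2).mul h1)).const_mul r),
      fun v => by simp; ring⟩
  obtain ⟨L1, k1, e1⟩ : ∃ L : Plane →L[ℝ] ℝ, HasFDerivAt (fun w => field a r e l w 1) L z ∧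
      ∀ v, L v = (e * (1 + 2 * r * a.a4 * z 0)) * v 0 + (e * r * a.a5) * v 1 :=
    ⟨_, ((h0.sub_const l).add
      ((((h0.pow 2).const_mul a.a4).add (h1.const_mul a.a5)).const_mul r)).const_mul e,
      fun v => by simp; ring⟩
  have key : HasFDerivAt (field a r e l) (ContinuousLinearMap.pi ![L0, L1]) z :=
    hasFDerivAt_pi.2 (Fin.forall_fin_two.2 ⟨k0, k1⟩)
  unfold jacobian
  rw [key.fderiv]
  ext i j
  fin_cases i <;> fin_cases j <;> simp [LinearMap.toMatrix'_apply, e0, e1]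

/-- The determinant of `Id - (h/2) Df(z)`. -/
def kahanDet (a : Coeffs) (r e h : ℝ) (z : Plane) : ℝ :=
  (1 - h / 2 * (2 * z 0 + r * (e * a.a1 - a.a2 * z 1))) * (1 - h / 2 * (e * r * a.a5)) -
    (h / 2 * (1 + r * a.a2 * z 0)) * (-(h / 2 * (e * (1 + 2 * r * a.a4 * z 0))))

theorem kahanMatrix_field (a : Coeffs) (r e l h : ℝ) (z : Plane) :
    kahanMatrix (field a r e l) h z =
      !![1 - h / 2 * (2 * z 0 + r * (e * a.a1 - a.a2 * z 1)), h / 2 * (1 + r * a.a2 * z 0);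
        -(h / 2 * (e * (1 + 2 * r * a.a4 * z 0))), 1 - h / 2 * (e * r * a.a5)] := by
  rw [kahanMatrix, jacobian_field]
  ext i j
  fin_cases i <;> fin_cases j <;> simp <;> ring

theorem det_kahanMatrix_field (a : Coeffs) (r e l h : ℝ) (z : Plane) :
    (kahanMatrix (field a r e l) h z).det = kahanDet a r e h z := by
  rw [kahanMatrix_field, Matrix.det_fin_two_of, kahanDet]

/-- The Kahan map in coordinates. -/
theorem kahan_field (a : Coeffs) (r e l h : ℝ) (z : Plane) :
    kahan (field a r e l) h z =
      ![z 0 + h * (((1 - h / 2 * (e * r * a.a5)) * field a r e l z 0 -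
          h / 2 * (1 + r * a.a2 * z 0) * field a r e l z 1) / kahanDet a r e h z),
        z 1 + h * ((h / 2 * (e * (1 + 2 * r * a.a4 * z 0)) * field a r e l z 0 +
          (1 - h / 2 * (2 * z 0 + r * (e * a.a1 - a.a2 * z 1))) * field a r e l z 1) /
            kahanDet a r e h z)] := by
  rw [kahan, Matrix.inv_def, det_kahanMatrix_field, kahanMatrix_field, Matrix.adjugate_fin_two_of,
    Ring.inverse_eq_inv']
  ext i
  fin_cases i <;> (simp [dotProduct, Fin.sum_univ_two, -mul_eq_mul_left_iff]; ring)

/-- The symmetric implicit form of the Kahan discretization. -/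
def Implicit (a : Coeffs) (r e l h : ℝ) (u v : Plane) : Prop :=
  v 0 - u 0 = h * (-(u 1 + v 1) / 2 + u 0 * v 0 +
    r * (e * a.a1 * ((u 0 + v 0) / 2) - a.a2 * ((u 0 * v 1 + u 1 * v 0) / 2))) ∧
  v 1 - u 1 = h * (e * ((u 0 + v 0) / 2 - l +
    r * (a.a4 * (u 0 * v 0) + a.a5 * ((u 1 + v 1) / 2))))

/-- Time reversal of the Kahan scheme: backward orbits are forward orbits for the step `-h`. This
reduces the repelling side to the attracting one. -/
theorem Implicit.symm {a : Coeffs} {r e l h : ℝ} {u v : Plane} (H : Implicit a r e l h u v) :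
    Implicit a r e l (-h) v u :=
  ⟨by linear_combination -H.1, by linear_combination -H.2⟩

/-- The relation is the polarization of the quadratic field, hence affine in `v`, with linear part
`Id - (h/2) Df(u)`; it determines `v` by Cramer's rule. -/
theorem eq_kahan_iff {a : Coeffs} {r e l h : ℝ} {u v : Plane} (hd : kahanDet a r e h u ≠ 0) :
    v = kahan (field a r e l) h u ↔ Implicit a r e l h u v := by
  have e0 : field a r e l u 0 =
    -u 1 + u 0 ^ 2 + r * (e * a.a1 * u 0 - a.a2 * u 0 * u 1) := rfl
  have e1 : field a r e l u 1 = e * (u 0 - l + r * (a.a4 * u 0 ^ 2 + a.a5 * u 1)) := rfl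
  rw [kahan_field]
  constructor
  · intro hv
    have v0 := congrFun hv 0
    have v1 := congrFun hv 1
    simp only [Matrix.cons_val_zero, Matrix.cons_val_one] at v0 v1
    constructor
    · rw [v0, v1]; rw [e0, e1]; field_simp; rw [kahanDet]; ring
    · rw [v0, v1]; rw [e0, e1]; field_simp; rw [kahanDet]; ring
  · rintro ⟨H0, H1⟩
    ext i
    fin_cases i
    · simp only [Fin.zero_eta, Matrix.cons_val_zero]
      rw [← sub_eq_iff_eq_add', ← mul_div_assoc, eq_div_iff hd, e0, e1, kahanDet]
      -- The coefficients here and in the second coordinate are the rows of the adjugate of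
      -- `kahanMatrix`.
      linear_combination (1 - h / 2 * (e * r * a.a5)) * H0 - h / 2 * (1 + r * a.a2 * u 0) * H1
    · simp only [Fin.mk_one, Matrix.cons_val_one, Matrix.cons_val_fin_one]
      rw [← sub_eq_iff_eq_add', ← mul_div_assoc, eq_div_iff hd, e0, e1, kahanDet]
      linear_combination (h / 2 * (e * (1 + 2 * r * a.a4 * u 0))) * H0 +
        (1 - h / 2 * (2 * u 0 + r * (e * a.a1 - a.a2 * u 1))) * H1

theorem kahanStep_iff {a : Coeffs} {r e l h : ℝ} {u v : Plane} :
    KahanStep (field a r e l) h u v ↔ kahanDet a r e h u ≠ 0 ∧ Implicit a r e l h u v := by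
  rw [KahanStep, det_kahanMatrix_field]
  exact and_congr_right fun hd => eq_kahan_iff hd

/-- The coordinate change to chart `K₁` conjugates the Kahan maps of the two charts. -/
theorem chartOneStep_kappa21 {a : Coeffs} {r l h : ℝ} {u v : Plane} (hu : 0 < u 1) (hv : 0 < v 1)
    (H : KahanStep (field a r 1 l) h u v) :
    ChartOneStep a (kappa21 r l h u) (kappa21 r l h v) := by
  obtain ⟨hd, H0, H1⟩ := kahanStep_iff.1 H
  -- Square roots `s`, `q` of the two heights make all identities rational. In the units of `u` the
  -- image is `(v₀/s, q²/s²)`, and the root `q/s` of its height converts the units of `u` into those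
  -- of `v`.
  obtain ⟨s, hs, hsu⟩ : ∃ s : ℝ, 0 < s ∧ u 1 = s ^ 2 :=
    ⟨√(u 1), Real.sqrt_pos.2 hu, (Real.sq_sqrt hu.le).symm⟩
  obtain ⟨q, hq, hqv⟩ : ∃ s : ℝ, 0 < s ∧ v 1 = s ^ 2 :=
    ⟨√(v 1), Real.sqrt_pos.2 hv, (Real.sq_sqrt hv.le).symm⟩
  have es : √(s ^ 2) = s := Real.sqrt_sq hs.le
  have eq : √(q ^ 2) = q := Real.sqrt_sq hq.le
  have ew : √(q ^ 2 / s ^ 2) = q / s := by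
    rw [Real.sqrt_div (sq_nonneg _), es, eq]
  refine ⟨![v 0 / s, q ^ 2 / s ^ 2], kahanStep_iff.2 ⟨?_, ?_, ?_⟩, ?_, ?_⟩
  · convert hd using 1
    simp only [kappa21, es, kahanDet, Matrix.cons_val_zero, Matrix.cons_val_one, hsu]
    field_simp
  · simp only [kappa21, es, Matrix.cons_val_zero, Matrix.cons_val_one, hsu]
    rw [hsu, hqv] at H0
    field_simp
    linear_combination 2 * H0
  · simp only [kappa21, es, Matrix.cons_val_zero, Matrix.cons_val_one, hsu]
    rw [hsu, hqv] at H1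
    field_simp
    linear_combination 2 * H1
  · exact div_pos (pow_pos hq 2) (pow_pos hs 2)
  · simp only [kappa21, es, eq, Matrix.cons_val_zero, Matrix.cons_val_one, hsu, hqv, ew]
    ext <;> simp <;> field_simp

/-! ### The special trajectory -/

@[simp] theorem gammaCurve_zero (h t : ℝ) : gammaCurve h t 0 = h * t / 2 := rfl

@[simp] theorem gammaCurve_one (h t : ℝ) :
    gammaCurve h t 1 = h ^ 2 * t ^ 2 / 4 - 1 / 2 - h ^ 2 / 8 := rfl

/-- Time reversal on the special curve: for the step `-h` it is traversed backward. -/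
theorem gammaCurve_neg (h t : ℝ) : gammaCurve (-h) t = gammaCurve h (-t) := by
  ext i; fin_cases i <;> simp

@[simp] theorem Unfolding.r_zero (c : Unfolding) : c.r 0 = 0 := by cases c <;> rfl

@[simp] theorem Unfolding.l_zero (c : Unfolding) : c.l 0 = 0 := by cases c <;> rfl

theorem unfoldedField_zero (a : Coeffs) (c : Unfolding) :
    unfoldedField a c 0 = field a 0 1 0 := by
  simp [unfoldedField]

theorem kahanDet_zero (a : Coeffs) (h : ℝ) (z : Plane) :
    kahanDet a 0 1 h z = 1 - h * z 0 + h ^ 2 / 4 := by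
  rw [kahanDet]; ring

theorem kahanDet_gammaCurve (a : Coeffs) (h t : ℝ) :
    kahanDet a 0 1 h (gammaCurve h t) = 1 - h ^ 2 * t / 2 + h ^ 2 / 4 := by
  rw [kahanDet_zero, gammaCurve_zero]; ring

theorem kahanDet_gammaCurve_neg (a : Coeffs) (h t : ℝ) :
    kahanDet a 0 1 (-h) (gammaCurve h t) = 1 + h ^ 2 * t / 2 + h ^ 2 / 4 := by
  rw [kahanDet_zero, gammaCurve_zero]; ring

/-- Real times are allowed, so the whole parabola is invariant and not just one orbit on it; the
pole plays no role in the implicit form. -/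
theorem implicit_gammaCurve (a : Coeffs) (h t : ℝ) :
    Implicit a 0 1 0 h (gammaCurve h t) (gammaCurve h (t + 1)) := by
  constructor <;> simp only [gammaCurve_zero, gammaCurve_one] <;> ring

theorem kahan_gammaCurve {a : Coeffs} {h t : ℝ} (ht : 1 - h ^ 2 * t / 2 + h ^ 2 / 4 ≠ 0) :
    kahan (field a 0 1 0) h (gammaCurve h t) = gammaCurve h (t + 1) := by
  rw [← kahanDet_gammaCurve a] at ht
  exact ((eq_kahan_iff ht).2 (implicit_gammaCurve a h t)).symm

theorem kahanStep_gammaCurve {a : Coeffs} {h t : ℝ} (ht : 1 - h ^ 2 * t / 2 + h ^ 2 / 4 ≠ 0) :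
    KahanStep (field a 0 1 0) h (gammaCurve h t) (gammaCurve h (t + 1)) := by
  rw [kahanStep_iff, kahanDet_gammaCurve]
  exact ⟨ht, implicit_gammaCurve a h t⟩

/-- The only pole on the curve is at `t = 2/h² + 1/2 > 0`, so times `t ≤ 0` are always safe. -/
theorem kahanDet_pos_of_nonpos {h t : ℝ} (ht : t ≤ 0) : 0 < 1 - h ^ 2 * t / 2 + h ^ 2 / 4 := by
  nlinarith [mul_nonneg (sq_nonneg h) (neg_nonneg.2 ht), sq_nonneg h]

/-- The trajectory `γ_h` avoids the poles of the Kahan map. -/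
theorem kahanDet_int_ne_zero {h : ℝ} (hpole : ∀ n : ℕ, h ^ 2 * (2 * (n : ℝ) - 1) ≠ 4) (n : ℤ) :
    1 - h ^ 2 * (n : ℝ) / 2 + h ^ 2 / 4 ≠ 0 := by
  obtain ⟨m, rfl | rfl⟩ := n.eq_nat_or_neg
  · intro H
    refine hpole m ?_
    push_cast at H
    linear_combination -4 * H
  · exact (kahanDet_pos_of_nonpos (by simp)).ne'

theorem hasDerivAt_gammaCurve (h t : ℝ) :
    HasDerivAt (gammaCurve h) ![h / 2, h ^ 2 * t / 2] t := by
  have h0 : HasDerivAt (fun s : ℝ => h * s / 2) (h / 2) t := by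
    convert! ((hasDerivAt_id t).const_mul h).div_const 2 using 1; simp
  have h1 : HasDerivAt (fun s : ℝ => h ^ 2 * s ^ 2 / 4 - 1 / 2 - h ^ 2 / 8) (h ^ 2 * t / 2) t := by
    convert! (((((hasDerivAt_id t).pow 2).const_mul (h ^ 2)).div_const 4).sub_const
      (1 / 2)).sub_const (h ^ 2 / 8) using 1
    simp; ring
  exact hasDerivAt_pi.2 (Fin.forall_fin_two.2 ⟨h0, h1⟩)

theorem deriv_gammaCurve_zero (h : ℝ) : deriv (gammaCurve h) 0 = ![h / 2, 0] := by
  rw [(hasDerivAt_gammaCurve h 0).deriv]; simp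

theorem mem_crossSection {h : ℝ} (hh : h ≠ 0) {z : Plane} : z ∈ crossSection h ↔ z 0 = 0 := by
  rw [crossSection, Set.mem_ofPred_eq, deriv_gammaCurve_zero]
  simp [dotProduct, Fin.sum_univ_two, hh]

theorem contDiff_gammaCurve (h : ℝ) {n : WithTop ℕ∞} : ContDiff ℝ n (gammaCurve h) := by
  refine contDiff_pi.2 (Fin.forall_fin_two.2 ⟨?_, ?_⟩)
  · simp only [gammaCurve_zero]; fun_prop
  · simp only [gammaCurve_one]; fun_prop

theorem continuous_gammaCurve (h : ℝ) : Continuous (gammaCurve h) :=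
  (contDiff_gammaCurve h (n := 0)).continuous

/-! ### Smoothness of the Kahan map of chart `K₂` -/

theorem Unfolding.contDiff_r (c : Unfolding) {n : WithTop ℕ∞} : ContDiff ℝ n c.r := by
  cases c
  · exact contDiff_const
  · exact contDiff_id

theorem Unfolding.contDiff_l (c : Unfolding) {n : WithTop ℕ∞} : ContDiff ℝ n c.l := by
  cases c
  · exact contDiff_id
  · exact contDiff_const

theorem contDiff_kahanDet (a : Coeffs) (c : Unfolding) (h : ℝ) {n : WithTop ℕ∞} :
    ContDiff ℝ n fun p : ℝ × Plane => kahanDet a (c.r p.1) 1 h p.2 := by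
  have hr : ContDiff ℝ n fun p : ℝ × Plane => c.r p.1 := c.contDiff_r.comp contDiff_fst
  unfold kahanDet
  fun_prop

theorem contDiffAt_kahanTwo (a : Coeffs) (c : Unfolding) (h : ℝ) {n : WithTop ℕ∞}
    {p : ℝ × Plane} (hp : kahanDet a (c.r p.1) 1 h p.2 ≠ 0) :
    ContDiffAt ℝ n (fun q : ℝ × Plane => kahanTwo a c h q.1 q.2) p := by
  have hr : ContDiff ℝ n fun p : ℝ × Plane => c.r p.1 := c.contDiff_r.comp contDiff_fst
  have hl : ContDiff ℝ n fun p : ℝ × Plane => c.l p.1 := c.contDiff_l.comp contDiff_fst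
  have hd : ContDiffAt ℝ n (fun p : ℝ × Plane => kahanDet a (c.r p.1) 1 h p.2) p :=
    (contDiff_kahanDet a c h).contDiffAt
  have f0 : ContDiff ℝ n fun p : ℝ × Plane => field a (c.r p.1) 1 (c.l p.1) p.2 0 := by
    simp only [field, Matrix.cons_val_zero]; fun_prop
  have f1 : ContDiff ℝ n fun p : ℝ × Plane => field a (c.r p.1) 1 (c.l p.1) p.2 1 := by
    simp only [field, Matrix.cons_val_one, Matrix.cons_val_fin_one]; fun_prop
  simp only [kahanTwo, unfoldedField, kahan_field]
  refine contDiffAt_pi.2 (Fin.forall_fin_two.2 ⟨?_, ?_⟩)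
  · simp only [Matrix.cons_val_zero]
    refine ContDiffAt.add (by fun_prop) (contDiffAt_const.mul (ContDiffAt.div ?_ hd hp))
    exact ContDiff.contDiffAt (by fun_prop)
  · simp only [Matrix.cons_val_one, Matrix.cons_val_fin_one]
    refine ContDiffAt.add (by fun_prop) (contDiffAt_const.mul (ContDiffAt.div ?_ hd hp))
    exact ContDiff.contDiffAt (by fun_prop)

/-! ### An implicit function theorem with a parameter in a subset of the line -/

/-- The zeros of a continuous family of strictly increasing functions depend continuously on the
parameter. -/
theorem exists_continuousOn_zero {J : Set ℝ} {Ξ : ℝ × ℝ → ℝ} {μ₀ t₀ ε : ℝ} (hε : 0 < ε)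
    (h0 : μ₀ ∈ J) (hΞ : ContinuousOn Ξ (J ×ˢ Set.Ioo (t₀ - ε) (t₀ + ε)))
    (hmono : ∀ μ ∈ J, StrictMonoOn (fun t => Ξ (μ, t)) (Set.Ioo (t₀ - ε) (t₀ + ε)))
    (hz : Ξ (μ₀, t₀) = 0) :
    ∃ τ : ℝ → ℝ, ∃ U ∈ 𝓝 μ₀, τ μ₀ = t₀ ∧ ContinuousOn τ (J ∩ U) ∧
      ∀ μ ∈ J ∩ U, τ μ ∈ Set.Ioo (t₀ - ε) (t₀ + ε) ∧ Ξ (μ, τ μ) = 0 := by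
  have slice : ∀ t ∈ Set.Ioo (t₀ - ε) (t₀ + ε), ContinuousOn (fun μ => Ξ (μ, t)) J := fun t ht =>
    hΞ.comp (by fun_prop) fun μ hμ => ⟨hμ, ht⟩
  have ht₀ : t₀ ∈ Set.Ioo (t₀ - ε) (t₀ + ε) := ⟨by linarith, by linarith⟩
  have hm : t₀ - ε / 2 ∈ Set.Ioo (t₀ - ε) (t₀ + ε) := ⟨by linarith, by linarith⟩
  have hp : t₀ + ε / 2 ∈ Set.Ioo (t₀ - ε) (t₀ + ε) := ⟨by linarith, by linarith⟩
  have hneg : Ξ (μ₀, t₀ - ε / 2) < 0 := hz ▸ hmono μ₀ h0 hm ht₀ (by linarith)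
  have hpos : 0 < Ξ (μ₀, t₀ + ε / 2) := hz ▸ hmono μ₀ h0 ht₀ hp (by linarith)
  have key : ∀ᶠ μ in 𝓝[J] μ₀, ∃ t ∈ Set.Ioo (t₀ - ε) (t₀ + ε), Ξ (μ, t) = 0 := by
    filter_upwards [(slice _ hm μ₀ h0).eventually_lt_const hneg,
      (slice _ hp μ₀ h0).eventually_const_lt hpos, self_mem_nhdsWithin] with μ h1 h2 hμ
    have hsub : Set.Icc (t₀ - ε / 2) (t₀ + ε / 2) ⊆ Set.Ioo (t₀ - ε) (t₀ + ε) :=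
      fun t ht => ⟨by linarith [ht.1], by linarith [ht.2]⟩
    have hc : ContinuousOn (fun t => Ξ (μ, t)) (Set.Icc (t₀ - ε / 2) (t₀ + ε / 2)) :=
      hΞ.comp (by fun_prop) fun t ht => ⟨hμ, hsub ht⟩
    obtain ⟨t, ht, h⟩ := intermediate_value_Icc (by linarith) hc ⟨h1.le, h2.le⟩
    exact ⟨t, hsub ht, h⟩
  obtain ⟨U, hU, hUJ⟩ := mem_nhdsWithin_iff_exists_mem_nhds_inter.1 key
  choose! τ hτ hτ0 using fun μ (hμ : μ ∈ U ∩ J) => hUJ hμ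
  have h0U : μ₀ ∈ U ∩ J := ⟨mem_of_mem_nhds hU, h0⟩
  have uniq : ∀ μ ∈ U ∩ J, ∀ t ∈ Set.Ioo (t₀ - ε) (t₀ + ε), Ξ (μ, t) = 0 → t = τ μ :=
    fun μ hμ t ht h => (hmono μ hμ.2).injOn ht (hτ μ hμ) (h.trans (hτ0 μ hμ).symm)
  refine ⟨τ, U, hU, (uniq μ₀ h0U t₀ ht₀ hz).symm, fun μ hμ => ?_,
    fun μ hμ => ⟨hτ μ hμ.symm, hτ0 μ hμ.symm⟩⟩
  rw [Set.inter_comm] at hμ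
  have hτμ := hτ μ hμ
  rw [ContinuousWithinAt, tendsto_order]
  constructor
  · intro b hb
    -- The sign of `Ξ` at a point `b'` strictly between `b` and the zero persists for nearby
    -- parameters, and monotonicity then keeps their zeros on the far side of `b'`.
    obtain ⟨b', hb1, hb2⟩ := exists_between (max_lt hb hτμ.1)
    have hb' : b' ∈ Set.Ioo (t₀ - ε) (t₀ + ε) :=
      ⟨(le_max_right _ _).trans_lt hb1, hb2.trans hτμ.2⟩
    have hlt : Ξ (μ, b') < 0 := hτ0 μ hμ ▸ hmono μ hμ.2 hb' hτμ hb2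
    filter_upwards [((slice b' hb' μ hμ.2).mono Set.inter_subset_left).eventually_lt_const hlt,
      self_mem_nhdsWithin] with ν hν hν'
    refine ((le_max_left _ _).trans_lt hb1).trans ?_
    by_contra! hle
    exact ((hτ0 ν hν'.symm ▸ (hmono ν hν'.1).monotoneOn (hτ ν hν'.symm) hb' hle).trans_lt hν).false
  · intro b hb
    obtain ⟨b', hb1, hb2⟩ := exists_between (lt_min hb hτμ.2)
    have hb' : b' ∈ Set.Ioo (t₀ - ε) (t₀ + ε) :=
      ⟨hτμ.1.trans hb1, hb2.trans_le (min_le_right _ _)⟩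
    have hlt : 0 < Ξ (μ, b') := hτ0 μ hμ ▸ hmono μ hμ.2 hτμ hb' hb1
    filter_upwards [((slice b' hb' μ hμ.2).mono Set.inter_subset_left).eventually_const_lt hlt,
      self_mem_nhdsWithin] with ν hν hν'
    refine lt_of_lt_of_le ?_ (hb2.le.trans (min_le_left _ _))
    by_contra! hle
    have := (hmono ν hν'.1).monotoneOn hb' (hτ ν hν'.symm) hle
    exact (hν.trans_le (this.trans_eq (hτ0 ν hν'.symm))).false

/-- A continuous solution `τ` of `Ξ (μ, τ μ) = 0` is differentiable where `∂Ξ/∂t ≠ 0`. -/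
theorem hasDerivWithinAt_of_zero {J : Set ℝ} {S : Set (ℝ × ℝ)} {Ξ : ℝ × ℝ → ℝ} {τ : ℝ → ℝ} {μ : ℝ}
    {L : ℝ × ℝ →L[ℝ] ℝ} (hμ : μ ∈ J) (hτ : ContinuousWithinAt τ J μ)
    (hS : ∀ ν ∈ J, (ν, τ ν) ∈ S) (hL : HasFDerivWithinAt Ξ L S (μ, τ μ)) (hL0 : L (0, 1) ≠ 0)
    (hz : ∀ ν ∈ J, Ξ (ν, τ ν) = 0) :
    HasDerivWithinAt τ (-(L (1, 0) / L (0, 1))) J μ := by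
  have hLe : ∀ x y : ℝ, L (x, y) = L (1, 0) * x + L (0, 1) * y := by
    intro x y
    have : ((x, y) : ℝ × ℝ) = x • (1, 0) + y • (0, 1) := by simp
    rw [this, map_add, map_smul, map_smul]
    simp [mul_comm]
  -- The derivative of `(μ, t) ↦ (μ, Ξ(μ, t))`: triangular, with diagonal `1` and `L (0, 1)`.
  let e : (ℝ × ℝ) ≃L[ℝ] (ℝ × ℝ) := ContinuousLinearEquiv.equivOfInverse
    ((ContinuousLinearMap.fst ℝ ℝ ℝ).prod L)
    ((ContinuousLinearMap.fst ℝ ℝ ℝ).prod ((L (0, 1))⁻¹ •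
      (ContinuousLinearMap.snd ℝ ℝ ℝ - L (1, 0) • ContinuousLinearMap.fst ℝ ℝ ℝ)))
    (fun p => by
      ext
      · simp
      · simp [hLe p.1 p.2]; field_simp)
    (fun p => by
      ext
      · simp
      · simp [hLe p.1 _]; field_simp; ring)
  have hf : HasFDerivWithinAt (fun p : ℝ × ℝ => (p.1, Ξ p)) (e : ℝ × ℝ →L[ℝ] ℝ × ℝ) S
      (μ, τ μ) := hasFDerivWithinAt_fst.prodMk hL
  have hg : Tendsto (fun p : ℝ × ℝ => (p.1, τ p.1)) (𝓝[J ×ˢ {0}] (μ, 0)) (𝓝[S] (μ, τ μ)) := by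
    refine tendsto_nhdsWithin_iff.2 ⟨?_, ?_⟩
    · have h1 : Tendsto (fun p : ℝ × ℝ => p.1) (𝓝[J ×ˢ {0}] (μ, 0)) (𝓝[J] μ) :=
        tendsto_nhdsWithin_iff.2 ⟨continuous_fst.continuousWithinAt,
          eventually_mem_nhdsWithin.mono fun p hp => hp.1⟩
      rw [nhds_prod_eq]
      exact (h1.mono_right nhdsWithin_le_nhds).prodMk (hτ.tendsto.comp h1)
    · exact eventually_mem_nhdsWithin.mono fun p hp => hS _ hp.1
  -- The inverse is differentiated only within `J × {0}`, where `p ↦ (p.1, τ p.1)` is a right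
  -- inverse of `(μ, t) ↦ (μ, Ξ(μ, t))`. Hence `μ` need not be interior to `J`.
  have H := HasFDerivWithinAt.of_local_left_inverse (g := fun p : ℝ × ℝ => (p.1, τ p.1))
    (a := (μ, 0)) hg hf ⟨hμ, rfl⟩ (eventually_mem_nhdsWithin.mono fun p hp => by
      have h2 : p.2 = 0 := hp.2
      rw [hz _ hp.1, ← h2])
  have hm : HasFDerivWithinAt (fun ν : ℝ => (ν, (0 : ℝ))) (ContinuousLinearMap.inl ℝ ℝ ℝ) J μ :=
    (ContinuousLinearMap.inl ℝ ℝ ℝ).hasFDerivWithinAt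
  have hmaps : Set.MapsTo (fun ν : ℝ => (ν, (0 : ℝ))) J (J ×ˢ {0}) := fun ν hν => ⟨hν, rfl⟩
  have H2 := (H.comp μ hm hmaps).snd
  refine HasDerivWithinAt.congr_deriv (f := τ) H2.hasDerivWithinAt ?_
  change (L (0, 1))⁻¹ * (0 - L (1, 0) * 1) = _
  ring

/-- A solution `τ` of `Ξ (μ, τ μ) = 0` is as smooth as `Ξ` if `∂Ξ/∂t ≠ 0`. -/
theorem contDiffOn_of_zero {J : Set ℝ} {S : Set (ℝ × ℝ)} {Ξ : ℝ × ℝ → ℝ} {τ : ℝ → ℝ} {k : ℕ}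
    (hJ : UniqueDiffOn ℝ J) (hSu : UniqueDiffOn ℝ S) (hk : 1 ≤ k) (hΞ : ContDiffOn ℝ k Ξ S)
    (hτ : ContinuousOn τ J) (hS : ∀ μ ∈ J, (μ, τ μ) ∈ S)
    (hL : ∀ p ∈ S, fderivWithin ℝ Ξ S p (0, 1) ≠ 0) (hz : ∀ μ ∈ J, Ξ (μ, τ μ) = 0) :
    ContDiffOn ℝ k τ J := by
  have hk' : (1 : WithTop ℕ∞) ≤ k := by exact_mod_cast hk
  have hd : ∀ μ ∈ J, HasDerivWithinAt τ (-(fderivWithin ℝ Ξ S (μ, τ μ) (1, 0) /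
      fderivWithin ℝ Ξ S (μ, τ μ) (0, 1))) J μ := fun μ hμ =>
    hasDerivWithinAt_of_zero hμ (hτ μ hμ) hS
      ((hΞ.differentiableOn (by positivity)) _ (hS μ hμ)).hasFDerivWithinAt (hL _ (hS μ hμ)) hz
  -- Bootstrapping: the formula for `τ'` involves only `τ` and the first derivative of `Ξ`, so `τ ∈
  -- C^j` implies `τ' ∈ C^j` as long as `j + 1 ≤ k`.
  suffices H : ∀ j : ℕ, j ≤ k → ContDiffOn ℝ j τ J from H k le_rfl
  intro j
  induction j with
  | zero => intro _; exact contDiffOn_zero.2 hτ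
  | succ j ih =>
    intro hj
    have ihj := ih (by omega)
    push_cast
    rw [contDiffOn_succ_iff_derivWithin hJ]
    refine ⟨fun μ hμ => (hd μ hμ).differentiableWithinAt, fun h => by simp at h, ?_⟩
    have hfd : ContDiffOn ℝ j (fderivWithin ℝ Ξ S) S :=
      hΞ.fderivWithin hSu (by exact_mod_cast hj)
    have hcomp : ContDiffOn ℝ j (fun μ => fderivWithin ℝ Ξ S (μ, τ μ)) J :=
      hfd.comp (contDiffOn_id.prodMk ihj) hS
    have h1 : ContDiffOn ℝ j (fun μ => fderivWithin ℝ Ξ S (μ, τ μ) (1, 0)) J :=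
      hcomp.clm_apply contDiffOn_const
    have h2 : ContDiffOn ℝ j (fun μ => fderivWithin ℝ Ξ S (μ, τ μ) (0, 1)) J :=
      hcomp.clm_apply contDiffOn_const
    exact (h1.div h2 fun μ hμ => hL _ (hS μ hμ)).neg.congr fun μ hμ =>
      (hd μ hμ).derivWithin (hJ μ hμ)

/-- The implicit function theorem for `Ξ (μ, t) = 0` with `μ` in a subset `J` of the line, near a
point of `J` which may be a boundary point. -/
theorem exists_implicit_function {J : Set ℝ} (hJ : UniqueDiffOn ℝ J) {Ξ : ℝ × ℝ → ℝ}
    {μ₀ t₀ ε α : ℝ} (hε : 0 < ε) (h0 : μ₀ ∈ J) {k : ℕ} (hk : 1 ≤ k)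
    (hΞ : ContDiffOn ℝ k Ξ ((J ∩ Set.Ioo (μ₀ - ε) (μ₀ + ε)) ×ˢ Set.Ioo (t₀ - ε) (t₀ + ε)))
    (hz : Ξ (μ₀, t₀) = 0) (hα : 0 < α) (hd : HasDerivAt (fun t => Ξ (μ₀, t)) α t₀) :
    ∃ τ : ℝ → ℝ, ∃ ε' : ℝ, 0 < ε' ∧ ε' ≤ ε ∧ τ μ₀ = t₀ ∧
      ContDiffOn ℝ k τ (J ∩ Set.Ioo (μ₀ - ε') (μ₀ + ε')) ∧
      ∀ μ ∈ J ∩ Set.Ioo (μ₀ - ε') (μ₀ + ε'), τ μ ∈ Set.Ioo (t₀ - ε) (t₀ + ε) ∧ Ξ (μ, τ μ) = 0 ∧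
        ∀ t ∈ Set.Ioo (t₀ - ε') (t₀ + ε'), Ξ (μ, t) = 0 → t = τ μ := by
  have hk' : (1 : WithTop ℕ∞) ≤ k := by exact_mod_cast hk
  have box : ∀ d : ℝ, UniqueDiffOn ℝ
      ((J ∩ Set.Ioo (μ₀ - d) (μ₀ + d)) ×ˢ Set.Ioo (t₀ - d) (t₀ + d)) := fun d =>
    (hJ.inter isOpen_Ioo).prod isOpen_Ioo.uniqueDiffOn
  set S := (J ∩ Set.Ioo (μ₀ - ε) (μ₀ + ε)) ×ˢ Set.Ioo (t₀ - ε) (t₀ + ε) with hSdef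
  have hmem : (μ₀, t₀) ∈ S :=
    ⟨⟨h0, by constructor <;> linarith⟩, by constructor <;> linarith⟩
  have hvert : ∀ μ ∈ J ∩ Set.Ioo (μ₀ - ε) (μ₀ + ε), ∀ t ∈ Set.Ioo (t₀ - ε) (t₀ + ε),
      HasDerivAt (fun s => Ξ (μ, s)) (fderivWithin ℝ Ξ S (μ, t) (0, 1)) t := by
    intro μ hμ t ht
    have h1 := (hΞ.differentiableOn (by positivity) (μ, t) ⟨hμ, ht⟩).hasFDerivWithinAt
    have h2 : HasDerivWithinAt (fun s : ℝ => (μ, s)) (0, 1) (Set.Ioo (t₀ - ε) (t₀ + ε)) t :=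
      (hasDerivWithinAt_const _ _ _).prodMk (hasDerivWithinAt_id _ _)
    exact (h1.comp_hasDerivWithinAt t h2 fun s hs => ⟨hμ, hs⟩).hasDerivAt
      (isOpen_Ioo.mem_nhds ht)
  have hB : ContinuousOn (fun p => fderivWithin ℝ Ξ S p (0, 1)) S :=
    (hΞ.continuousOn_fderivWithin (box ε) hk').clm_apply continuousOn_const
  have hB0 : 0 < fderivWithin ℝ Ξ S (μ₀, t₀) (0, 1) := by
    rwa [(hvert μ₀ hmem.1 t₀ hmem.2).unique hd]
  -- Positivity of the `t`-derivative spreads to a smaller box, which makes `Ξ (μ, ·)` strictly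
  -- increasing there for each admissible `μ`.
  have hev := (hB _ hmem).eventually_const_lt hB0
  obtain ⟨d, hd0, hdS⟩ := Metric.mem_nhdsWithin_iff.1 hev
  set d' := min d ε with hd'
  have hd'0 : 0 < d' := lt_min hd0 hε
  have hsubS : (J ∩ Set.Ioo (μ₀ - d') (μ₀ + d')) ×ˢ Set.Ioo (t₀ - d') (t₀ + d') ⊆ S := by
    have hle : d' ≤ ε := min_le_right _ _
    exact Set.prod_mono (Set.inter_subset_inter_right _
      (Set.Ioo_subset_Ioo (by linarith) (by linarith)))
      (Set.Ioo_subset_Ioo (by linarith) (by linarith))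
  have hpos : ∀ p ∈ (J ∩ Set.Ioo (μ₀ - d') (μ₀ + d')) ×ˢ Set.Ioo (t₀ - d') (t₀ + d'),
      0 < fderivWithin ℝ Ξ S p (0, 1) := by
    intro p hp
    refine hdS ⟨?_, hsubS hp⟩
    have hle : d' ≤ d := min_le_left _ _
    rw [Metric.mem_ball, Prod.dist_eq, max_lt_iff, Real.dist_eq, Real.dist_eq, abs_lt, abs_lt]
    obtain ⟨⟨_, h1, h2⟩, h3, h4⟩ := hp
    exact ⟨⟨by linarith, by linarith⟩, by linarith, by linarith⟩
  set J' := J ∩ Set.Ioo (μ₀ - d') (μ₀ + d') with hJ'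
  have h0' : μ₀ ∈ J' := ⟨h0, by constructor <;> linarith⟩
  have hmono : ∀ μ ∈ J', StrictMonoOn (fun t => Ξ (μ, t)) (Set.Ioo (t₀ - d') (t₀ + d')) := by
    intro μ hμ
    have hder : ∀ t ∈ Set.Ioo (t₀ - d') (t₀ + d'), HasDerivAt (fun s => Ξ (μ, s))
        (fderivWithin ℝ Ξ S (μ, t) (0, 1)) t := fun t ht =>
      have := hsubS (a := (μ, t)) ⟨hμ, ht⟩
      hvert μ this.1 t this.2
    refine strictMonoOn_of_deriv_pos (convex_Ioo _ _)
      (fun t ht => (hder t ht).continuousAt.continuousWithinAt) fun t ht => ?_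
    rw [interior_Ioo] at ht
    rw [(hder t ht).deriv]
    exact hpos _ ⟨hμ, ht⟩
  obtain ⟨τ, U, hU, hτ0, hτc, hτ⟩ := exists_continuousOn_zero hd'0 h0'
    (hΞ.continuousOn.mono hsubS) hmono hz
  obtain ⟨e, he, heU⟩ := Metric.mem_nhds_iff.1 hU
  rw [Real.ball_eq_Ioo] at heU
  set ε' := min e d' with hε'
  have hε'd : ε' ≤ d' := min_le_right _ _
  have hε'e : ε' ≤ e := min_le_left _ _
  have hsub : J ∩ Set.Ioo (μ₀ - ε') (μ₀ + ε') ⊆ J' ∩ U := fun μ hμ =>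
    ⟨⟨hμ.1, by linarith [hμ.2.1], by linarith [hμ.2.2]⟩,
      heU ⟨by linarith [hμ.2.1], by linarith [hμ.2.2]⟩⟩
  refine ⟨τ, ε', lt_min he hd'0, hε'd.trans (min_le_right _ _), hτ0, ?_, fun μ hμ =>
    ⟨(hsubS (a := (μ, τ μ)) ⟨(hsub hμ).1, (hτ μ (hsub hμ)).1⟩).2, (hτ μ (hsub hμ)).2,
      fun t ht h => (hmono μ (hsub hμ).1).injOn ⟨by linarith [ht.1], by linarith [ht.2]⟩
        (hτ μ (hsub hμ)).1 (h.trans (hτ μ (hsub hμ)).2.symm)⟩⟩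
  have hfd : ∀ p ∈ J' ×ˢ Set.Ioo (t₀ - d') (t₀ + d'),
      fderivWithin ℝ Ξ (J' ×ˢ Set.Ioo (t₀ - d') (t₀ + d')) p = fderivWithin ℝ Ξ S p :=
    fun p hp => fderivWithin_subset hsubS (box d' p hp)
      (hΞ.differentiableOn (by positivity) p (hsubS hp))
  exact contDiffOn_of_zero (hJ.inter isOpen_Ioo) (box d') hk (hΞ.mono hsubS) (hτc.mono hsub)
    (fun μ hμ => ⟨(hsub hμ).1, (hτ μ (hsub hμ)).1⟩)
    (fun p hp => by rw [hfd p hp]; exact (hpos p hp).ne') fun μ hμ => (hτ μ (hsub hμ)).2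

/-! ### The range of chart `K₁` along the special trajectory -/

theorem kappa21_base (r l h : ℝ) (z : Plane) :
    (kappa21 r l h z).base = (√(z 1) * r, 1 / z 1, l / √(z 1), h * √(z 1)) := rfl

theorem le_of_base_mem {ρ δ κ ν r l h : ℝ} (hh : 0 < h) (hδ : 0 < δ) {z : Plane} (hz : 0 < z 1)
    (H : (kappa21 r l h z).base ∈ baseDomain ρ δ κ ν) :
    1 / δ ≤ z 1 ∧ z 1 ≤ ν ^ 2 / h ^ 2 := by
  obtain ⟨-, ⟨-, h2⟩, -, -, h4⟩ := H
  simp only [kappa21_base] at h2 h4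
  have hs : 0 ≤ h * √(z 1) := by positivity
  refine ⟨(one_div_le hδ hz).2 h2, ?_⟩
  rw [le_div_iff₀ (by positivity)]
  calc z 1 * h ^ 2 = (h * √(z 1)) ^ 2 := by rw [mul_pow, Real.sq_sqrt hz.le]; ring
    _ ≤ ν ^ 2 := by gcongr

theorem base_mem {ρ δ κ ν r l h : ℝ} (hh : 0 < h) (hδ : 0 < δ) (hν : 0 < ν) {z : Plane}
    (h1 : 1 / δ ≤ z 1) (h2 : z 1 ≤ ν ^ 2 / h ^ 2) (hr : 0 ≤ r) (hr' : ν / h * r ≤ ρ)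
    (hl : |l| * √δ ≤ κ) :
    (kappa21 r l h z).base ∈ baseDomain ρ δ κ ν := by
  have hz : 0 < z 1 := (one_div_pos.2 hδ).trans_le h1
  have hs : 0 < √(z 1) := Real.sqrt_pos.2 hz
  have hle : √(z 1) ≤ ν / h := by
    rw [Real.sqrt_le_left (by positivity), div_pow]; exact h2
  have hge : 1 / √(z 1) ≤ √δ := by
    rw [one_div, ← Real.sqrt_inv]
    refine Real.sqrt_le_sqrt ?_
    rw [← one_div]
    exact (one_div_le hδ hz).1 h1
  refine ⟨⟨by simp only [kappa21_base]; positivity, ?_⟩, ⟨?_, ?_⟩, ?_, ?_, ?_⟩ <;>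
    simp only [kappa21_base]
  · exact (mul_le_mul_of_nonneg_right hle hr).trans hr'
  · positivity
  · exact (one_div_le hδ hz).1 h1
  · rw [abs_div, abs_of_pos hs, div_eq_mul_one_div]
    exact (mul_le_mul_of_nonneg_left hge (abs_nonneg _)).trans hl
  · positivity
  · rw [le_div_iff₀ hh] at hle; linarith

/-- The times `t ≤ 0` at which `γ̂` lies in the range of chart `K₁`. -/
def timeRange (δ ν h : ℝ) : Set ℝ :=
  {t | t ≤ 0 ∧ 1 / δ ≤ gammaCurve h t 1 ∧ gammaCurve h t 1 ≤ ν ^ 2 / h ^ 2}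

theorem timeRange_neg (δ ν h : ℝ) : timeRange δ ν (-h) = timeRange δ ν h := by
  simp [timeRange]

/-- The interval form supplies compactness, and shows that a nondegenerate range is the closure of
its interior. -/
theorem timeRange_eq_Icc {δ ν h : ℝ} (hδ : 0 < δ) (hh : 0 < h) :
    timeRange δ ν h = Set.Icc (-2 * √(ν ^ 2 / h ^ 2 + 1 / 2 + h ^ 2 / 8) / h)
      (-2 * √(1 / δ + 1 / 2 + h ^ 2 / 8) / h) := by
  ext t
  have hδ' : 0 < 1 / δ := one_div_pos.2 hδ
  have hB : 0 ≤ ν ^ 2 / h ^ 2 := by positivity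
  rw [Set.mem_Icc, div_le_iff₀ hh, le_div_iff₀ hh]
  simp only [timeRange, Set.mem_ofPred_eq, gammaCurve_one]
  constructor
  · rintro ⟨ht, h1, h2⟩
    have hth : t * h ≤ 0 := mul_nonpos_of_nonpos_of_nonneg ht hh.le
    constructor
    · have := Real.abs_le_sqrt (x := t * h / 2) (y := ν ^ 2 / h ^ 2 + 1 / 2 + h ^ 2 / 8)
        (by linarith [show (t * h / 2) ^ 2 = h ^ 2 * t ^ 2 / 4 by ring])
      linarith [(abs_le.1 this).1]
    · have : √(1 / δ + 1 / 2 + h ^ 2 / 8) ≤ -(t * h / 2) := by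
        rw [Real.sqrt_le_left (by linarith)]
        linarith [show (-(t * h / 2)) ^ 2 = h ^ 2 * t ^ 2 / 4 by ring]
      linarith
  · rintro ⟨h1, h2⟩
    have hs : 0 < √(1 / δ + 1 / 2 + h ^ 2 / 8) := by positivity
    have hth : t * h < 0 := by linarith
    refine ⟨(neg_of_mul_neg_left hth hh.le).le, ?_, ?_⟩
    · have := (Real.sqrt_le_left (x := 1 / δ + 1 / 2 + h ^ 2 / 8) (y := -(t * h / 2))
        (by linarith)).1 (by linarith)
      linarith [show (-(t * h / 2)) ^ 2 = h ^ 2 * t ^ 2 / 4 by ring]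
    · have := (Real.le_sqrt' (x := -(t * h / 2)) (y := ν ^ 2 / h ^ 2 + 1 / 2 + h ^ 2 / 8)
        (by linarith)).1 (by linarith)
      linarith [show (-(t * h / 2)) ^ 2 = h ^ 2 * t ^ 2 / 4 by ring]

/-! ### The branches of the special trajectory in chart `K₁` -/

/-- With `s = h t / 2` and `C = 1/2 + h²/8` the quotient is the coordinate `x₁` of `γ̂(t)`. -/
theorem tendsto_div_sqrt_sq_sub (C : ℝ) :
    Tendsto (fun s : ℝ => s / √(s ^ 2 - C)) atTop (𝓝 1) := by
  have h1 : Tendsto (fun s : ℝ => (√(1 - C / s ^ 2))⁻¹) atTop (𝓝 (√(1 - 0))⁻¹) :=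
    Tendsto.inv₀ ((Real.continuous_sqrt.tendsto _).comp (tendsto_const_nhds.sub
      (tendsto_const_nhds.div_atTop (tendsto_pow_atTop two_ne_zero)))) (by simp)
  rw [sub_zero, Real.sqrt_one, inv_one] at h1
  refine h1.congr' ?_
  filter_upwards [eventually_gt_atTop 0] with s hs
  rw [show s ^ 2 - C = s ^ 2 * (1 - C / s ^ 2) by field_simp, Real.sqrt_mul (sq_nonneg s),
    Real.sqrt_sq hs.le, ← div_div, div_self hs.ne', one_div]

theorem tendsto_kappa21_gammaCurve_x {h : ℝ} (hh : 0 < h) :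
    Tendsto (fun s => (kappa21 0 0 h (gammaCurve h s)).x) atTop (𝓝 1) := by
  have h1 : Tendsto (fun s : ℝ => h * s / 2) atTop atTop :=
    (tendsto_id.const_mul_atTop hh).atTop_div_const two_pos
  refine ((tendsto_div_sqrt_sq_sub (1 / 2 + h ^ 2 / 8)).comp h1).congr fun s => ?_
  simp only [Function.comp_apply, kappa21, gammaCurve_zero, gammaCurve_one]
  congr 2
  ring

theorem tendsto_kappa21_gammaCurve_e {h : ℝ} (hh : 0 < h) :
    Tendsto (fun s => (kappa21 0 0 h (gammaCurve h s)).e) atTop (𝓝 0) := by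
  simp only [kappa21, gammaCurve_one]
  refine tendsto_const_nhds.div_atTop ?_
  simp only [sub_eq_add_neg]
  refine tendsto_atTop_add_const_right _ _ (tendsto_atTop_add_const_right _ _ ?_)
  exact ((tendsto_pow_atTop two_ne_zero).const_mul_atTop (by positivity)).atTop_div_const
    (by norm_num)

theorem gammaCurve_one_mono {h s t : ℝ} (hs : 0 ≤ s) (hst : s ≤ t) :
    gammaCurve h s 1 ≤ gammaCurve h t 1 := by
  simp only [gammaCurve_one]; gcongr

theorem gammaCurve_one_strictMono {h s t : ℝ} (hh : h ≠ 0) (hs : 0 ≤ s) (hst : s < t) :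
    gammaCurve h s 1 < gammaCurve h t 1 := by
  simp only [gammaCurve_one]; gcongr

/-- The required forward orbit is that of the points `γ̂(s + n)`. Their heights increase, so they
stay in the chart, but they could meet the pole, which `hd` rules out. -/
theorem kappa21_gammaCurve_mem_repellingBranch (a : Coeffs) {h s : ℝ} (hh : 0 < h) (hs : 0 ≤ s)
    (hy : 0 < gammaCurve h s 1)
    (hd : ∀ n : ℕ, 1 - h ^ 2 * (s + n) / 2 + h ^ 2 / 4 ≠ 0) :
    kappa21 0 0 h (gammaCurve h s) ∈ repellingBranch a := by
  have hpos : ∀ n : ℕ, 0 < gammaCurve h (s + n) 1 := fun n =>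
    hy.trans_le (gammaCurve_one_mono hs (by simp))
  have hlim : Tendsto (fun n : ℕ => s + (n : ℝ)) atTop atTop :=
    tendsto_atTop_add_const_left _ _ tendsto_natCast_atTop_atTop
  refine ⟨by simp [kappa21], by simp [kappa21], by simp only [kappa21]; positivity,
    by simp only [kappa21]; positivity, fun n => kappa21 0 0 h (gammaCurve h (s + n)), by simp,
    fun n => ?_, (tendsto_kappa21_gammaCurve_x hh).comp hlim,
    (tendsto_kappa21_gammaCurve_e hh).comp hlim⟩
  have := kahanStep_gammaCurve (a := a) (hd n)
  have e : s + ((n + 1 : ℕ) : ℝ) = s + n + 1 := by push_cast; ring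
  have hp := hpos (n + 1)
  simp only [e] at hp ⊢
  exact chartOneStep_kappa21 (hpos n) hp this

/-- The backward orbit `γ̂(t - n)` runs through nonpositive times only, so no condition on the pole
is needed. -/
theorem kappa21_gammaCurve_mem_attractingBranch (a : Coeffs) {h t : ℝ} (hh : 0 < h) (ht : t ≤ 0)
    (hy : 0 < gammaCurve h t 1) :
    kappa21 0 0 h (gammaCurve h t) ∈ attractingBranch a := by
  have hpos : ∀ n : ℕ, 0 < gammaCurve h (t - n) 1 := fun n => by
    refine hy.trans_le ?_
    simp only [gammaCurve_one]
    have : t ^ 2 ≤ (t - n) ^ 2 := by nlinarith [Nat.cast_nonneg (α := ℝ) n]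
    gcongr
  have hlim : Tendsto (fun n : ℕ => -t + (n : ℝ)) atTop atTop :=
    tendsto_atTop_add_const_left _ _ tendsto_natCast_atTop_atTop
  refine ⟨by simp [kappa21], by simp [kappa21], by simp only [kappa21]; positivity,
    by simp only [kappa21]; positivity, fun n => kappa21 0 0 h (gammaCurve h (t - n)), by simp,
    fun n => ?_, ?_, ?_⟩
  · have hle : t - ((n + 1 : ℕ) : ℝ) ≤ 0 := by
      have : (0 : ℝ) ≤ ((n + 1 : ℕ) : ℝ) := Nat.cast_nonneg _
      linarith
    have := kahanStep_gammaCurve (a := a) (kahanDet_pos_of_nonpos (h := h) hle).ne'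
    rw [show t - ((n + 1 : ℕ) : ℝ) + 1 = t - n by push_cast; ring] at this
    exact chartOneStep_kappa21 (hpos _) (hpos n) this
  · refine ((tendsto_kappa21_gammaCurve_x hh).comp hlim).neg.congr fun n => ?_
    simp only [Function.comp_apply, kappa21, gammaCurve_zero, gammaCurve_one]
    rw [← neg_div, show t - (n : ℝ) = -(-t + n) by ring, neg_sq]
    congr 1
    ring
  · refine ((tendsto_kappa21_gammaCurve_e hh).comp hlim).congr fun n => ?_
    simp only [Function.comp_apply, kappa21, gammaCurve_one]
    rw [show t - (n : ℝ) = -(-t + n) by ring, neg_sq]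

theorem gammaCurve_mem_chartTwo_attracting {a : Coeffs} {k : ℕ} {ρ δ κ ν h t : ℝ}
    {M : Set ChartPoint} (hM : IsCenterStable a k ρ δ κ ν M) (hρ : 0 < ρ) (hδ : 0 < δ)
    (hκ : 0 < κ) (hν : 0 < ν) (hh : 0 < h) (ht : t ∈ timeRange δ ν h) :
    gammaCurve h t ∈ chartTwo M 0 0 h := by
  obtain ⟨h0, h1, h2⟩ := ht
  have hy : 0 < gammaCurve h t 1 := (one_div_pos.2 hδ).trans_le h1
  exact ⟨hy, hM.2 _ (kappa21_gammaCurve_mem_attractingBranch a hh h0 hy)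
    (base_mem hh hδ hν h1 h2 le_rfl (by simpa using hρ.le) (by simpa using hκ.le))⟩

theorem continuousOn_kappa21_base {ρ δ κ ν h : ℝ} (hρ : 0 < ρ) (hδ : 0 < δ)
    (hκ : 0 < κ) (hν : 0 < ν) (hh : 0 < h) :
    ContinuousOn (fun t => (kappa21 0 0 h (gammaCurve (-h) t)).base) (timeRange δ ν h) ∧
      Set.MapsTo (fun t => (kappa21 0 0 h (gammaCurve (-h) t)).base) (timeRange δ ν h)
        (baseDomain ρ δ κ ν) := by
  have hy : ∀ t ∈ timeRange δ ν h, 0 < gammaCurve (-h) t 1 := fun t ht => by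
    rw [← timeRange_neg] at ht
    exact (one_div_pos.2 hδ).trans_le ht.2.1
  constructor
  · simp only [kappa21_base]
    have hc : ContinuousOn (fun t => gammaCurve (-h) t 1) (timeRange δ ν h) :=
      ((continuous_apply 1).comp (continuous_gammaCurve (-h))).continuousOn
    have hs := Real.continuous_sqrt.comp_continuousOn hc
    have hs0 : ∀ t ∈ timeRange δ ν h, √(gammaCurve (-h) t 1) ≠ 0 := fun t ht =>
      (Real.sqrt_pos.2 (hy t ht)).ne'
    exact (hs.mul continuousOn_const).prodMk ((continuousOn_const.div hc fun t ht =>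
      (hy t ht).ne').prodMk ((continuousOn_const.div hs hs0).prodMk (continuousOn_const.mul hs)))
  · intro t ht
    rw [← timeRange_neg] at ht
    have h2 := ht.2.2
    rw [neg_sq] at h2
    exact base_mem hh hδ hν ht.2.1 h2 le_rfl (by simpa using hρ.le) (by simpa using hκ.le)

/-- For all but countably many times the point lies on the repelling branch, hence on the graph.
Both sides of the graph equation are continuous in `t`, and the good times are dense because `hδν`
makes the range a nondegenerate interval. -/
theorem gammaCurve_mem_chartTwo_repelling {a : Coeffs} {k : ℕ} {ρ δ κ ν h t : ℝ}
    {M : Set ChartPoint} (hM : IsCenterUnstable a k ρ δ κ ν M) (hρ : 0 < ρ) (hδ : 0 < δ)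
    (hκ : 0 < κ) (hν : 0 < ν) (hh : 0 < h) (hδν : 1 / δ < ν ^ 2 / h ^ 2)
    (ht : t ∈ timeRange δ ν h) :
    gammaCurve (-h) t ∈ chartTwo M 0 0 h := by
  obtain ⟨⟨⟨g, hg, hMg⟩, -, -⟩, hb⟩ := hM
  obtain ⟨hbc, hbm⟩ := continuousOn_kappa21_base (ρ := ρ) hρ hδ hκ hν hh
  have hy : ∀ t ∈ timeRange δ ν h, 0 < gammaCurve (-h) t 1 := fun t ht => by
    rw [← timeRange_neg] at ht
    exact (one_div_pos.2 hδ).trans_le ht.2.1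
  -- The bad times: those `t` for which `-t + n` is the pole `2/h² + 1/2` for some `n`.
  set P : Set ℝ := Set.range fun n : ℕ => (n : ℝ) - (2 / h ^ 2 + 1 / 2) with hP
  have hdense : Dense Pᶜ := (Set.countable_range _).dense_compl ℝ
  have hIcc := timeRange_eq_Icc (δ := δ) (ν := ν) hδ hh
  have hne : -2 * √(ν ^ 2 / h ^ 2 + 1 / 2 + h ^ 2 / 8) / h <
      -2 * √(1 / δ + 1 / 2 + h ^ 2 / 8) / h := by
    have : √(1 / δ + 1 / 2 + h ^ 2 / 8) < √(ν ^ 2 / h ^ 2 + 1 / 2 + h ^ 2 / 8) :=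
      Real.sqrt_lt_sqrt (by positivity) (by linarith)
    rw [div_lt_div_iff_of_pos_right hh]
    linarith
  have hcl : timeRange δ ν h ⊆ closure (interior (timeRange δ ν h) ∩ Pᶜ) := by
    refine subset_trans ?_ (closure_minimal (hdense.open_subset_closure_inter isOpen_interior)
      isClosed_closure)
    rw [hIcc, interior_Icc, closure_Ioo hne.ne]
  have heq : Set.EqOn (fun t => (kappa21 0 0 h (gammaCurve (-h) t)).x)
      (fun t => g (kappa21 0 0 h (gammaCurve (-h) t)).base)
      (interior (timeRange δ ν h) ∩ Pᶜ) := by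
    rintro s ⟨hs, hsP⟩
    have hs' := interior_subset hs
    have hys := hy s hs'
    have hmem := hbm hs'
    simp only at hmem ⊢
    rw [gammaCurve_neg] at hys hmem ⊢
    have := hb _ (kappa21_gammaCurve_mem_repellingBranch a hh (neg_nonneg.2 hs'.1) hys
      fun n hn => hsP ⟨n, ?_⟩) hmem
    · rw [hMg] at this
      exact this.2
    · simp only
      field_simp
      linear_combination -4 * hn
  have hfx : ContinuousOn (fun t => (kappa21 0 0 h (gammaCurve (-h) t)).x) (timeRange δ ν h) :=
    ((continuous_apply 0).comp (continuous_gammaCurve (-h))).continuousOn.div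
      (Real.continuous_sqrt.comp
        ((continuous_apply 1).comp (continuous_gammaCurve (-h)))).continuousOn
      fun t ht => (Real.sqrt_pos.2 (hy t ht)).ne'
  have := heq.of_subset_closure hfx (hg.continuousOn.comp hbc hbm)
    (Set.inter_subset_left.trans interior_subset) hcl ht
  exact ⟨hy t ht, hMg ▸ ⟨hbm ht, this⟩⟩

/-! ### Orbits near the special trajectory -/

theorem Unfolding.zero_mem_range (c : Unfolding) : (0 : ℝ) ∈ c.range := by
  cases c <;> simp [Unfolding.range]

theorem Unfolding.uniqueDiffOn_range (c : Unfolding) : UniqueDiffOn ℝ c.range := by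
  cases c
  · exact uniqueDiffOn_univ
  · exact uniqueDiffOn_Ici 0

theorem Unfolding.r_nonneg {c : Unfolding} {μ : ℝ} (hμ : μ ∈ c.range) : 0 ≤ c.r μ := by
  cases c
  · exact le_rfl
  · exact hμ

/-- Parameters near `0` in the admissible range and points near `γ̂(t)`. -/
abbrev nearCurve (c : Unfolding) (η t : ℝ) : Filter (ℝ × Plane) :=
  𝓝[c.range] 0 ×ˢ 𝓝 (gammaCurve η t)

theorem nearCurve_le (c : Unfolding) (η t : ℝ) : nearCurve c η t ≤ 𝓝 (0, gammaCurve η t) := by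
  rw [nhds_prod_eq]
  exact Filter.prod_mono nhdsWithin_le_nhds le_rfl

theorem eventually_kahanDet_ne_zero {a : Coeffs} {c : Unfolding} {h η t : ℝ}
    (hd : kahanDet a 0 1 h (gammaCurve η t) ≠ 0) :
    ∀ᶠ p in nearCurve c η t, kahanDet a (c.r p.1) 1 h p.2 ≠ 0 := by
  refine nearCurve_le c η t ?_
  refine (contDiff_kahanDet a c h (n := 0)).continuous.continuousAt.eventually_ne ?_
  simpa using hd

/-- The iterates of the Kahan map of chart `K₂`, with the parameter as an argument. -/
def kahanIter (a : Coeffs) (c : Unfolding) (h : ℝ) (n : ℕ) (p : ℝ × Plane) : Plane :=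
  (kahanTwo a c h p.1)^[n] p.2

@[simp] theorem kahanIter_zero (a : Coeffs) (c : Unfolding) (h : ℝ) (p : ℝ × Plane) :
    kahanIter a c h 0 p = p.2 := rfl

theorem kahanIter_succ (a : Coeffs) (c : Unfolding) (h : ℝ) (n : ℕ) (p : ℝ × Plane) :
    kahanIter a c h (n + 1) p = kahanIter a c h n (p.1, kahanTwo a c h p.1 p.2) := rfl

theorem kahanIter_succ' (a : Coeffs) (c : Unfolding) (h : ℝ) (n : ℕ) (p : ℝ × Plane) :
    kahanIter a c h (n + 1) p = kahanTwo a c h p.1 (kahanIter a c h n p) :=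
  Function.iterate_succ_apply' _ _ _

theorem kahanTwo_zero_gammaCurve {a : Coeffs} {c : Unfolding} {h t : ℝ}
    (ht : 1 - h ^ 2 * t / 2 + h ^ 2 / 4 ≠ 0) :
    kahanTwo a c h 0 (gammaCurve h t) = gammaCurve h (t + 1) := by
  rw [kahanTwo, unfoldedField_zero, kahan_gammaCurve ht]

/-- The bound `t + n ≤ 1` means that every application of the map takes place at a time `≤ 0`, away
from the pole; only the last point may have positive time. -/
theorem kahanIter_zero_gammaCurve (a : Coeffs) (c : Unfolding) (h : ℝ) {t : ℝ} {n : ℕ}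
    (ht : t + n ≤ 1) : kahanIter a c h n (0, gammaCurve h t) = gammaCurve h (t + n) := by
  induction n with
  | zero => simp
  | succ n ih =>
    push_cast at ht ⊢
    rw [kahanIter_succ', ih (by linarith),
      kahanTwo_zero_gammaCurve (kahanDet_pos_of_nonpos (by linarith)).ne', add_assoc]

theorem contDiffAt_kahanIter (a : Coeffs) (c : Unfolding) (h : ℝ) {t : ℝ} {n : ℕ}
    (ht : t + n ≤ 1) {k : WithTop ℕ∞} :
    ContDiffAt ℝ k (kahanIter a c h n) (0, gammaCurve h t) := by
  induction n with
  | zero => exact contDiffAt_snd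
  | succ n ih =>
    push_cast at ht
    have e : kahanIter a c h (n + 1) = (fun q : ℝ × Plane => kahanTwo a c h q.1 q.2) ∘
        fun p => (p.1, kahanIter a c h n p) := funext (kahanIter_succ' a c h n)
    rw [e]
    refine ContDiffAt.comp _ (contDiffAt_kahanTwo a c h ?_)
      (contDiffAt_fst.prodMk (ih (by linarith)))
    simp only [Unfolding.r_zero, kahanIter_zero_gammaCurve a c h (show t + n ≤ 1 by linarith)]
    rw [kahanDet_gammaCurve]
    exact (kahanDet_pos_of_nonpos (by linarith)).ne'

theorem tendsto_kahanIter (a : Coeffs) (c : Unfolding) (h : ℝ) {t : ℝ} {n : ℕ}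
    (ht : t + n ≤ 1) :
    Tendsto (fun p => (p.1, kahanIter a c h n p)) (nearCurve c h t) (nearCurve c h (t + n)) := by
  refine tendsto_fst.prodMk ?_
  have := (contDiffAt_kahanIter a c h ht (k := 0)).continuousAt.tendsto
  rw [kahanIter_zero_gammaCurve a c h ht] at this
  exact this.mono_left (nearCurve_le c h t)

theorem tendsto_kahanTwo {a : Coeffs} {c : Unfolding} {h t : ℝ}
    (ht : 1 - h ^ 2 * t / 2 + h ^ 2 / 4 ≠ 0) :
    Tendsto (fun p => (p.1, kahanTwo a c h p.1 p.2)) (nearCurve c h t)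
      (nearCurve c h (t + 1)) := by
  refine tendsto_fst.prodMk ?_
  have hd : kahanDet a (c.r (0, gammaCurve h t).1) 1 h (0, gammaCurve h t).2 ≠ 0 := by
    simpa [kahanDet_gammaCurve] using ht
  have := (contDiffAt_kahanTwo a c h hd (n := 0)).continuousAt.tendsto
  rw [kahanTwo_zero_gammaCurve ht] at this
  exact this.mono_left (nearCurve_le c h t)

theorem tendsto_kahanTwo_neg {a : Coeffs} {c : Unfolding} {h t : ℝ}
    (ht : 1 + h ^ 2 * t / 2 + h ^ 2 / 4 ≠ 0) :
    Tendsto (fun p => (p.1, kahanTwo a c (-h) p.1 p.2)) (nearCurve c h t)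
      (nearCurve c h (t - 1)) := by
  have := tendsto_kahanTwo (a := a) (c := c) (h := -h) (t := -t) (by
    convert ht using 1; ring)
  rw [nearCurve, nearCurve, gammaCurve_neg, gammaCurve_neg, neg_neg,
    show -(-t + 1) = t - 1 by ring] at this
  exact this

theorem eventually_kahanDet_ne_zero_of_nonpos (a : Coeffs) (c : Unfolding) (η : ℝ) {t : ℝ} (ht : t ≤ 0) :
    ∀ᶠ p in nearCurve c η t, kahanDet a (c.r p.1) 1 η p.2 ≠ 0 := by
  refine eventually_kahanDet_ne_zero ?_
  rw [kahanDet_gammaCurve]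
  exact (kahanDet_pos_of_nonpos ht).ne'

theorem tendsto_kahanTwo_natCast (a : Coeffs) (c : Unfolding) (η : ℝ) (n : ℕ) :
    Tendsto (fun p => (p.1, kahanTwo a c η p.1 p.2)) (nearCurve c η (-(n + 1 : ℕ)))
      (nearCurve c η (-n)) := by
  have hle : -((n + 1 : ℕ) : ℝ) ≤ 0 := neg_nonpos.2 (Nat.cast_nonneg _)
  have := tendsto_kahanTwo (a := a) (c := c) (h := η) (kahanDet_pos_of_nonpos hle).ne'
  rwa [show -((n + 1 : ℕ) : ℝ) + 1 = -n by push_cast; ring] at this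

theorem eventually_side_neg (c : Unfolding) {η t : ℝ} (hη : η ≠ 0) (ht : t < 0) :
    ∀ᶠ p in nearCurve c η t, η * p.2 0 < 0 := by
  have hc : Continuous fun p : ℝ × Plane => η * p.2 0 := by fun_prop
  refine nearCurve_le c η t (hc.continuousAt.eventually_lt_const ?_)
  have := mul_neg_of_pos_of_neg (pow_pos (abs_pos.2 hη) 2) ht
  simp only [gammaCurve_zero]
  rw [sq_abs] at this
  linarith

theorem eventually_side_pos (c : Unfolding) {η t : ℝ} (hη : η ≠ 0) (ht : 0 < t) :
    ∀ᶠ p in nearCurve c η t, 0 < η * p.2 0 := by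
  have hc : Continuous fun p : ℝ × Plane => η * p.2 0 := by fun_prop
  refine nearCurve_le c η t (hc.continuousAt.eventually_const_lt ?_)
  have := mul_pos (pow_pos (abs_pos.2 hη) 2) ht
  simp only [gammaCurve_zero]
  rw [sq_abs] at this
  linarith

theorem eventually_lt_snd (c : Unfolding) {η t b : ℝ} (hb : b < gammaCurve η t 1) :
    ∀ᶠ p in nearCurve c η t, b < p.2 1 := by
  have hc : Continuous fun p : ℝ × Plane => p.2 1 := by fun_prop
  exact nearCurve_le c η t (hc.continuousAt.eventually_const_lt hb)

theorem eventually_snd_lt (c : Unfolding) {η t b : ℝ} (hb : gammaCurve η t 1 < b) :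
    ∀ᶠ p in nearCurve c η t, p.2 1 < b := by
  have hc : Continuous fun p : ℝ × Plane => p.2 1 := by fun_prop
  exact nearCurve_le c η t (hc.continuousAt.eventually_lt_const hb)

/-! ### The two sides of the section -/

/-- The parameters for which the slices of the manifolds are parametrized by `timeRange δ ν h`. -/
def smallParams (c : Unfolding) (ρ δ κ ν h : ℝ) : Set ℝ :=
  {μ | 0 ≤ c.r μ ∧ ν / h * c.r μ ≤ ρ ∧ |c.l μ| * √δ ≤ κ}

theorem eventually_smallParams (c : Unfolding) {ρ δ κ ν h : ℝ} (hρ : 0 < ρ) (hκ : 0 < κ) :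
    ∀ᶠ μ in 𝓝[c.range] 0, μ ∈ smallParams c ρ δ κ ν h := by
  have h1 : Continuous fun μ => ν / h * c.r μ :=
    continuous_const.mul (c.contDiff_r (n := 0)).continuous
  have h2 : Continuous fun μ => |c.l μ| * √δ :=
    (c.contDiff_l (n := 0)).continuous.abs.mul continuous_const
  filter_upwards [self_mem_nhdsWithin,
    nhdsWithin_le_nhds (h1.continuousAt.eventually_lt_const (u := ρ) (by simpa using hρ)),
    nhdsWithin_le_nhds (h2.continuousAt.eventually_lt_const (u := κ) (by simpa using hκ))]
    with μ h3 h4 h5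
  exact ⟨Unfolding.r_nonneg h3, h4.le, h5.le⟩

/-- The hypotheses common to the attracting side (`η = h`, orbits followed forward) and the
repelling side (`η = -h`, orbits followed backward): `M` is a manifold of chart `K₁`, the graph of
`g`, and `R μ` is the relation of consecutive points of an orbit. -/
structure IsSide (a : Coeffs) (c : Unfolding) (k : ℕ) (ρ δ κ ν h η : ℝ)
    (g : ℝ × ℝ × ℝ × ℝ → ℝ) (M : Set ChartPoint) (R : ℝ → Plane → Plane → Prop) : Prop where
  one_le : 1 ≤ k
  rho_pos : 0 < ρ
  delta_pos : 0 < δ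
  kappa_pos : 0 < κ
  nu_pos : 0 < ν
  h_pos : 0 < h
  eta : η = h ∨ η = -h
  smooth : ContDiffOn ℝ k g (baseDomain ρ δ κ ν)
  mem_iff : ∀ p, p ∈ M ↔ p.base ∈ baseDomain ρ δ κ ν ∧ p.x = g p.base
  curve_mem : ∀ t ∈ timeRange δ ν h, gammaCurve η t ∈ chartTwo M 0 0 h
  invariant : ∀ (r l : ℝ) (u v : Plane), 0 < u 1 → 0 < v 1 →
    (kappa21 r l h u).base ∈ baseDomain ρ δ κ ν → (kappa21 r l h v).base ∈ baseDomain ρ δ κ ν →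
    η * u 0 < 0 → η * v 0 < 0 → kahanDet a r 1 η u ≠ 0 → kahanDet a r 1 (-η) v ≠ 0 →
    Implicit a r 1 l η u v → (u ∈ chartTwo M r l h ↔ v ∈ chartTwo M r l h)
  implicit_of_step : ∀ μ u v, R μ u v → Implicit a (c.r μ) 1 (c.l μ) η u v
  step_of_implicit : ∀ μ u v, kahanDet a (c.r μ) 1 η u ≠ 0 → kahanDet a (c.r μ) 1 (-η) v ≠ 0 →
    Implicit a (c.r μ) 1 (c.l μ) η u v → R μ u v
  pole : ∀ n : ℕ, 1 - h ^ 2 * (n : ℝ) / 2 + h ^ 2 / 4 ≠ 0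

namespace IsSide

variable {a : Coeffs} {c : Unfolding} {k : ℕ} {ρ δ κ ν h η : ℝ}
  {g : ℝ × ℝ × ℝ × ℝ → ℝ} {M : Set ChartPoint} {R : ℝ → Plane → Plane → Prop}

theorem eta_sq (S : IsSide a c k ρ δ κ ν h η g M R) : η ^ 2 = h ^ 2 := by
  rcases S.eta with rfl | rfl
  · rfl
  · exact neg_sq h

theorem eta_ne_zero (S : IsSide a c k ρ δ κ ν h η g M R) : η ≠ 0 := by
  have := S.h_pos
  rcases S.eta with rfl | rfl
  · exact this.ne'
  · exact (neg_neg_of_pos this).ne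

theorem gammaCurve_eta_one (S : IsSide a c k ρ δ κ ν h η g M R) (t : ℝ) :
    gammaCurve η t 1 = gammaCurve h t 1 := by
  rw [gammaCurve_one, gammaCurve_one, S.eta_sq]

theorem pole_eta (S : IsSide a c k ρ δ κ ν h η g M R) (n : ℕ) :
    1 + η ^ 2 * (-(n : ℝ)) / 2 + η ^ 2 / 4 ≠ 0 := by
  have := S.pole n
  rw [S.eta_sq]
  convert this using 1
  ring

theorem det_neg_ne_zero (S : IsSide a c k ρ δ κ ν h η g M R) (n : ℕ) :
    ∀ᶠ p in nearCurve c η (-n), kahanDet a (c.r p.1) 1 (-η) p.2 ≠ 0 := by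
  refine eventually_kahanDet_ne_zero ?_
  rw [kahanDet_gammaCurve_neg]
  exact S.pole_eta n

theorem tendsto_step_back (S : IsSide a c k ρ δ κ ν h η g M R) (n : ℕ) :
    Tendsto (fun p => (p.1, kahanTwo a c (-η) p.1 p.2)) (nearCurve c η (-n))
      (nearCurve c η (-(n + 1 : ℕ))) := by
  have := tendsto_kahanTwo_neg (a := a) (c := c) (h := η) (S.pole_eta n)
  rwa [show -(n : ℝ) - 1 = -(n + 1 : ℕ) by push_cast; ring] at this

theorem eventually_base_mem (S : IsSide a c k ρ δ κ ν h η g M R) {t : ℝ}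
    (h1 : 1 / δ < gammaCurve h t 1) (h2 : gammaCurve h t 1 < ν ^ 2 / h ^ 2) :
    ∀ᶠ p in nearCurve c η t,
      (kappa21 (c.r p.1) (c.l p.1) h p.2).base ∈ baseDomain ρ δ κ ν := by
  rw [← S.gammaCurve_eta_one] at h1 h2
  filter_upwards [eventually_lt_snd c h1, eventually_snd_lt c h2,
    tendsto_fst.eventually (eventually_smallParams c (δ := δ) (ν := ν) (h := h)
      S.rho_pos S.kappa_pos)] with p h3 h4 h5
  exact base_mem S.h_pos S.delta_pos S.nu_pos h3.le h4.le h5.1 h5.2.1 h5.2.2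

/-- Local invariance of the slices near the points of the special trajectory. -/
theorem eventually_mem_iff (S : IsSide a c k ρ δ κ ν h η g M R) {n : ℕ} (hn : n ≠ 0)
    (hy : 0 < gammaCurve h (-n) 1) :
    ∀ᶠ p in nearCurve c η (-(n + 1 : ℕ)),
      (kappa21 (c.r p.1) (c.l p.1) h p.2).base ∈ baseDomain ρ δ κ ν →
      (kappa21 (c.r p.1) (c.l p.1) h (kahanTwo a c η p.1 p.2)).base ∈ baseDomain ρ δ κ ν →
      (p.2 ∈ chartTwo M (c.r p.1) (c.l p.1) h ↔
        kahanTwo a c η p.1 p.2 ∈ chartTwo M (c.r p.1) (c.l p.1) h) := by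
  have hn0 : (0 : ℝ) < n := by positivity
  have hy' : 0 < gammaCurve η (-(n + 1 : ℕ)) 1 := by
    refine hy.trans_le ?_
    rw [S.gammaCurve_eta_one, gammaCurve_one, gammaCurve_one, neg_sq, neg_sq]
    gcongr
    simp
  rw [← S.gammaCurve_eta_one] at hy
  have hlt : -((n + 1 : ℕ) : ℝ) < 0 := by push_cast; linarith
  have T := tendsto_kahanTwo_natCast a c η n
  filter_upwards [eventually_kahanDet_ne_zero_of_nonpos a c η hlt.le, T.eventually (S.det_neg_ne_zero n),
    eventually_side_neg c S.eta_ne_zero hlt,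
    T.eventually (eventually_side_neg c S.eta_ne_zero (neg_lt_zero.2 hn0)),
    eventually_lt_snd c hy', T.eventually (eventually_lt_snd c hy)] with p d1 d2 s1 s2 y1 y2 b1 b2
  exact S.invariant _ _ _ _ y1 y2 b1 b2 s1 s2 d1 d2 ((eq_kahan_iff d1).1 rfl)

/-- The map undoes its reverse near the special trajectory. -/
theorem eventually_kahanTwo_neg_eq (S : IsSide a c k ρ δ κ ν h η g M R) (n : ℕ) :
    ∀ᶠ p in nearCurve c η (-n),
      kahanTwo a c η p.1 (kahanTwo a c (-η) p.1 p.2) = p.2 := by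
  have hle : -((n + 1 : ℕ) : ℝ) ≤ 0 := neg_nonpos.2 (Nat.cast_nonneg _)
  filter_upwards [S.det_neg_ne_zero n,
    (S.tendsto_step_back n).eventually (eventually_kahanDet_ne_zero_of_nonpos a c η hle)] with p d1 d2
  have H : Implicit a (c.r p.1) 1 (c.l p.1) (-η) p.2 (kahanTwo a c (-η) p.1 p.2) :=
    (eq_kahan_iff d1).1 rfl
  have H' := H.symm
  rw [neg_neg] at H'
  exact ((eq_kahan_iff d2).2 H').symm

/-- Orbits starting near `γ̂(-n)` reach a neighbourhood of `γ̂(0)` through the given side. -/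
theorem eventually_reflTransGen (S : IsSide a c k ρ δ κ ν h η g M R) (n : ℕ) :
    ∀ᶠ p in nearCurve c η (-n),
      Relation.ReflTransGen (fun u v => η * u 0 < 0 ∧ R p.1 u v) p.2 (kahanIter a c η n p) := by
  induction n with
  | zero => exact Eventually.of_forall fun p => Relation.ReflTransGen.refl
  | succ n ih =>
    have hlt : -((n + 1 : ℕ) : ℝ) < 0 := by push_cast; linarith [Nat.cast_nonneg (α := ℝ) n]
    have T := tendsto_kahanTwo_natCast a c η n
    filter_upwards [T.eventually ih, eventually_side_neg c S.eta_ne_zero hlt,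
      eventually_kahanDet_ne_zero_of_nonpos a c η hlt.le, T.eventually (S.det_neg_ne_zero n)] with p h1 h2 d1 d2
    exact Relation.ReflTransGen.head
      ⟨h2, S.step_of_implicit _ _ _ d1 d2 ((eq_kahan_iff d1).1 rfl)⟩ h1

end IsSide

/-! ### Parametrization of the slices by time, and the crossing of the section. -/

/-- The time `t ≤ 0` at which the second coordinate of `γ̂(t)` is `y`. -/
def timeOf (h y : ℝ) : ℝ := -2 * √(y + 1 / 2 + h ^ 2 / 8) / h

theorem timeOf_gammaCurve {h t : ℝ} (hh : 0 < h) (ht : t ≤ 0) :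
    timeOf h (gammaCurve h t 1) = t := by
  rw [timeOf, gammaCurve_one, show h ^ 2 * t ^ 2 / 4 - 1 / 2 - h ^ 2 / 8 + 1 / 2 + h ^ 2 / 8 =
    (-(h * t / 2)) ^ 2 by ring, Real.sqrt_sq (by nlinarith)]
  field_simp

theorem gammaCurve_timeOf {h y : ℝ} (hh : 0 < h) (hy : 0 ≤ y) :
    gammaCurve h (timeOf h y) 1 = y := by
  rw [timeOf, gammaCurve_one, div_pow, mul_pow, Real.sq_sqrt (by positivity)]
  field_simp
  ring

theorem continuous_timeOf (h : ℝ) : Continuous (timeOf h) := by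
  unfold timeOf; fun_prop

/-- The slices of the manifolds in chart `K₂`, parametrized by the time of the point of `γ̂` at the
same height. -/
def sliceCurve (c : Unfolding) (g : ℝ × ℝ × ℝ × ℝ → ℝ) (h : ℝ) (p : ℝ × ℝ) : Plane :=
  ![√(gammaCurve h p.2 1) * g (kappa21 (c.r p.1) (c.l p.1) h (gammaCurve h p.2)).base,
    gammaCurve h p.2 1]

namespace IsSide

variable {a : Coeffs} {c : Unfolding} {k : ℕ} {ρ δ κ ν h η : ℝ}
  {g : ℝ × ℝ × ℝ × ℝ → ℝ} {M : Set ChartPoint} {R : ℝ → Plane → Plane → Prop}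

theorem snd_pos (S : IsSide a c k ρ δ κ ν h η g M R) {t : ℝ} (ht : t ∈ timeRange δ ν h) :
    0 < gammaCurve h t 1 :=
  (one_div_pos.2 S.delta_pos).trans_le ht.2.1

theorem base_mem_of_timeRange (S : IsSide a c k ρ δ κ ν h η g M R) {μ t : ℝ}
    (hμ : μ ∈ smallParams c ρ δ κ ν h) (ht : t ∈ timeRange δ ν h) :
    (kappa21 (c.r μ) (c.l μ) h (gammaCurve h t)).base ∈ baseDomain ρ δ κ ν :=
  base_mem S.h_pos S.delta_pos S.nu_pos ht.2.1 ht.2.2 hμ.1 hμ.2.1 hμ.2.2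

theorem sliceCurve_mem (S : IsSide a c k ρ δ κ ν h η g M R) {μ t : ℝ}
    (hμ : μ ∈ smallParams c ρ δ κ ν h) (ht : t ∈ timeRange δ ν h) :
    sliceCurve c g h (μ, t) ∈ chartTwo M (c.r μ) (c.l μ) h := by
  have hy := S.snd_pos ht
  refine ⟨hy, (S.mem_iff _).2 ⟨S.base_mem_of_timeRange hμ ht, ?_⟩⟩
  have hs := (Real.sqrt_pos.2 hy).ne'
  -- The factor `√y` in `sliceCurve` cancels against the one in `x₁ = x / √y`.
  change √(gammaCurve h t 1) * _ / √(gammaCurve h t 1) = _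
  rw [mul_div_cancel_left₀ _ hs]
  rfl

theorem eq_sliceCurve (S : IsSide a c k ρ δ κ ν h η g M R) {μ : ℝ} {z : Plane}
    (hz : z ∈ chartTwo M (c.r μ) (c.l μ) h) :
    timeOf h (z 1) ∈ timeRange δ ν h ∧ z = sliceCurve c g h (μ, timeOf h (z 1)) := by
  obtain ⟨hy, hzM⟩ := hz
  obtain ⟨hb, hx⟩ := (S.mem_iff _).1 hzM
  have hle := le_of_base_mem S.h_pos S.delta_pos hy hb
  have e := gammaCurve_timeOf S.h_pos hy.le
  refine ⟨⟨?_, by rwa [e]⟩, ?_⟩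
  · have := S.h_pos
    rw [timeOf, neg_mul, neg_div]
    exact neg_nonpos.2 (by positivity)
  · ext i
    fin_cases i
    · change z 0 = √(gammaCurve h _ 1) * g (kappa21 _ _ h (gammaCurve h (timeOf h (z 1)))).base
      have hx' : z 0 / √(z 1) = _ := hx
      rw [kappa21_base] at hx' ⊢
      simp only [e]
      rw [← hx', mul_div_cancel₀ _ (Real.sqrt_pos.2 hy).ne']
    · exact e.symm

/-- Slice and curve are both graphs over the height, and the curve lies on the slice, so at `μ = 0`
they coincide as parametrized arcs. -/
theorem sliceCurve_zero (S : IsSide a c k ρ δ κ ν h η g M R) {t : ℝ}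
    (ht : t ∈ timeRange δ ν h) : sliceCurve c g h (0, t) = gammaCurve η t := by
  have h1 := S.curve_mem t ht
  have h2 := (S.eq_sliceCurve (μ := 0) (by simpa using h1)).2
  rw [S.gammaCurve_eta_one, timeOf_gammaCurve S.h_pos ht.1] at h2
  exact h2.symm

theorem contDiffOn_sliceCurve (S : IsSide a c k ρ δ κ ν h η g M R) :
    ContDiffOn ℝ k (sliceCurve c g h) (smallParams c ρ δ κ ν h ×ˢ timeRange δ ν h) := by
  have hy : ContDiff ℝ k fun p : ℝ × ℝ => gammaCurve h p.2 1 := by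
    simp only [gammaCurve_one]; fun_prop
  have hy0 : ∀ p ∈ smallParams c ρ δ κ ν h ×ˢ timeRange δ ν h, gammaCurve h p.2 1 ≠ 0 :=
    fun p hp => (S.snd_pos hp.2).ne'
  have hs : ContDiffOn ℝ k (fun p : ℝ × ℝ => √(gammaCurve h p.2 1))
      (smallParams c ρ δ κ ν h ×ˢ timeRange δ ν h) := hy.contDiffOn.sqrt hy0
  have hs0 : ∀ p ∈ smallParams c ρ δ κ ν h ×ˢ timeRange δ ν h, √(gammaCurve h p.2 1) ≠ 0 :=
    fun p hp => (Real.sqrt_pos.2 (S.snd_pos hp.2)).ne'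
  have hr : ContDiff ℝ k fun p : ℝ × ℝ => c.r p.1 := c.contDiff_r.comp contDiff_fst
  have hl : ContDiff ℝ k fun p : ℝ × ℝ => c.l p.1 := c.contDiff_l.comp contDiff_fst
  have hb : ContDiffOn ℝ k
      (fun p : ℝ × ℝ => (kappa21 (c.r p.1) (c.l p.1) h (gammaCurve h p.2)).base)
      (smallParams c ρ δ κ ν h ×ˢ timeRange δ ν h) := by
    simp only [kappa21_base]
    exact (hs.mul hr.contDiffOn).prodMk ((contDiffOn_const.div hy.contDiffOn hy0).prodMk
      ((hl.contDiffOn.div hs hs0).prodMk (contDiffOn_const.mul hs)))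
  refine contDiffOn_pi.2 (Fin.forall_fin_two.2 ⟨?_, hy.contDiffOn⟩)
  exact hs.mul (S.smooth.comp hb fun p hp => S.base_mem_of_timeRange hp.1 hp.2)

theorem zero_mem_smallParams (S : IsSide a c k ρ δ κ ν h η g M R) :
    0 ∈ smallParams c ρ δ κ ν h := by
  refine ⟨by simp, ?_, ?_⟩
  · simpa using S.rho_pos.le
  · simpa using S.kappa_pos.le

theorem eventually_smallParams (S : IsSide a c k ρ δ κ ν h η g M R) :
    ∀ᶠ μ in 𝓝[c.range] 0, μ ∈ smallParams c ρ δ κ ν h :=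
  KahanCanard.eventually_smallParams c S.rho_pos S.kappa_pos

theorem tendsto_sliceCurve (S : IsSide a c k ρ δ κ ν h η g M R) {t : ℝ}
    (ht : t ∈ timeRange δ ν h) :
    Tendsto (fun p => (p.1, sliceCurve c g h p)) (𝓝[c.range] 0 ×ˢ 𝓝[timeRange δ ν h] t)
      (nearCurve c η t) := by
  refine tendsto_fst.prodMk ?_
  have := (S.contDiffOn_sliceCurve.continuousOn (0, t) ⟨S.zero_mem_smallParams, ht⟩).tendsto
  rw [S.sliceCurve_zero ht, nhdsWithin_prod_eq] at this
  exact this.mono_left (Filter.prod_mono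
    (le_inf nhdsWithin_le_nhds (le_principal_iff.2 S.eventually_smallParams)) le_rfl)

theorem eventually_mem_timeRange (S : IsSide a c k ρ δ κ ν h η g M R) {n : ℕ}
    (h1 : 1 / δ < gammaCurve h (-n) 1) (h2 : gammaCurve h (-n) 1 < ν ^ 2 / h ^ 2) :
    ∀ᶠ t in 𝓝 (-n : ℝ), t ∈ timeRange δ ν h := by
  -- At time `0` the height is `-1/2 - h²/8 < 0`, outside the chart.
  have hn : n ≠ 0 := by
    rintro rfl
    have := inv_pos.2 S.delta_pos
    simp only [gammaCurve_one] at h1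
    norm_num at h1
    linarith [sq_nonneg h]
  have hlt : (-n : ℝ) < 0 := by rw [neg_lt_zero]; positivity
  have hc : Continuous fun t => gammaCurve h t 1 :=
    (continuous_apply 1).comp (continuous_gammaCurve h)
  filter_upwards [eventually_lt_nhds hlt, hc.continuousAt.eventually_const_lt h1,
    hc.continuousAt.eventually_lt_const h2] with t h3 h4 h5
  exact ⟨h3.le, h4.le, h5.le⟩

/-- The `n`-th iterates of the slices are smooth near an interior time `-n` of the range. -/
theorem exists_contDiffOn_kahanIter (S : IsSide a c k ρ δ κ ν h η g M R) {n : ℕ}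
    (h1 : 1 / δ < gammaCurve h (-n) 1) (h2 : gammaCurve h (-n) 1 < ν ^ 2 / h ^ 2) :
    ∃ ε > 0, (∀ μ ∈ c.range ∩ Set.Ioo (-ε) ε, ∀ t ∈ Set.Ioo (-(n : ℝ) - ε) (-n + ε),
        μ ∈ smallParams c ρ δ κ ν h ∧ t ∈ timeRange δ ν h) ∧
      ContDiffOn ℝ k (fun p : ℝ × ℝ => kahanIter a c η n (p.1, sliceCurve c g h p))
        ((c.range ∩ Set.Ioo (-ε) ε) ×ˢ Set.Ioo (-(n : ℝ) - ε) (-n + ε)) := by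
  have hT := S.eventually_mem_timeRange h1 h2
  have hT0 : (-n : ℝ) ∈ timeRange δ ν h := hT.self_of_nhds
  have hTn : 𝓝[timeRange δ ν h] (-n : ℝ) = 𝓝 (-n : ℝ) := nhdsWithin_eq_nhds.2 hT
  have hsm : ∀ᶠ p in 𝓝[c.range] (0 : ℝ) ×ˢ 𝓝 (-n : ℝ), p.1 ∈ smallParams c ρ δ κ ν h ∧
      p.2 ∈ timeRange δ ν h ∧ ContDiffAt ℝ k (kahanIter a c η n) (p.1, sliceCurve c g h p) := by
    have e1 : ∀ᶠ q in nearCurve c η (-n), ContDiffAt ℝ k (kahanIter a c η n) q :=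
      nearCurve_le c η _ ((contDiffAt_kahanIter a c η (by simp)).eventually (by simp))
    have e2 := (S.tendsto_sliceCurve hT0).eventually e1
    rw [hTn] at e2
    filter_upwards [tendsto_fst.eventually S.eventually_smallParams, tendsto_snd.eventually hT, e2]
      with p h3 h4 h5 using ⟨h3, h4, h5⟩
  obtain ⟨ε, hε, hbox⟩ : ∃ ε > 0, ∀ μ ∈ c.range ∩ Set.Ioo (-ε) ε,
      ∀ t ∈ Set.Ioo (-(n : ℝ) - ε) (-n + ε), μ ∈ smallParams c ρ δ κ ν h ∧
      t ∈ timeRange δ ν h ∧ ContDiffAt ℝ k (kahanIter a c η n) (μ, sliceCurve c g h (μ, t)) := by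
    obtain ⟨s, hs, u, hu, hsu⟩ := Filter.mem_prod_iff.1 hsm
    obtain ⟨ε1, hε1, hs1⟩ := Metric.mem_nhdsWithin_iff.1 hs
    obtain ⟨ε2, hε2, hu2⟩ := Metric.mem_nhds_iff.1 hu
    rw [Real.ball_eq_Ioo] at hs1 hu2
    refine ⟨min ε1 ε2, lt_min hε1 hε2, fun μ hμ t ht => hsu (a := (μ, t)) ⟨hs1 ⟨?_, hμ.1⟩, hu2 ?_⟩⟩
    · have := min_le_left ε1 ε2
      exact ⟨by linarith [hμ.2.1], by linarith [hμ.2.2]⟩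
    · have := min_le_right ε1 ε2
      exact ⟨by linarith [ht.1], by linarith [ht.2]⟩
  refine ⟨ε, hε, fun μ hμ t ht => ⟨(hbox μ hμ t ht).1, (hbox μ hμ t ht).2.1⟩, ?_⟩
  · rintro p ⟨hp1, hp2⟩
    have hslice := (S.contDiffOn_sliceCurve.mono (s := smallParams c ρ δ κ ν h ×ˢ timeRange δ ν h)
      (t := (c.range ∩ Set.Ioo (-ε) ε) ×ˢ Set.Ioo (-(n : ℝ) - ε) (-n + ε))
      fun q hq => ⟨(hbox _ hq.1 _ hq.2).1, (hbox _ hq.1 _ hq.2).2.1⟩) p ⟨hp1, hp2⟩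
    exact (hbox _ hp1 _ hp2).2.2.comp_contDiffWithinAt p (contDiffWithinAt_fst.prodMk hslice)

/-- Near an interior time `-n` of the range, the slices contain a unique orbit reaching the
section after `n` steps, and it depends smoothly on the parameter. -/
theorem exists_hit (S : IsSide a c k ρ δ κ ν h η g M R) {n : ℕ}
    (h1 : 1 / δ < gammaCurve h (-n) 1) (h2 : gammaCurve h (-n) 1 < ν ^ 2 / h ^ 2) :
    ∃ (τ : ℝ → ℝ) (ε : ℝ), 0 < ε ∧
      ContDiffOn ℝ k (fun μ => kahanIter a c η n (μ, sliceCurve c g h (μ, τ μ)))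
        (c.range ∩ Set.Ioo (-ε) ε) ∧
      τ 0 = -n ∧ Tendsto τ (𝓝[c.range] 0) (𝓝 (-n)) ∧
      (∀ μ ∈ c.range ∩ Set.Ioo (-ε) ε, μ ∈ smallParams c ρ δ κ ν h ∧ τ μ ∈ timeRange δ ν h ∧
        kahanIter a c η n (μ, sliceCurve c g h (μ, τ μ)) 0 = 0) ∧
      ∀ᶠ p in nearCurve c η (-n), p.2 ∈ chartTwo M (c.r p.1) (c.l p.1) h →
        kahanIter a c η n p 0 = 0 → p.2 = sliceCurve c g h (p.1, τ p.1) := by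
  have hT := S.eventually_mem_timeRange h1 h2
  have hT0 : (-n : ℝ) ∈ timeRange δ ν h := hT.self_of_nhds
  obtain ⟨ε, hε, hbox, hX⟩ := S.exists_contDiffOn_kahanIter h1 h2
  -- The factor `η` gives the crossing the same orientation on both sides: at `μ = 0` one gets
  -- `(η²/2)(t + n)`, with positive slope for either sign of `η`.
  set Ξ : ℝ × ℝ → ℝ := fun p => η * kahanIter a c η n (p.1, sliceCurve c g h p) 0 with hΞ
  have hΞs : ContDiffOn ℝ k Ξ
      ((c.range ∩ Set.Ioo (0 - ε) (0 + ε)) ×ˢ Set.Ioo (-(n : ℝ) - ε) (-n + ε)) := by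
    rw [zero_sub, zero_add]
    exact contDiffOn_const.mul (contDiffOn_pi.1 hX 0)
  have hΞ0 : ∀ᶠ t in 𝓝 (-n : ℝ), Ξ (0, t) = η ^ 2 / 2 * (t + n) := by
    filter_upwards [hT, eventually_lt_nhds (show (-n : ℝ) < -n + 1 by linarith)] with t h3 h4
    simp only [hΞ]
    rw [S.sliceCurve_zero h3, kahanIter_zero_gammaCurve a c η (by linarith), gammaCurve_zero]
    ring
  have hder : HasDerivAt (fun t => Ξ (0, t)) (η ^ 2 / 2) (-n : ℝ) := by
    have : HasDerivAt (fun t : ℝ => η ^ 2 / 2 * (t + n)) (η ^ 2 / 2) (-n : ℝ) := by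
      simpa using ((hasDerivAt_id (-n : ℝ)).add_const (n : ℝ)).const_mul (η ^ 2 / 2)
    exact this.congr_of_eventuallyEq hΞ0
  have hη2 : 0 < η ^ 2 / 2 := by have := S.eta_ne_zero; positivity
  obtain ⟨τ, ε', hε', hle, hτ0, hτs, hτ⟩ := exists_implicit_function c.uniqueDiffOn_range hε
    c.zero_mem_range S.one_le hΞs (by simpa using hΞ0.self_of_nhds) hη2 hder
  rw [zero_sub, zero_add] at hτs hτ
  have hsub : c.range ∩ Set.Ioo (-ε') ε' ⊆ c.range ∩ Set.Ioo (-ε) ε :=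
    Set.inter_subset_inter_right _ (Set.Ioo_subset_Ioo (by linarith) hle)
  have hnear : c.range ∩ Set.Ioo (-ε') ε' ∈ 𝓝[c.range] (0 : ℝ) :=
    inter_mem self_mem_nhdsWithin
      (mem_nhdsWithin_of_mem_nhds (Ioo_mem_nhds (by linarith) hε'))
  refine ⟨τ, ε', hε', ?_, hτ0, ?_, fun μ hμ => ?_, ?_⟩
  · have hpair : ContDiffOn ℝ k (fun μ => (μ, τ μ)) (c.range ∩ Set.Ioo (-ε') ε') :=
      contDiffOn_id.prodMk hτs
    have hmaps : Set.MapsTo (fun μ => (μ, τ μ)) (c.range ∩ Set.Ioo (-ε') ε')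
        ((c.range ∩ Set.Ioo (-ε) ε) ×ˢ Set.Ioo (-(n : ℝ) - ε) (-n + ε)) :=
      fun μ hμ => ⟨hsub hμ, (hτ μ hμ).1⟩
    have hcomp := ContDiffOn.comp hX hpair hmaps
    simpa only [Function.comp_def] using hcomp
  · have h0 : (0 : ℝ) ∈ c.range ∩ Set.Ioo (-ε') ε' := ⟨c.zero_mem_range, by linarith, hε'⟩
    have := (hτs.continuousOn 0 h0).tendsto
    rw [hτ0] at this
    exact this.mono_left (le_inf nhdsWithin_le_nhds (le_principal_iff.2 hnear))
  · obtain ⟨h3, h4, -⟩ := hτ μ hμ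
    obtain ⟨h5, h6⟩ := hbox μ (hsub hμ) _ h3
    exact ⟨h5, h6, (mul_eq_zero.1 h4).resolve_left S.eta_ne_zero⟩
  -- A slice point is determined by its height, so one near `γ̂(-n)` has its time near `-n`, where
  -- the implicit function theorem gives uniqueness.
  · have hcont : Tendsto (fun p : ℝ × Plane => timeOf h (p.2 1)) (nearCurve c η (-n))
        (𝓝 (-n)) := by
      have hc : Continuous fun p : ℝ × Plane => timeOf h (p.2 1) :=
        (continuous_timeOf h).comp (by fun_prop)
      have := (hc.continuousAt (x := (0, gammaCurve η (-n)))).tendsto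
      simp only [S.gammaCurve_eta_one] at this
      rw [timeOf_gammaCurve S.h_pos hT0.1] at this
      exact this.mono_left (nearCurve_le c η _)
    filter_upwards [tendsto_fst.eventually hnear, hcont.eventually
      (Ioo_mem_nhds (show -(n : ℝ) - ε' < -n by linarith) (show -(n : ℝ) < -n + ε' by linarith))]
      with p h3 h4 h5 h6
    obtain ⟨h7, h8⟩ := S.eq_sliceCurve h5
    have := (hτ p.1 h3).2.2 _ h4 (by simp only [hΞ, ← h8, h6, mul_zero])
    rw [← this]
    exact h8

end IsSide

/-! ### Uniqueness of the point on the section. -/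

theorem gammaCurve_natCast_lt {h : ℝ} (hh : h ≠ 0) {m n : ℕ} (hmn : m < n) :
    gammaCurve h (-m) 1 < gammaCurve h (-n) 1 := by
  have := gammaCurve_one_strictMono (s := m) (t := n) hh (by positivity) (by exact_mod_cast hmn)
  simpa [gammaCurve_one] using this

/-- An orbit which leaves the domain of a relation at its `N`-th point consists of at most `N`
steps. -/
theorem exists_iterate_of_reflTransGen {α : Type*} {r : α → α → Prop} {f : α → α} {x z : α} {N : ℕ}
    (hstep : ∀ j < N, ∀ v, r (f^[j] x) v → v = f (f^[j] x)) (hN : ∀ v, ¬ r (f^[N] x) v)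
    (hz : Relation.ReflTransGen r x z) : ∃ j ≤ N, z = f^[j] x := by
  induction hz with
  | refl => exact ⟨0, Nat.zero_le _, rfl⟩
  | tail _ huv ih =>
    obtain ⟨j, hj, rfl⟩ := ih
    have hjN : j ≠ N := by rintro rfl; exact hN _ huv
    exact ⟨j + 1, by omega, by
      rw [Function.iterate_succ_apply']; exact hstep j (by omega) _ huv⟩

namespace IsSide

variable {a : Coeffs} {c : Unfolding} {k : ℕ} {ρ δ κ ν h η : ℝ}
  {g : ℝ × ℝ × ℝ × ℝ → ℝ} {M : Set ChartPoint} {R : ℝ → Plane → Plane → Prop}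

/-- Orbits of the slices which start near different points of the special trajectory and reach
the section near `γ_h(0)` reach it in the same point. -/
theorem eventually_hit_eq (S : IsSide a c k ρ δ κ ν h η g M R) {Z : ℝ → Plane} {n₀ : ℕ}
    (h1 : 1 / δ < gammaCurve h (-n₀) 1) (h2 : gammaCurve h (-n₀) 1 < ν ^ 2 / h ^ 2)
    (hZ : ∀ᶠ p in nearCurve c η (-n₀), p.2 ∈ chartTwo M (c.r p.1) (c.l p.1) h →
      kahanIter a c η n₀ p 0 = 0 → kahanIter a c η n₀ p = Z p.1) (n : ℕ)
    (hn : (-n : ℝ) ∈ timeRange δ ν h) :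
    ∀ᶠ p in nearCurve c η (-n), p.2 ∈ chartTwo M (c.r p.1) (c.l p.1) h →
      kahanIter a c η n p 0 = 0 → kahanIter a c η n p = Z p.1 := by
  have hh := S.h_pos.ne'
  have hδ := one_div_pos.2 S.delta_pos
  have ne_zero : ∀ m : ℕ, 1 / δ ≤ gammaCurve h (-m) 1 → m ≠ 0 := by
    rintro m hm rfl
    rw [gammaCurve_one] at hm
    have := inv_pos.2 S.delta_pos
    norm_num at hm
    linarith [sq_nonneg h]
  have base_of : ∀ (m : ℕ) (p : ℝ × Plane), p.2 ∈ chartTwo M (c.r p.1) (c.l p.1) h →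
      (kappa21 (c.r p.1) (c.l p.1) h p.2).base ∈ baseDomain ρ δ κ ν :=
    fun m p hp => ((S.mem_iff _).1 hp.2).1
  -- One moves from `n` towards `n₀` a step at a time: by the map if `n > n₀`, by its reverse if `n
  -- < n₀`. The new time lies strictly inside the range even if `-n` is an endpoint, so the new
  -- point is in the domain of the graph and local invariance puts it on the slice.
  rcases le_total n₀ n with hle | hle
  · induction n, hle using Nat.le_induction with
    | base => exact hZ
    | succ m hm ih =>
      have hlt := gammaCurve_natCast_lt hh (Nat.lt_succ_self m)
      have hge : 1 / δ < gammaCurve h (-m) 1 := by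
        rcases hm.eq_or_lt with rfl | hm
        · exact h1
        · exact h1.trans (gammaCurve_natCast_lt hh hm)
      have hlt' := hlt.trans_le hn.2.2
      have T := tendsto_kahanTwo_natCast a c η m
      filter_upwards [T.eventually (ih ⟨by simp, hge.le, hlt'.le⟩),
        S.eventually_mem_iff (ne_zero m hge.le) (hδ.trans hge),
        T.eventually (S.eventually_base_mem hge hlt')] with p h3 h4 h5 h6 h7
      exact h3 ((h4 (base_of m p h6) h5).1 h6) h7
  · obtain ⟨d, rfl⟩ := Nat.exists_eq_add_of_le hle
    clear hle
    induction d generalizing n with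
    | zero => exact hZ
    | succ d ih =>
      have hlt := gammaCurve_natCast_lt hh (Nat.lt_succ_self n)
      have hge : 1 / δ < gammaCurve h (-(n + 1 : ℕ)) 1 := hn.2.1.trans_lt hlt
      have hlt' : gammaCurve h (-(n + 1 : ℕ)) 1 < ν ^ 2 / h ^ 2 := by
        rcases Nat.eq_zero_or_pos d with rfl | hd
        · exact h2
        · exact (gammaCurve_natCast_lt hh (show n + 1 < n + (d + 1) by omega)).trans h2
      have e : n + (d + 1) = n + 1 + d := by omega
      rw [e] at h1 h2 hZ
      have T := S.tendsto_step_back n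
      filter_upwards [T.eventually (ih (n + 1) ⟨neg_nonpos.2 (Nat.cast_nonneg _), hge.le, hlt'.le⟩ h1 h2 hZ),
        T.eventually (S.eventually_mem_iff (ne_zero n hn.2.1) (hδ.trans_le hn.2.1)),
        T.eventually (S.eventually_base_mem hge hlt'), S.eventually_kahanTwo_neg_eq n]
        with p h3 h4 h5 h6 h7 h8
      rw [kahanIter_succ] at h3
      simp only [h6] at h3 h4
      exact h3 ((h4 h5 (base_of n p h7)).2 h7) h8

/-- The points on the section of orbits starting on the slices near a given time. -/
theorem eventually_section_eq (S : IsSide a c k ρ δ κ ν h η g M R) {Z : ℝ → Plane}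
    (hZ : ∀ n : ℕ, (-n : ℝ) ∈ timeRange δ ν h → ∀ᶠ p in nearCurve c η (-n),
      p.2 ∈ chartTwo M (c.r p.1) (c.l p.1) h →
      kahanIter a c η n p 0 = 0 → kahanIter a c η n p = Z p.1) {t : ℝ}
    (ht : t ∈ timeRange δ ν h) :
    ∀ᶠ p in 𝓝[c.range] 0 ×ˢ 𝓝[timeRange δ ν h] t, ∀ z,
      Relation.ReflTransGen (fun u v => η * u 0 < 0 ∧ R p.1 u v) (sliceCurve c g h p) z →
      z 0 = 0 → z = Z p.1 := by
  -- The least `N` with `t + N > 0`. The unperturbed orbit has left the side at its `N`-th point,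
  -- and all earlier points have time `≤ 0`.
  set N := ⌊-t⌋₊ + 1 with hN
  have hN1 : 0 < t + N := by
    have := Nat.lt_floor_add_one (-t)
    rw [hN]; push_cast; linarith
  have hN2 : t + N ≤ 1 := by
    have := Nat.floor_le (neg_nonneg.2 ht.1)
    rw [hN]; push_cast; linarith
  have hcast : ∀ j ≤ N, t + j ≤ 1 := fun j hj => by
    have : (j : ℝ) ≤ N := by exact_mod_cast hj
    linarith
  have T0 := S.tendsto_sliceCurve ht
  have T : ∀ j ≤ N, Tendsto (fun p => (p.1, kahanIter a c η j (p.1, sliceCurve c g h p)))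
      (𝓝[c.range] 0 ×ˢ 𝓝[timeRange δ ν h] t) (nearCurve c η (t + j)) := fun j hj =>
    (tendsto_kahanIter a c η (hcast j hj)).comp T0
  have A1 : ∀ᶠ p in 𝓝[c.range] 0 ×ˢ 𝓝[timeRange δ ν h] t, ∀ j ∈ Finset.range N,
      kahanDet a (c.r p.1) 1 η (kahanIter a c η j (p.1, sliceCurve c g h p)) ≠ 0 := by
    refine (Finset.eventually_all _).2 fun j hj => ?_
    have hj' := Finset.mem_range.1 hj
    refine (T j hj'.le).eventually (eventually_kahanDet_ne_zero_of_nonpos a c η ?_)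
    have := hcast (j + 1) hj'
    push_cast at this
    linarith
  have A2 := (T N le_rfl).eventually (eventually_side_pos c S.eta_ne_zero hN1)
  have A3 : ∀ᶠ p in 𝓝[c.range] 0 ×ˢ 𝓝[timeRange δ ν h] t, ∀ j ∈ Finset.range (N + 1),
      kahanIter a c η j (p.1, sliceCurve c g h p) 0 = 0 →
        kahanIter a c η j (p.1, sliceCurve c g h p) = Z p.1 := by
    refine (Finset.eventually_all _).2 fun j hj => ?_
    have hj' : j ≤ N := by simpa [Nat.lt_succ_iff] using hj
    -- If `t + j ≠ 0`, the `j`-th point stays off the section for nearby parameters and starting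
    -- times. If `t + j = 0`, the starting time is the integer `-j` and the local statement `hZ`
    -- applies.
    rcases lt_trichotomy (t + j) 0 with hlt | heq | hgt
    · filter_upwards [(T j hj').eventually (eventually_side_neg c S.eta_ne_zero hlt)] with p h1 h2
      rw [h2, mul_zero] at h1
      exact absurd h1 (lt_irrefl _)
    · have htj : t = -j := by linarith
      subst htj
      filter_upwards [T0.eventually (hZ j ht), tendsto_fst.eventually S.eventually_smallParams,
        tendsto_snd.eventually eventually_mem_nhdsWithin] with p h1 h2 h3
      exact h1 (S.sliceCurve_mem h2 h3)
    · filter_upwards [(T j hj').eventually (eventually_side_pos c S.eta_ne_zero hgt)] with p h1 h2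
      rw [h2, mul_zero] at h1
      exact absurd h1 (lt_irrefl _)
  filter_upwards [A1, A2, A3] with p h1 h2 h3 z hz hz0
  -- A step of `R` from a point off the poles must be the Kahan step, and no step is allowed from
  -- the `N`-th point; so every reachable point is an iterate of index at most `N`.
  obtain ⟨j, hj, rfl⟩ := exists_iterate_of_reflTransGen (f := kahanTwo a c η p.1) (N := N)
    (fun j hj v hv => (eq_kahan_iff (h1 j (Finset.mem_range.2 hj))).2
      (S.implicit_of_step _ _ _ hv.2)) (fun v hv => lt_asymm h2 hv.1) hz
  exact h3 j (Finset.mem_range.2 (Nat.lt_succ_of_le hj)) hz0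

/-- The sheet of the continued manifold meets the section in exactly one point, which depends
smoothly on the parameter. -/
theorem exists_section_point (S : IsSide a c k ρ δ κ ν h η g M R) {n₀ : ℕ}
    (h1 : 1 / δ < gammaCurve h (-n₀) 1) (h2 : gammaCurve h (-n₀) 1 < ν ^ 2 / h ^ 2) :
    ∃ (Z : ℝ → ℝ) (ε : ℝ), 0 < ε ∧ ContDiffOn ℝ k Z (c.range ∩ Set.Ioo (-ε) ε) ∧
      ![0, Z 0] = gammaCurve η 0 ∧ ∀ μ ∈ c.range ∩ Set.Ioo (-ε) ε, ∀ z : Plane,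
        ((∃ m ∈ chartTwo M (c.r μ) (c.l μ) h,
          Relation.ReflTransGen (fun u v => η * u 0 < 0 ∧ R μ u v) m z) ∧ z 0 = 0) ↔
            z = ![0, Z μ] := by
  obtain ⟨τ, ε, hε, hs, hτ0, hτt, hτ, huniq⟩ := S.exists_hit h1 h2
  set Z : ℝ → Plane := fun μ => kahanIter a c η n₀ (μ, sliceCurve c g h (μ, τ μ)) with hZdef
  have hT0 : (-n₀ : ℝ) ∈ timeRange δ ν h := ⟨by simp, h1.le, h2.le⟩
  have hZn : ∀ᶠ p in nearCurve c η (-n₀), p.2 ∈ chartTwo M (c.r p.1) (c.l p.1) h →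
      kahanIter a c η n₀ p 0 = 0 → kahanIter a c η n₀ p = Z p.1 := by
    filter_upwards [huniq] with p h3 h4 h5
    have := h3 h4 h5
    rw [hZdef]
    simp only
    rw [← this]
  have hcompact : IsCompact (timeRange δ ν h) := by
    rw [timeRange_eq_Icc S.delta_pos S.h_pos]; exact isCompact_Icc
  -- Compactness of the range of times turns the local uniqueness at each starting time into
  -- uniqueness for all of them on one neighbourhood of `μ = 0`.
  have hunique : ∀ᶠ μ in 𝓝[c.range] (0 : ℝ), ∀ t ∈ timeRange δ ν h, ∀ z,
      Relation.ReflTransGen (fun u v => η * u 0 < 0 ∧ R μ u v) (sliceCurve c g h (μ, t)) z →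
      z 0 = 0 → z = Z μ := by
    refine hcompact.induction_on (p := fun s => ∀ᶠ μ in 𝓝[c.range] (0 : ℝ), ∀ t ∈ s, ∀ z,
      Relation.ReflTransGen (fun u v => η * u 0 < 0 ∧ R μ u v) (sliceCurve c g h (μ, t)) z →
      z 0 = 0 → z = Z μ) (by simp) (fun s t hst H => H.mono fun μ hμ x hx => hμ x (hst hx))
      (fun s t hs' ht' => ?_) fun t ht => ?_
    · filter_upwards [hs', ht'] with μ h3 h4 x hx
      exact hx.elim (h3 x) (h4 x)
    · obtain ⟨U, hU, V, hV, hUV⟩ := Filter.mem_prod_iff.1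
        (S.eventually_section_eq (S.eventually_hit_eq h1 h2 hZn) ht)
      exact ⟨V, hV, Filter.mem_of_superset hU fun μ hμ x hx => hUV (a := (μ, x)) ⟨hμ, hx⟩⟩
  have hexists : ∀ᶠ μ in 𝓝[c.range] (0 : ℝ),
      Relation.ReflTransGen (fun u v => η * u 0 < 0 ∧ R μ u v) (sliceCurve c g h (μ, τ μ))
        (Z μ) := by
    have T : Tendsto (fun μ => (μ, τ μ)) (𝓝[c.range] 0)
        (𝓝[c.range] 0 ×ˢ 𝓝[timeRange δ ν h] (-n₀ : ℝ)) := by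
      refine tendsto_id.prodMk (tendsto_nhdsWithin_iff.2 ⟨hτt, ?_⟩)
      filter_upwards [self_mem_nhdsWithin,
        mem_nhdsWithin_of_mem_nhds (Ioo_mem_nhds (neg_neg_of_pos hε) hε)] with μ h3 h4
      exact (hτ μ ⟨h3, h4⟩).2.1
    exact ((S.tendsto_sliceCurve hT0).comp T).eventually (S.eventually_reflTransGen n₀)
  obtain ⟨ε', hε', hball⟩ := Metric.mem_nhdsWithin_iff.1 (hunique.and hexists)
  rw [Real.ball_eq_Ioo, zero_sub, zero_add] at hball
  have hZ0 : ∀ μ ∈ c.range ∩ Set.Ioo (-ε) ε, Z μ = ![0, Z μ 1] := fun μ hμ => by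
    ext i
    fin_cases i
    · exact (hτ μ hμ).2.2
    · rfl
  have hsub : c.range ∩ Set.Ioo (-min ε ε') (min ε ε') ⊆ c.range ∩ Set.Ioo (-ε) ε :=
    Set.inter_subset_inter_right _
      (Set.Ioo_subset_Ioo (neg_le_neg (min_le_left _ _)) (min_le_left _ _))
  refine ⟨fun μ => Z μ 1, min ε ε', lt_min hε hε', ((contDiffOn_pi.1 hs) 1).mono hsub, ?_,
    fun μ hμ z => ?_⟩
  · rw [← hZ0 0 ⟨c.zero_mem_range, by linarith, hε⟩, hZdef]
    simp only [hτ0]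
    rw [S.sliceCurve_zero hT0, kahanIter_zero_gammaCurve a c η (by simp), neg_add_cancel]
  · obtain ⟨h3, h4⟩ := hball (a := μ) ⟨⟨(neg_le_neg (min_le_right _ _)).trans_lt hμ.2.1,
      hμ.2.2.trans_le (min_le_right _ _)⟩, hμ.1⟩
    obtain ⟨h5, h6, h7⟩ := hτ μ (hsub hμ)
    rw [← hZ0 μ (hsub hμ)]
    constructor
    · rintro ⟨⟨m, hm, hmz⟩, hz⟩
      obtain ⟨h8, h9⟩ := S.eq_sliceCurve hm
      rw [h9] at hmz
      exact h3 _ h8 z hmz hz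
    · rintro rfl
      exact ⟨⟨_, S.sliceCurve_mem h5 h6, h4⟩, h7⟩

end IsSide

/-! ### The linearization along the special trajectory -/

/-- The Jacobian matrix of the unperturbed map at `γ̂(t)`. -/
def stepMatrix (h t : ℝ) : Matrix (Fin 2) (Fin 2) ℝ :=
  (1 - h ^ 2 * t / 2 + h ^ 2 / 4)⁻¹ •
    !![1 + h ^ 2 / 4 + h ^ 2 * t / 2, -h;
      h * (1 + h ^ 2 / 4), 1 - h ^ 2 / 4 - h ^ 2 * t / 2]

theorem mapF_eq (a : Coeffs) (c : Unfolding) (h : ℝ) (z : Plane) :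
    mapF a c h z = ![z 0 + h * ((-z 1 + z 0 ^ 2 - h / 2 * z 0) / (1 - h * z 0 + h ^ 2 / 4)),
      z 1 + h * ((h / 2 * (-z 1 + z 0 ^ 2) + (1 - h * z 0) * z 0) /
        (1 - h * z 0 + h ^ 2 / 4))] := by
  rw [mapF, kahanTwo, unfoldedField_zero, kahan_field, kahanDet_zero]
  have e0 : field a 0 1 0 z 0 = -z 1 + z 0 ^ 2 := by simp [field]
  have e1 : field a 0 1 0 z 1 = z 0 := by simp [field]
  rw [e0, e1]
  congr 2 <;> ring_nf

theorem jacobian_mapF_gammaCurve {a : Coeffs} {c : Unfolding} {h t : ℝ}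
    (ht : 1 - h ^ 2 * t / 2 + h ^ 2 / 4 ≠ 0) :
    jacobian (mapF a c h) (gammaCurve h t) = stepMatrix h t := by
  set z := gammaCurve h t with hz
  have h0 := hasFDerivAt_coord 0 z
  have h1 := hasFDerivAt_coord 1 z
  have z0 : z 0 = h * t / 2 := rfl
  have z1 : z 1 = h ^ 2 * t ^ 2 / 4 - 1 / 2 - h ^ 2 / 8 := rfl
  have hD : 1 - h * z 0 + h ^ 2 / 4 ≠ 0 := by
    convert ht using 1; rw [z0]; ring
  have hd := (hasDerivAt_inv hD).comp_hasFDerivAt z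
    (((h0.const_mul h).const_sub 1).add_const (h ^ 2 / 4))
  obtain ⟨D, hDeq⟩ : ∃ D, D = 1 - h ^ 2 * t / 2 + h ^ 2 / 4 := ⟨_, rfl⟩
  have eD : 1 - h * z 0 + h ^ 2 / 4 = D := by rw [hDeq, z0]; ring
  rw [← hDeq] at ht
  obtain ⟨L0, k0, e0⟩ : ∃ L : Plane →L[ℝ] ℝ, HasFDerivAt (fun w => mapF a c h w 0) L z ∧
      ∀ v, L v = stepMatrix h t 0 0 * v 0 + stepMatrix h t 0 1 * v 1 := by
    refine ⟨_, (h0.add (((((h1.neg.add (h0.pow 2)).sub (h0.const_mul (h / 2))).mul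
      hd).const_mul h))).congr_of_eventuallyEq (Eventually.of_forall fun w => ?_), fun v => ?_⟩
    · simp [mapF_eq, div_eq_mul_inv]
    · simp [stepMatrix, ← hDeq]
      rw [eD, z0, z1]
      field_simp
      rw [hDeq]
      ring
  obtain ⟨L1, k1, e1⟩ : ∃ L : Plane →L[ℝ] ℝ, HasFDerivAt (fun w => mapF a c h w 1) L z ∧
      ∀ v, L v = stepMatrix h t 1 0 * v 0 + stepMatrix h t 1 1 * v 1 := by
    refine ⟨_, (h1.add ((((((h1.neg.add (h0.pow 2)).const_mul (h / 2)).add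
      (((h0.const_mul h).const_sub 1).mul h0)).mul
      hd).const_mul h))).congr_of_eventuallyEq (Eventually.of_forall fun w => ?_), fun v => ?_⟩
    · simp [mapF_eq, div_eq_mul_inv]
    · simp [stepMatrix, ← hDeq]
      rw [eD, z0, z1]
      field_simp
      rw [hDeq]
      ring
  have key : HasFDerivAt (mapF a c h) (ContinuousLinearMap.pi ![L0, L1]) z :=
    hasFDerivAt_pi.2 (Fin.forall_fin_two.2 ⟨k0, k1⟩)
  unfold jacobian
  rw [key.fderiv]
  ext i j
  fin_cases i <;> fin_cases j <;> simp [LinearMap.toMatrix'_apply, e0, e1]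

/-- The chain rule for time reversal: the inverse of the linearization at `γ̂(t)` is the
linearization for the step `-h` at the next point, whose reversed time is `-(t + 1)`. -/
theorem stepMatrix_neg_mul {h t : ℝ} (h1 : 1 - h ^ 2 * t / 2 + h ^ 2 / 4 ≠ 0)
    (h2 : 1 + h ^ 2 * (t + 1) / 2 + h ^ 2 / 4 ≠ 0) :
    stepMatrix (-h) (-(t + 1)) * stepMatrix h t = 1 := by
  have e : 1 - (-h) ^ 2 * (-(t + 1)) / 2 + (-h) ^ 2 / 4 = 1 + h ^ 2 * (t + 1) / 2 + h ^ 2 / 4 := by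
    ring
  have key : !![1 + (-h) ^ 2 / 4 + (-h) ^ 2 * (-(t + 1)) / 2, -(-h);
      -h * (1 + (-h) ^ 2 / 4), 1 - (-h) ^ 2 / 4 - (-h) ^ 2 * (-(t + 1)) / 2] *
      !![1 + h ^ 2 / 4 + h ^ 2 * t / 2, -h;
        h * (1 + h ^ 2 / 4), 1 - h ^ 2 / 4 - h ^ 2 * t / 2] =
      ((1 - h ^ 2 * t / 2 + h ^ 2 / 4) * (1 + h ^ 2 * (t + 1) / 2 + h ^ 2 / 4)) •
        (1 : Matrix (Fin 2) (Fin 2) ℝ) := by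
    ext i j
    fin_cases i <;> fin_cases j <;> simp [Matrix.mul_apply, Fin.sum_univ_two] <;> ring
  rw [stepMatrix, stepMatrix, e, Matrix.smul_mul, Matrix.mul_smul, smul_smul, key, smul_smul,
    ← mul_inv, mul_comm (1 + h ^ 2 * (t + 1) / 2 + h ^ 2 / 4), inv_mul_cancel₀ (mul_ne_zero h1 h2),
    one_smul]

theorem stepMatrix_int_mul {h : ℝ} (hpole : ∀ n : ℕ, h ^ 2 * (2 * (n : ℝ) - 1) ≠ 4) (n : ℤ) :
    stepMatrix (-h) (-((n : ℝ) + 1)) * stepMatrix h n = 1 := by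
  refine stepMatrix_neg_mul (kahanDet_int_ne_zero hpole n) ?_
  have := kahanDet_int_ne_zero hpole (-(n + 1))
  convert this using 1
  push_cast
  ring

/-- The adjoint equation makes the pairing with solutions of the linearized equation constant. -/
theorem IsAdjointSolution.dotProduct_mulVec {a : Coeffs} {c : Unfolding} {h : ℝ} {ψ : ℤ → Plane}
    (hψ : IsAdjointSolution a c h ψ) (hpole : ∀ n : ℕ, h ^ 2 * (2 * (n : ℝ) - 1) ≠ 4) (n : ℤ)
    (w : Plane) :
    ψ (n + 1) ⬝ᵥ (jacobian (mapF a c h) (gamma h n) *ᵥ w) = ψ n ⬝ᵥ w := by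
  have hJ : jacobian (mapF a c h) (gamma h n) = stepMatrix h n :=
    jacobian_mapF_gammaCurve (kahanDet_int_ne_zero hpole n)
  have hinv := stepMatrix_int_mul hpole n
  have hT : (stepMatrix h n)ᵀ * (stepMatrix (-h) (-((n : ℝ) + 1)))ᵀ = 1 := by
    rw [← Matrix.transpose_mul, hinv, Matrix.transpose_one]
  rw [hψ n, hJ, Matrix.inv_eq_right_inv hT, Matrix.mulVec_transpose, ← Matrix.dotProduct_mulVec,
    Matrix.mulVec_mulVec, hinv, Matrix.one_mulVec]

theorem sum_Ico_int_of_sub {e s : ℤ → ℝ} {m n : ℤ} (hmn : m ≤ n)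
    (he : ∀ i, m ≤ i → i < n → e (i + 1) = e i + s i) :
    ∑ i ∈ Finset.Ico m n, s i = e n - e m := by
  induction n, hmn using Int.leInduction with
  | base => simp
  | succ n hn ih =>
    rw [← Finset.insert_Ico_right_eq_Ico_add_one hn, Finset.sum_insert (by simp),
      ih fun i h1 h2 => he i h1 (by omega), he n hn (by omega)]
    ring

/-- The finite-sum formula for the separation of the manifolds. -/
theorem IsAdjointSolution.finite_sum_formula {a : Coeffs} {c : Unfolding} {h : ℝ} {ψ : ℤ → Plane}
    (hψ : IsAdjointSolution a c h ψ) (hpole : ∀ n : ℕ, h ^ 2 * (2 * (n : ℝ) - 1) ≠ 4)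
    {wm wp : ℤ → Plane} (hm : IsVariationalSolution a c h (Set.Iio 0) wm)
    (hp : IsVariationalSolution a c h (Set.Ici 0) wp) (N : ℕ) :
    ψ 0 ⬝ᵥ wm 0 - ψ 0 ⬝ᵥ wp 0 = ∑ n ∈ Finset.Ico (-(N : ℤ)) N,
      ψ (n + 1) ⬝ᵥ mapG a c h (gamma h n) 0 + ψ (-N) ⬝ᵥ wm (-N) - ψ N ⬝ᵥ wp N := by
  -- Pairing the variational equation with `ψ(n+1)` turns `DF w(n)` into `⟨ψ(n), w(n)⟩`, so the
  -- summands are increments of the pairing. Each half of the sum uses its own solution `w_∓`.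
  have e1 := sum_Ico_int_of_sub (e := fun n => ψ n ⬝ᵥ wm n)
    (s := fun n => ψ (n + 1) ⬝ᵥ mapG a c h (gamma h n) 0) (m := -(N : ℤ)) (n := 0) (by omega)
    fun i _ hi => by
      rw [hm i hi, dotProduct_add, hψ.dotProduct_mulVec hpole]
  have e2 := sum_Ico_int_of_sub (e := fun n => ψ n ⬝ᵥ wp n)
    (s := fun n => ψ (n + 1) ⬝ᵥ mapG a c h (gamma h n) 0) (m := 0) (n := N) (by omega)
    fun i hi _ => by
      rw [hp i hi, dotProduct_add, hψ.dotProduct_mulVec hpole]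
  rw [← Finset.Ico_union_Ico_eq_Ico (show -(N : ℤ) ≤ 0 by omega) (show (0 : ℤ) ≤ N by omega),
    Finset.sum_union (Finset.Ico_disjoint_Ico_consecutive _ _ _), e1, e2]
  ring

theorem abs_dotProduct_le (u v : Plane) : |u ⬝ᵥ v| ≤ 2 * (‖u‖ * ‖v‖) := by
  rw [dotProduct, Fin.sum_univ_two]
  have h : ∀ i, |u i * v i| ≤ ‖u‖ * ‖v‖ := fun i => by
    rw [abs_mul]
    exact mul_le_mul (norm_le_pi_norm u i) (norm_le_pi_norm v i) (abs_nonneg _) (norm_nonneg _)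
  linarith [abs_add_le (u 0 * v 0) (u 1 * v 1), h 0, h 1]

/-- The limit formula when the boundary terms vanish. -/
theorem IsAdjointSolution.tendsto_sum {a : Coeffs} {c : Unfolding} {h : ℝ} {ψ : ℤ → Plane}
    (hψ : IsAdjointSolution a c h ψ) (hpole : ∀ n : ℕ, h ^ 2 * (2 * (n : ℝ) - 1) ≠ 4)
    {wm wp : ℤ → Plane} (hm : IsVariationalSolution a c h (Set.Iio 0) wm)
    (hp : IsVariationalSolution a c h (Set.Ici 0) wp)
    (h1 : Tendsto (fun N : ℕ => ‖ψ (-N)‖ * ‖wm (-N)‖) atTop (𝓝 0))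
    (h2 : Tendsto (fun N : ℕ => ‖ψ N‖ * ‖wp N‖) atTop (𝓝 0)) :
    Tendsto (fun N : ℕ => ∑ n ∈ Finset.Ico (-(N : ℤ)) N, ψ (n + 1) ⬝ᵥ mapG a c h (gamma h n) 0)
      atTop (𝓝 (ψ 0 ⬝ᵥ wm 0 - ψ 0 ⬝ᵥ wp 0)) := by
  have b1 : Tendsto (fun N : ℕ => ψ (-N) ⬝ᵥ wm (-N)) atTop (𝓝 0) :=
    squeeze_zero_norm (fun N => abs_dotProduct_le _ _) (by simpa using h1.const_mul 2)
  have b2 : Tendsto (fun N : ℕ => ψ N ⬝ᵥ wp N) atTop (𝓝 0) :=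
    squeeze_zero_norm (fun N => abs_dotProduct_le _ _) (by simpa using h2.const_mul 2)
  have := (b2.sub b1).const_add (ψ 0 ⬝ᵥ wm 0 - ψ 0 ⬝ᵥ wp 0)
  rw [sub_zero, add_zero] at this
  refine this.congr fun N => ?_
  rw [hψ.finite_sum_formula hpole hm hp N]
  ring

/-! ### Subexponential growth -/

/-- Sequences growing more slowly than every exponential. -/
def Subexponential (u : ℕ → ℝ) : Prop :=
  ∀ c : ℝ, 0 < c → Tendsto (fun n : ℕ => u n * Real.exp (-c * n)) atTop (𝓝 0)

namespace Subexponential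

theorem tendsto_exp_neg {c : ℝ} (hc : 0 < c) :
    Tendsto (fun n : ℕ => Real.exp (-c * n)) atTop (𝓝 0) :=
  Real.tendsto_exp_atBot.comp
    (tendsto_natCast_atTop_atTop.const_mul_atTop_of_neg (neg_neg_of_pos hc))

theorem of_tendsto {u : ℕ → ℝ} {L : ℝ} (hu : Tendsto u atTop (𝓝 L)) : Subexponential u :=
  fun c hc => by simpa using hu.mul (tendsto_exp_neg hc)

theorem const (L : ℝ) : Subexponential fun _ => L := of_tendsto tendsto_const_nhds

theorem add {u v : ℕ → ℝ} (hu : Subexponential u) (hv : Subexponential v) :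
    Subexponential fun n => u n + v n := fun c hc => by
  simpa [add_mul] using (hu c hc).add (hv c hc)

theorem mul {u v : ℕ → ℝ} (hu : Subexponential u) (hv : Subexponential v) :
    Subexponential fun n => u n * v n := fun c hc => by
  have := (hu (c / 2) (half_pos hc)).mul (hv (c / 2) (half_pos hc))
  rw [mul_zero] at this
  refine this.congr fun n => ?_
  rw [mul_mul_mul_comm, ← Real.exp_add]
  congr 2
  ring

theorem natCast : Subexponential fun n => (n : ℝ) := fun c hc => by
  have h1 : Tendsto (fun n : ℕ => c * (n : ℝ)) atTop atTop :=
    tendsto_natCast_atTop_atTop.const_mul_atTop hc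
  have := ((Real.tendsto_pow_mul_exp_neg_atTop_nhds_zero 1).comp h1).const_mul c⁻¹
  rw [mul_zero] at this
  refine this.congr fun n => ?_
  simp only [Function.comp_apply, pow_one, neg_mul]
  field_simp

theorem congr {u v : ℕ → ℝ} (hu : Subexponential u) (h : ∀ n, u n = v n) : Subexponential v :=
  funext h ▸ hu

theorem abs {u : ℕ → ℝ} (hu : Subexponential u) : Subexponential fun n => |u n| := fun c hc => by
  have := (hu c hc).abs
  rw [abs_zero] at this
  exact this.congr fun n => by rw [abs_mul, Real.abs_exp]

theorem of_le {u v : ℕ → ℝ} (hv : Subexponential v) (hu : ∀ n, 0 ≤ u n) (h : ∀ n, u n ≤ v n) :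
    Subexponential u := fun c hc =>
  squeeze_zero (fun n => mul_nonneg (hu n) (Real.exp_pos _).le)
    (fun n => mul_le_mul_of_nonneg_right (h n) (Real.exp_pos _).le) (hv c hc)

/-- A linear recursion whose factors tend to `1` has subexponential growth. -/
theorem of_recursion {u α β : ℕ → ℝ} (hu : ∀ n, 0 ≤ u n) (hα : Tendsto α atTop (𝓝 1))
    (hβ : Subexponential β) (h : ∀ n, u (n + 1) ≤ α n * u n + β n) : Subexponential u := by
  have bound : ∀ c : ℝ, 0 < c → ∃ (B : ℝ) (N : ℕ), ∀ n ≥ N, u n * Real.exp (-c * n) ≤ B := by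
    intro c hc
    have hlt : Real.exp (-c) < 1 := by rw [Real.exp_lt_one_iff]; linarith
    -- With `e^{-c} < q < 1`, the weighted sequence `v n = u n * exp (-c * n)` eventually satisfies
    -- `v (n+1) ≤ q * v n + e^{-c}`, and `B` is preserved since `B * (1 - q) ≥ 1 > e^{-c}`.
    obtain ⟨q, hq1, hq2⟩ := exists_between hlt
    have e1 : ∀ᶠ n in atTop, α n * Real.exp (-c) ≤ q := by
      have := hα.mul_const (Real.exp (-c))
      rw [one_mul] at this
      exact this.eventually_le_const hq1
    have e2 : ∀ᶠ n : ℕ in atTop, β n * Real.exp (-c * n) ≤ 1 :=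
      (hβ c hc).eventually_le_const one_pos
    obtain ⟨N, hN⟩ := eventually_atTop.1 (e1.and e2)
    refine ⟨max (u N * Real.exp (-c * N)) (1 / (1 - q)), N, fun n hn => ?_⟩
    induction n, hn using Nat.le_induction with
    | base => exact le_max_left _ _
    | succ n hn ih =>
      obtain ⟨h1, h2⟩ := hN n hn
      set B := max (u N * Real.exp (-c * N)) (1 / (1 - q))
      have hB : 1 ≤ B * (1 - q) := by
        rw [← div_le_iff₀ (by linarith)]; exact le_max_right _ _
      have hq0 : 0 < q := (Real.exp_pos _).trans hq1
      have hv : 0 ≤ u n * Real.exp (-c * n) := mul_nonneg (hu n) (Real.exp_pos _).le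
      have hexp : Real.exp (-c * ((n + 1 : ℕ) : ℝ)) = Real.exp (-c) * Real.exp (-c * n) := by
        rw [← Real.exp_add]; congr 1; push_cast; ring
      calc u (n + 1) * Real.exp (-c * ((n + 1 : ℕ) : ℝ))
          ≤ (α n * u n + β n) * (Real.exp (-c) * Real.exp (-c * n)) := by
            rw [hexp]; exact mul_le_mul_of_nonneg_right (h n) (by positivity)
        _ = (α n * Real.exp (-c)) * (u n * Real.exp (-c * n)) +
            Real.exp (-c) * (β n * Real.exp (-c * n)) := by ring
        _ ≤ q * B + Real.exp (-c) * 1 := by gcongr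
        _ ≤ B := by nlinarith
  intro c hc
  -- Boundedness at the rate `c/2` leaves a spare factor `exp (-(c/2) * n)`, which forces
  -- convergence to `0` at the rate `c`.
  obtain ⟨B, N, hB⟩ := bound (c / 2) (half_pos hc)
  refine squeeze_zero' (Eventually.of_forall fun n => mul_nonneg (hu n) (Real.exp_pos _).le)
    (eventually_atTop.2 ⟨N, fun n hn => ?_⟩)
    (by simpa only [mul_zero] using (tendsto_exp_neg (half_pos hc)).const_mul B)
  calc u n * Real.exp (-c * n) = u n * Real.exp (-(c / 2) * n) * Real.exp (-(c / 2) * n) := by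
        rw [mul_assoc, ← Real.exp_add]; congr 2; ring
    _ ≤ B * Real.exp (-(c / 2) * n) :=
        mul_le_mul_of_nonneg_right (hB n hn) (Real.exp_pos _).le

theorem summable {u f : ℕ → ℝ} (hu : Subexponential u) {c : ℝ} (hc : 0 < c)
    (h : ∀ n, |f n| ≤ u n * Real.exp (-c * n)) : Summable f := by
  refine summable_of_isBigO_nat (Real.summable_exp_nat_mul_iff.2
    (neg_neg_of_pos (half_pos hc))) ?_
  refine Asymptotics.IsBigO.of_bound 1 ?_
  filter_upwards [(hu (c / 2) (half_pos hc)).eventually_le_const one_pos] with n hn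
  rw [Real.norm_eq_abs, Real.norm_eq_abs, Real.abs_exp]
  calc |f n| ≤ u n * Real.exp (-c * n) := h n
    _ = u n * Real.exp (-(c / 2) * n) * Real.exp (-(c / 2) * n) := by
        rw [mul_assoc, ← Real.exp_add]; congr 2; ring
    _ ≤ 1 * Real.exp (-(c / 2) * n) := mul_le_mul_of_nonneg_right hn (Real.exp_pos _).le
    _ = 1 * Real.exp (n * -(c / 2)) := by rw [mul_comm (n : ℝ)]

theorem norm {z : ℕ → Plane} (h0 : Subexponential fun n => z n 0)
    (h1 : Subexponential fun n => z n 1) : Subexponential fun n => ‖z n‖ := by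
  refine (h0.abs.add h1.abs).of_le (fun n => norm_nonneg _) fun n => ?_
  refine (pi_norm_le_iff_of_nonneg (by positivity)).2 (Fin.forall_fin_two.2 ⟨?_, ?_⟩)
  · rw [Real.norm_eq_abs]; linarith [abs_nonneg (z n 1)]
  · rw [Real.norm_eq_abs]; linarith [abs_nonneg (z n 0)]

end Subexponential

/-! ### Growth of the solutions of the variational equation -/

theorem tendsto_affine_div (p q r : ℝ) {s : ℝ} (hs : s ≠ 0) :
    Tendsto (fun n : ℕ => (p + q * n) / (r + s * n)) atTop (𝓝 (q / s)) := by
  have h1 : ∀ x : ℝ, Tendsto (fun n : ℕ => x / (n : ℝ)) atTop (𝓝 0) := fun x =>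
    tendsto_const_nhds.div_atTop tendsto_natCast_atTop_atTop
  have := ((h1 p).add_const q).div ((h1 r).add_const s) (by simpa using hs)
  simp only [zero_add] at this
  refine this.congr' ?_
  filter_upwards [eventually_gt_atTop 0] with n hn
  have hn' : (0 : ℝ) < n := by exact_mod_cast hn
  rw [Pi.div_apply, div_add' _ _ _ hn'.ne', div_add' _ _ _ hn'.ne',
    div_div_div_cancel_right₀ hn'.ne']

/-- The operator norm of a matrix with respect to the maximum norm. -/
def rowBound (A : Matrix (Fin 2) (Fin 2) ℝ) : ℝ :=
  max (|A 0 0| + |A 0 1|) (|A 1 0| + |A 1 1|)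

theorem norm_mulVec_le_rowBound (A : Matrix (Fin 2) (Fin 2) ℝ) (w : Plane) :
    ‖A *ᵥ w‖ ≤ rowBound A * ‖w‖ := by
  have h0 := norm_le_pi_norm w 0
  have h1 := norm_le_pi_norm w 1
  rw [Real.norm_eq_abs] at h0 h1
  have hb : 0 ≤ rowBound A := le_trans (by positivity) (le_max_left _ _)
  have row : ∀ i, |A i 0| + |A i 1| ≤ rowBound A → ‖(A *ᵥ w) i‖ ≤ rowBound A * ‖w‖ := by
    intro i hi
    have e : (A *ᵥ w) i = A i 0 * w 0 + A i 1 * w 1 := by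
      simp [Matrix.mulVec, dotProduct, Fin.sum_univ_two]
    rw [e, Real.norm_eq_abs]
    calc |A i 0 * w 0 + A i 1 * w 1| ≤ |A i 0| * |w 0| + |A i 1| * |w 1| := by
          rw [← abs_mul, ← abs_mul]; exact abs_add_le _ _
      _ ≤ |A i 0| * ‖w‖ + |A i 1| * ‖w‖ := by gcongr
      _ = (|A i 0| + |A i 1|) * ‖w‖ := by ring
      _ ≤ rowBound A * ‖w‖ := by gcongr
  exact (pi_norm_le_iff_of_nonneg (mul_nonneg hb (norm_nonneg _))).2
    (Fin.forall_fin_two.2 ⟨row 0 (le_max_left _ _), row 1 (le_max_right _ _)⟩)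

/-- Diagonal entries are quotients of affine functions of `n` tending to `-1` and `1`; off-diagonal
ones have constant numerators and vanish in the limit. For `-h` the same limit controls the inverse
linearizations. -/
theorem tendsto_rowBound_stepMatrix {h : ℝ} (hh : h ≠ 0) :
    Tendsto (fun n : ℕ => rowBound (stepMatrix h n)) atTop (𝓝 1) := by
  have hs : -(h ^ 2 / 2) ≠ 0 := by simpa using hh
  have entry : ∀ p q : ℝ, Tendsto (fun n : ℕ =>
      (1 - h ^ 2 * (n : ℝ) / 2 + h ^ 2 / 4)⁻¹ * (p + q * n)) atTop (𝓝 (q / -(h ^ 2 / 2))) :=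
    fun p q => (tendsto_affine_div p q (1 + h ^ 2 / 4) hs).congr fun n => by
      rw [inv_mul_eq_div]; congr 1; ring
  have t00 := (entry (1 + h ^ 2 / 4) (h ^ 2 / 2)).abs
  have t01 := (entry (-h) 0).abs
  have t10 := (entry (h * (1 + h ^ 2 / 4)) 0).abs
  have t11 := (entry (1 - h ^ 2 / 4) (-(h ^ 2 / 2))).abs
  have := (t00.add t01).max (t10.add t11)
  rw [div_neg, div_self (neg_ne_zero.1 hs), div_self hs] at this
  simp only [zero_div, abs_zero, abs_neg, abs_one, add_zero, zero_add, max_self] at this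
  refine this.congr fun n => ?_
  simp only [rowBound, stepMatrix, Matrix.smul_apply, smul_eq_mul, Matrix.of_apply,
    Matrix.cons_val', Matrix.cons_val_zero, Matrix.cons_val_one, Matrix.cons_val_fin_one]
  congr 4 <;> ring

theorem Unfolding.hasDerivAt_r (c : Unfolding) (μ : ℝ) : HasDerivAt c.r (c.r 1) μ := by
  cases c
  · exact hasDerivAt_const _ _
  · exact hasDerivAt_id _

theorem Unfolding.hasDerivAt_l (c : Unfolding) (μ : ℝ) : HasDerivAt c.l (c.l 1) μ := by
  cases c
  · exact hasDerivAt_id _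
  · exact hasDerivAt_const _ _

/-- The perturbation along the special trajectory. -/
theorem mapG_gammaCurve {a : Coeffs} {c : Unfolding} {h t : ℝ}
    (ht : 1 - h ^ 2 * t / 2 + h ^ 2 / 4 ≠ 0) {u v : Plane} (hu : u = gammaCurve h t)
    (hv : v = gammaCurve h (t + 1)) {p0 p1 : ℝ}
    (hp0 : p0 = c.r 1 * (a.a1 * ((u 0 + v 0) / 2) - a.a2 * ((u 0 * v 1 + u 1 * v 0) / 2)))
    (hp1 : p1 = -c.l 1 + c.r 1 * (a.a4 * (u 0 * v 0) + a.a5 * ((u 1 + v 1) / 2))) :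
    mapG a c h u 0 0 = (1 - h ^ 2 * t / 2 + h ^ 2 / 4)⁻¹ * (h * (p0 - h / 2 * p1)) ∧
      mapG a c h u 0 1 = h * p1 + h / 2 * mapG a c h u 0 0 := by
  have hd : kahanDet a (c.r ((0 : ℝ), u).1) 1 h ((0 : ℝ), u).2 ≠ 0 := by
    simpa [hu, kahanDet_gammaCurve] using ht
  set V : ℝ → Plane := fun μ => kahanTwo a c h μ u with hVdef
  set w := mapG a c h u 0 with hw
  have hV0 : V 0 = v := by rw [hv, hVdef]; simp only; rw [hu, kahanTwo_zero_gammaCurve ht]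
  have hV : HasDerivAt V w 0 := by
    have hpair : ContDiffAt ℝ 1 (fun μ : ℝ => (μ, u)) 0 := contDiffAt_id.prodMk contDiffAt_const
    have h1 : ContDiffAt ℝ 1 V 0 :=
      ContDiffAt.comp (g := fun q : ℝ × Plane => kahanTwo a c h q.1 q.2) (0 : ℝ)
        (contDiffAt_kahanTwo a c h hd) hpair
    rw [hw, mapG, dslope_same]
    exact (h1.differentiableAt one_ne_zero).hasDerivAt
  have hV0' := hasDerivAt_pi.1 hV 0
  have hV1' := hasDerivAt_pi.1 hV 1
  have hr := c.hasDerivAt_r 0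
  have hl := c.hasDerivAt_l 0
  have himp : ∀ᶠ μ in 𝓝 (0 : ℝ), Implicit a (c.r μ) 1 (c.l μ) h u (V μ) := by
    have hc : Continuous fun μ : ℝ => kahanDet a (c.r μ) 1 h u :=
      (contDiff_kahanDet a c h (n := 0)).continuous.comp (continuous_id.prodMk continuous_const)
    filter_upwards [hc.continuousAt.eventually_ne hd] with μ hμ using (eq_kahan_iff hμ).1 rfl
  -- The implicit form is differentiated in `μ` at `0`; `p0` and `p1` collect the explicit
  -- dependence on `r` and `λ`. This gives a linear system for `G(u, 0)` and avoids differentiating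
  -- the rational formula.
  have key0 : w 0 = h * (-w 1 / 2 + u 0 * w 0 + p0) := by
    refine (hV0'.sub_const (u 0)).unique (HasDerivAt.congr_of_eventuallyEq ?_
      (himp.mono fun μ hμ => hμ.1))
    have := (((((hV1'.const_add (u 1)).neg).div_const 2).add (hV0'.const_mul (u 0))).add
      (hr.mul ((((hV0'.const_add (u 0)).div_const 2).const_mul (1 * a.a1)).sub
        ((((hV1'.const_mul (u 0)).add (hV0'.const_mul (u 1))).div_const 2).const_mul
          a.a2)))).const_mul h
    refine this.congr_deriv ?_
    simp only [Unfolding.r_zero, zero_mul, add_zero, hp0, ← hV0, one_mul, Pi.add_apply,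
      Pi.sub_apply]
  have key1 : w 1 = h * (w 0 / 2 + p1) := by
    refine (hV1'.sub_const (u 1)).unique (HasDerivAt.congr_of_eventuallyEq ?_
      (himp.mono fun μ hμ => hμ.2))
    have := (((((hV0'.const_add (u 0)).div_const 2).sub hl).add
      (hr.mul (((hV0'.const_mul (u 0)).const_mul a.a4).add
        (((hV1'.const_add (u 1)).div_const 2).const_mul a.a5)))).const_mul 1).const_mul h
    refine this.congr_deriv ?_
    simp only [Unfolding.r_zero, zero_mul, add_zero, hp1, ← hV0, one_mul, Pi.add_apply]
    ring
  refine ⟨?_, by linear_combination key1⟩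
  rw [eq_inv_mul_iff_mul_eq₀ ht]
  have hu0 : u 0 = h * t / 2 := by rw [hu]; rfl
  rw [hu0] at key0
  linear_combination key0 - h / 2 * key1

/-- Along the trajectory the perturbation is polynomial in `n` up to inverse determinants, which
tend to `0`. The affine index `s` covers both ends of the trajectory. -/
theorem subexponential_mapG {a : Coeffs} {c : Unfolding} {h : ℝ} (hh : h ≠ 0)
    (hpole : ∀ n : ℕ, h ^ 2 * (2 * (n : ℝ) - 1) ≠ 4) {s : ℕ → ℤ} {α β : ℝ} (hβ : β ≠ 0)
    (hs : ∀ n, (s n : ℝ) = α + β * n) :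
    Subexponential fun n => ‖mapG a c h (gamma h (s n)) 0‖ := by
  have S := Subexponential.const
  have hS : Subexponential fun n => (s n : ℝ) := by
    simp only [hs]; exact (S α).add ((S β).mul Subexponential.natCast)
  have hD : Subexponential fun n => (1 - h ^ 2 * (s n : ℝ) / 2 + h ^ 2 / 4)⁻¹ := by
    refine Subexponential.of_tendsto (L := 0) ?_
    have hne : -(h ^ 2 * β / 2) ≠ 0 := by simp [hh, hβ]
    have := tendsto_affine_div 1 0 (1 - h ^ 2 * α / 2 + h ^ 2 / 4) hne
    rw [zero_div] at this
    refine this.congr fun n => ?_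
    rw [zero_mul, add_zero, one_div, hs]
    congr 1
    ring
  have x0 : Subexponential fun n => gammaCurve h (s n) 0 := by
    refine ((S (h / 2)).mul hS).congr fun n => ?_
    rw [gammaCurve_zero]; ring
  have x1 : Subexponential fun n => gammaCurve h (s n + 1) 0 := by
    refine ((S (h / 2)).mul (hS.add (S 1))).congr fun n => ?_
    rw [gammaCurve_zero]; ring
  have y0 : Subexponential fun n => gammaCurve h (s n) 1 := by
    refine (((S (h ^ 2 / 4)).mul (hS.mul hS)).add (S (-(1 / 2) - h ^ 2 / 8))).congr fun n => ?_
    rw [gammaCurve_one]; ring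
  have y1 : Subexponential fun n => gammaCurve h (s n + 1) 1 := by
    refine (((S (h ^ 2 / 4)).mul ((hS.add (S 1)).mul (hS.add (S 1)))).add
      (S (-(1 / 2) - h ^ 2 / 8))).congr fun n => ?_
    rw [gammaCurve_one]; ring
  have P0 := (S (c.r 1)).mul (((S (a.a1 / 2)).mul (x0.add x1)).add
    ((S (-(a.a2 / 2))).mul ((x0.mul y1).add (y0.mul x1))))
  have P1 := (S (-c.l 1)).add ((S (c.r 1)).mul (((S a.a4).mul (x0.mul x1)).add
    ((S (a.a5 / 2)).mul (y0.add y1))))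
  have hG := fun n => mapG_gammaCurve (a := a) (c := c) (kahanDet_int_ne_zero hpole (s n))
    rfl rfl rfl rfl
  have G0 : Subexponential fun n => mapG a c h (gammaCurve h (s n)) 0 0 := by
    refine (hD.mul ((S h).mul (P0.add ((S (-(h / 2))).mul P1)))).congr fun n => ?_
    rw [(hG n).1]; ring
  have G1 : Subexponential fun n => mapG a c h (gammaCurve h (s n)) 0 1 := by
    refine (((S h).mul P1).add ((S (h / 2)).mul G0)).congr fun n => ?_
    rw [(hG n).2]; ring
  exact Subexponential.norm G0 G1

/-- Forward solutions of the variational equation grow subexponentially. -/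
theorem IsVariationalSolution.subexponential_forward {a : Coeffs} {c : Unfolding} {h : ℝ}
    (hh : h ≠ 0) (hpole : ∀ n : ℕ, h ^ 2 * (2 * (n : ℝ) - 1) ≠ 4) {w : ℤ → Plane}
    (hw : IsVariationalSolution a c h (Set.Ici 0) w) : Subexponential fun n => ‖w n‖ := by
  have hG : Subexponential fun n => ‖mapG a c h (gamma h (n : ℤ)) 0‖ :=
    subexponential_mapG hh hpole (α := 0) one_ne_zero (fun n => by simp)
  refine Subexponential.of_recursion (fun n => norm_nonneg _) (tendsto_rowBound_stepMatrix hh) hG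
    fun n => ?_
  have hJ : jacobian (mapF a c h) (gamma h n) = stepMatrix h n := by
    have := kahanDet_int_ne_zero hpole n
    exact jacobian_mapF_gammaCurve this
  push_cast
  rw [hw n (Int.natCast_nonneg n), hJ]
  refine (norm_add_le _ _).trans ?_
  gcongr
  exact norm_mulVec_le_rowBound _ _

/-- Backward solutions of the variational equation grow subexponentially. -/
theorem IsVariationalSolution.subexponential_backward {a : Coeffs} {c : Unfolding} {h : ℝ}
    (hh : h ≠ 0) (hpole : ∀ n : ℕ, h ^ 2 * (2 * (n : ℝ) - 1) ≠ 4) {w : ℤ → Plane}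
    (hw : IsVariationalSolution a c h (Set.Iio 0) w) : Subexponential fun n => ‖w (-n)‖ := by
  have hG : Subexponential fun n => ‖mapG a c h (gamma h (-(n + 1 : ℕ) : ℤ)) 0‖ :=
    subexponential_mapG hh hpole (α := -1) (β := -1) (by norm_num)
      (fun n => by push_cast; ring)
  have hα := tendsto_rowBound_stepMatrix (neg_ne_zero.2 hh)
  refine Subexponential.of_recursion (fun n => norm_nonneg _) hα
    ((Subexponential.of_tendsto hα).mul hG) fun n => ?_
  have hJ : jacobian (mapF a c h) (gamma h (-(n + 1 : ℕ) : ℤ)) =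
      stepMatrix h (-(n + 1 : ℕ) : ℤ) := by
    have := kahanDet_int_ne_zero hpole (-(n + 1 : ℕ))
    exact jacobian_mapF_gammaCurve this
  have hstep := hw (-(n + 1 : ℕ)) (by simp only [Set.mem_Iio]; omega)
  have hinv := stepMatrix_int_mul hpole (-(n + 1 : ℕ))
  rw [show -(((-(n + 1 : ℕ) : ℤ) : ℝ) + 1) = n by push_cast; ring] at hinv
  rw [hJ, show (-(n + 1 : ℕ) : ℤ) + 1 = -n by push_cast; ring] at hstep
  -- Solving the equation for the earlier value yields a recursion of the same kind, with the
  -- inverse linearization as factor.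
  have e : w (-((n + 1 : ℕ) : ℤ)) = stepMatrix (-h) n *ᵥ
      (w (-n) - mapG a c h (gamma h (-(n + 1 : ℕ) : ℤ)) 0) := by
    rw [hstep, add_sub_cancel_right, Matrix.mulVec_mulVec, hinv, Matrix.one_mulVec]
  rw [e, ← mul_add]
  refine (norm_mulVec_le_rowBound _ _).trans (mul_le_mul_of_nonneg_left (norm_sub_le _ _) ?_)
  exact le_trans (by positivity) (le_max_left _ _)

/-- The series formula for the separation of the manifolds. -/
theorem IsAdjointSolution.hasSum {a : Coeffs} {c : Unfolding} {h : ℝ} {ψ : ℤ → Plane}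
    (hh : h ≠ 0) (hψ : IsAdjointSolution a c h ψ)
    (hpole : ∀ n : ℕ, h ^ 2 * (2 * (n : ℝ) - 1) ≠ 4) {wm wp : ℤ → Plane}
    (hm : IsVariationalSolution a c h (Set.Iio 0) wm)
    (hp : IsVariationalSolution a c h (Set.Ici 0) wp) (hdecay : DecaysExponentially ψ) :
    HasSum (fun n : ℤ => ψ (n + 1) ⬝ᵥ mapG a c h (gamma h n) 0)
      (ψ 0 ⬝ᵥ wm 0 - ψ 0 ⬝ᵥ wp 0) := by
  obtain ⟨C, b, hb, hC⟩ := hdecay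
  have hC0 : 0 ≤ C := by simpa using (norm_nonneg _).trans (hC 0)
  have decay : ∀ n : ℕ, ‖ψ n‖ ≤ C * Real.exp (-b * n) ∧ ‖ψ (-n)‖ ≤ C * Real.exp (-b * n) := by
    intro n
    have h1 := hC n
    have h2 := hC (-n)
    push_cast at h1 h2
    rw [abs_neg] at h2
    rw [Nat.abs_cast] at h1 h2
    exact ⟨h1, h2⟩
  have bdry : ∀ u v : ℕ → Plane, (∀ n, ‖u n‖ ≤ C * Real.exp (-b * n)) →
      (Subexponential fun n => ‖v n‖) → Tendsto (fun n => ‖u n‖ * ‖v n‖) atTop (𝓝 0) := by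
    intro u v h1 h2
    refine squeeze_zero (fun n => by positivity) (fun n => ?_)
      (by simpa only [mul_zero] using (h2 b hb).const_mul C)
    calc ‖u n‖ * ‖v n‖ ≤ C * Real.exp (-b * n) * ‖v n‖ := by gcongr; exact h1 n
      _ = C * (‖v n‖ * Real.exp (-b * n)) := by ring
  have hlim := hψ.tendsto_sum hpole hm hp
    (bdry (fun n => ψ (-n)) (fun n => wm (-n)) (fun n => (decay n).2)
      (hm.subexponential_backward hh hpole))
    (bdry (fun n => ψ n) (fun n => wp n) (fun n => (decay n).1)
      (hp.subexponential_forward hh hpole))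
  have hsum : Summable fun n : ℤ => ψ (n + 1) ⬝ᵥ mapG a c h (gamma h n) 0 := by
    have hG1 : Subexponential fun n => ‖mapG a c h (gamma h (n : ℤ)) 0‖ :=
      subexponential_mapG hh hpole (α := 0) one_ne_zero (fun n => by simp)
    have hG2 : Subexponential fun n => ‖mapG a c h (gamma h (-(n + 1 : ℕ) : ℤ)) 0‖ :=
      subexponential_mapG hh hpole (α := -1) (β := -1) (by norm_num)
        (fun n => by push_cast; ring)
    refine Summable.of_nat_of_neg_add_one
      (((Subexponential.const (2 * C)).mul hG1).summable hb fun n => ?_)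
      (((Subexponential.const (2 * C)).mul hG2).summable hb fun n => ?_)
    · refine (abs_dotProduct_le _ _).trans ?_
      have h1 := (decay (n + 1)).1
      push_cast at h1
      have h2 : Real.exp (-b * (n + 1)) ≤ Real.exp (-b * n) := by
        rw [Real.exp_le_exp]; linarith
      calc 2 * (‖ψ (n + 1)‖ * ‖mapG a c h (gamma h n) 0‖)
          ≤ 2 * ((C * Real.exp (-b * n)) * ‖mapG a c h (gamma h n) 0‖) := by
            gcongr; exact h1.trans (by gcongr)
        _ = 2 * C * ‖mapG a c h (gamma h n) 0‖ * Real.exp (-b * n) := by ring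
    · have e : (-((n : ℤ) + 1)) + 1 = -n := by ring
      rw [e]
      refine (abs_dotProduct_le _ _).trans ?_
      push_cast
      calc 2 * (‖ψ (-n)‖ * ‖mapG a c h (gamma h (-((n : ℤ) + 1))) 0‖)
          ≤ 2 * ((C * Real.exp (-b * n)) * ‖mapG a c h (gamma h (-((n : ℤ) + 1))) 0‖) := by
            gcongr; exact (decay n).2
        _ = 2 * C * ‖mapG a c h (gamma h (-((n : ℤ) + 1))) 0‖ * Real.exp (-b * n) := by ring
  -- The symmetric partial sums converge both to the sum of the absolutely convergent series and to
  -- the telescoped limit.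
  have := hsum.hasSum.comp (Finset.tendsto_Ico_neg (R := ℤ))
  rw [← tendsto_nhds_unique this hlim]
  exact hsum.hasSum

/-- Forward solutions of the variational equation exist for every initial value. -/
theorem exists_isVariationalSolution_forward (a : Coeffs) (c : Unfolding) (h : ℝ) (w₀ : Plane) :
    ∃ w, IsVariationalSolution a c h (Set.Ici 0) w ∧ w 0 = w₀ := by
  let f : ℕ → Plane := fun n => Nat.rec w₀ (fun n w =>
    jacobian (mapF a c h) (gamma h n) *ᵥ w + mapG a c h (gamma h n) 0) n
  refine ⟨fun n => f n.toNat, fun n hn => ?_, rfl⟩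
  obtain ⟨m, rfl⟩ := Int.eq_ofNat_of_zero_le hn
  rfl

/-- Backward solutions of the variational equation exist for every final value. -/
theorem exists_isVariationalSolution_backward (a : Coeffs) (c : Unfolding) {h : ℝ}
    (hpole : ∀ n : ℕ, h ^ 2 * (2 * (n : ℝ) - 1) ≠ 4) (w₀ : Plane) :
    ∃ w, IsVariationalSolution a c h (Set.Iio 0) w ∧ w 0 = w₀ := by
  let f : ℕ → Plane := fun n => Nat.rec w₀ (fun n w =>
    stepMatrix (-h) n *ᵥ (w - mapG a c h (gamma h (-(n + 1 : ℕ) : ℤ)) 0)) n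
  refine ⟨fun n => f (-n).toNat, fun n hn => ?_, rfl⟩
  obtain ⟨m, rfl⟩ : ∃ m : ℕ, n = -(m + 1 : ℕ) := ⟨(-n - 1).toNat, by
    have : n < 0 := hn
    omega⟩
  have hJ : jacobian (mapF a c h) (gamma h (-(m + 1 : ℕ) : ℤ)) =
      stepMatrix h (-(m + 1 : ℕ) : ℤ) := by
    have := kahanDet_int_ne_zero hpole (-(m + 1 : ℕ))
    exact jacobian_mapF_gammaCurve this
  have hinv := stepMatrix_int_mul hpole (-(m + 1 : ℕ))
  rw [show -(((-(m + 1 : ℕ) : ℤ) : ℝ) + 1) = m by push_cast; ring] at hinv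
  have hinv' := mul_eq_one_comm.1 hinv
  have e1 : (-(-((m + 1 : ℕ) : ℤ) + 1)).toNat = m := by omega
  have e2 : (-(-((m + 1 : ℕ) : ℤ))).toNat = m + 1 := by omega
  have hf : f (m + 1) = stepMatrix (-h) m *ᵥ
    (f m - mapG a c h (gamma h (-(m + 1 : ℕ) : ℤ)) 0) := rfl
  simp only [e1, e2]
  rw [hJ, hf, Matrix.mulVec_mulVec, hinv', Matrix.one_mulVec, sub_add_cancel]

/-! ### The attracting and the repelling side -/

/-- Here `η = h`, and `η x < 0` is the half-plane `x < 0` in which the graph is invariant. -/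
theorem isSide_attracting {a : Coeffs} (c : Unfolding) {k : ℕ} (hk : 1 ≤ k) {ρ δ κ ν h : ℝ}
    (hρ : 0 < ρ) (hδ : 0 < δ) (hκ : 0 < κ) (hν : 0 < ν) (hh : 0 < h) {M : Set ChartPoint}
    (hM : IsCenterStable a k ρ δ κ ν M) (hpole : ∀ n : ℕ, h ^ 2 * (2 * (n : ℝ) - 1) ≠ 4) :
    ∃ g, IsSide a c k ρ δ κ ν h h g M fun μ => KahanStep (unfoldedField a c μ) h := by
  obtain ⟨g, hg, hMg⟩ := hM.1.1
  exact ⟨g, {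
    one_le := hk
    rho_pos := hρ
    delta_pos := hδ
    kappa_pos := hκ
    nu_pos := hν
    h_pos := hh
    eta := Or.inl rfl
    smooth := hg
    mem_iff := fun p => by rw [hMg]; rfl
    curve_mem := fun t ht => gammaCurve_mem_chartTwo_attracting hM hρ hδ hκ hν hh ht
    invariant := fun r l u v hu hv bu bv su sv du _ H => by
      have step := chartOneStep_kappa21 hu hv (kahanStep_iff.2 ⟨du, H⟩)
      have side : ∀ z : Plane, 0 < z 1 → h * z 0 < 0 → 0 < -1 * (kappa21 r l h z).x := by
        intro z hz hz0
        rw [neg_one_mul, neg_pos]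
        exact div_neg_of_neg_of_pos (neg_of_mul_neg_right hz0 hh.le) (Real.sqrt_pos.2 hz)
      have := hM.1.2.1 _ _ bu bv (side u hu su) (side v hv sv) step
      simp only [chartTwo, Set.mem_ofPred_eq, hu, hv, true_and, this]
    implicit_of_step := fun μ u v H => (kahanStep_iff.1 H).2
    step_of_implicit := fun μ u v du _ H => kahanStep_iff.2 ⟨du, H⟩
    pole := fun n => by exact_mod_cast kahanDet_int_ne_zero hpole n }⟩

/-- Here `η = -h` and the relation is reversed, so `η x < 0` means `x > 0` and the same statements
describe orbits followed backward. -/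
theorem isSide_repelling {a : Coeffs} (c : Unfolding) {k : ℕ} (hk : 1 ≤ k) {ρ δ κ ν h : ℝ}
    (hρ : 0 < ρ) (hδ : 0 < δ) (hκ : 0 < κ) (hν : 0 < ν) (hh : 0 < h) {M : Set ChartPoint}
    (hM : IsCenterUnstable a k ρ δ κ ν M) (hδν : 1 / δ < ν ^ 2 / h ^ 2)
    (hpole : ∀ n : ℕ, h ^ 2 * (2 * (n : ℝ) - 1) ≠ 4) :
    ∃ g, IsSide a c k ρ δ κ ν h (-h) g M fun μ u v => KahanStep (unfoldedField a c μ) h v u := by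
  obtain ⟨g, hg, hMg⟩ := hM.1.1
  exact ⟨g, {
    one_le := hk
    rho_pos := hρ
    delta_pos := hδ
    kappa_pos := hκ
    nu_pos := hν
    h_pos := hh
    eta := Or.inr rfl
    smooth := hg
    mem_iff := fun p => by rw [hMg]; rfl
    curve_mem := fun t ht => gammaCurve_mem_chartTwo_repelling hM hρ hδ hκ hν hh hδν ht
    invariant := fun r l u v hu hv bu bv su sv _ dv H => by
      have H' := H.symm
      rw [neg_neg] at H' dv
      have step := chartOneStep_kappa21 hv hu (kahanStep_iff.2 ⟨dv, H'⟩)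
      have side : ∀ z : Plane, 0 < z 1 → -h * z 0 < 0 → 0 < 1 * (kappa21 r l h z).x := by
        intro z hz hz0
        rw [neg_mul, neg_lt_zero] at hz0
        rw [one_mul]
        exact div_pos (pos_of_mul_pos_right hz0 hh.le) (Real.sqrt_pos.2 hz)
      have := hM.1.2.1 _ _ bv bu (side v hv sv) (side u hu su) step
      simp only [chartTwo, Set.mem_ofPred_eq, hu, hv, true_and, this]
    implicit_of_step := fun μ u v H => (kahanStep_iff.1 H).2.symm
    step_of_implicit := fun μ u v _ dv H => by
      have H' := H.symm
      rw [neg_neg] at H' dv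
      exact kahanStep_iff.2 ⟨dv, H'⟩
    pole := fun n => by exact_mod_cast kahanDet_int_ne_zero hpole n }⟩

theorem forwardSheet_inter_crossSection {f : Plane → Plane} {h : ℝ} (hh : 0 < h) (M : Set Plane)
    (z : Plane) : z ∈ forwardSheet f h M ∩ crossSection h ↔
      (∃ m ∈ M, Relation.ReflTransGen (fun u v => h * u 0 < 0 ∧ KahanStep f h u v) m z) ∧
        z 0 = 0 := by
  have e : ∀ x : ℝ, h * x < 0 ↔ x < 0 := fun x =>
    ⟨fun H => neg_of_mul_neg_right H hh.le, mul_neg_of_pos_of_neg hh⟩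
  simp only [e]
  exact and_congr Iff.rfl (mem_crossSection hh.ne')

theorem backwardSheet_inter_crossSection {f : Plane → Plane} {h : ℝ} (hh : 0 < h) (M : Set Plane)
    (z : Plane) : z ∈ backwardSheet f h M ∩ crossSection h ↔
      (∃ m ∈ M, Relation.ReflTransGen (fun u v => -h * u 0 < 0 ∧ KahanStep f h v u) m z) ∧
        z 0 = 0 := by
  have e : ∀ x : ℝ, -h * x < 0 ↔ 0 < x := fun x => by
    rw [neg_mul, neg_lt_zero]; exact mul_pos_iff_of_pos_left hh
  simp only [e]
  refine and_congr (exists_congr fun m => and_congr_right fun _ => ?_) (mem_crossSection hh.ne')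
  exact Relation.reflTransGen_swap.symm

theorem reflTransGen_gamma {a : Coeffs} {h : ℝ}
    (hpole : ∀ n : ℕ, h ^ 2 * (2 * (n : ℝ) - 1) ≠ 4) {m n : ℤ} (hmn : m ≤ n) :
    Relation.ReflTransGen (KahanStep (field a 0 1 0) h) (gamma h m) (gamma h n) := by
  induction n, hmn using Int.leInduction with
  | base => exact Relation.ReflTransGen.refl
  | succ n _ ih =>
    refine ih.tail ?_
    have := kahanStep_gammaCurve (a := a) (kahanDet_int_ne_zero hpole n)
    rw [gamma, gamma]
    push_cast
    exact this

theorem gamma_mem_orbitHull {a : Coeffs} {h : ℝ}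
    (hpole : ∀ n : ℕ, h ^ 2 * (2 * (n : ℝ) - 1) ≠ 4) {M : Set Plane} {m : ℤ}
    (hm : gamma h m ∈ M) (n : ℤ) : gamma h n ∈ orbitHull (field a 0 1 0) h M := by
  refine ⟨_, hm, ?_⟩
  rcases le_total m n with h1 | h1
  · exact Or.inl (reflTransGen_gamma hpole h1)
  · exact Or.inr (reflTransGen_gamma hpole h1)

theorem hasDerivWithinAt_of_contDiffOn {J : Set ℝ} {f : ℝ → ℝ} {k : ℕ} (hk : 1 ≤ k) {ε : ℝ}
    (hε : 0 < ε) (h0 : (0 : ℝ) ∈ J) (hf : ContDiffOn ℝ k f (J ∩ Set.Ioo (-ε) ε)) :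
    ∃ d, HasDerivWithinAt f d J 0 := by
  have hmem : (0 : ℝ) ∈ J ∩ Set.Ioo (-ε) ε := ⟨h0, by linarith, hε⟩
  have hd := hf.differentiableOn (by exact_mod_cast (by omega : k ≠ 0)) 0 hmem
  refine ⟨_, hd.hasDerivWithinAt.mono_of_mem_nhdsWithin ?_⟩
  exact inter_mem self_mem_nhdsWithin
    (mem_nhdsWithin_of_mem_nhds (Ioo_mem_nhds (by linarith) hε))

end KahanCanard
end

/-! ### The main theorem. -/

open KahanCanard in
theorem mainTheorem4
    (a : KahanCanard.Coeffs) (c : KahanCanard.Unfolding) (k : ℕ) (hk : 1 ≤ k)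
    (ρ δ κ ν : ℝ) (hρ : 0 < ρ) (hδ : 0 < δ) (hκ : 0 < κ) (hν : 0 < ν) (hν1 : ν < 1)
    (Ma Mr : Set KahanCanard.ChartPoint)
    (hMa : KahanCanard.IsCenterStable a k ρ δ κ ν Ma)
    (hMr : KahanCanard.IsCenterUnstable a k ρ δ κ ν Mr)
    (h : ℝ) (hh : 0 < h)
    -- no point of the special trajectory is a pole of the Kahan map
    (hpole : ∀ n : ℕ, h ^ 2 * (2 * (n : ℝ) - 1) ≠ 4)
    -- the special trajectory visits the interior of the range of chart `K₁`
    (hvisit : ∃ n : ℤ, 1 / δ < KahanCanard.gamma h n 1 ∧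
      h ^ 2 * KahanCanard.gamma h n 1 < ν ^ 2)
    (ψ : ℤ → KahanCanard.Plane) (hψ : KahanCanard.IsAdjointSolution a c h ψ)
    (hψ_norm : ψ 0 ⬝ᵥ ψ 0 = 1)
    (hψ_orth : ψ 0 ⬝ᵥ deriv (KahanCanard.gammaCurve h) 0 = 0) :
    -- the manifolds intersect along the special trajectory
    (∀ n : ℤ,
      KahanCanard.gamma h n ∈ KahanCanard.orbitHull (KahanCanard.unfoldedField a c 0) h
          (KahanCanard.chartTwo Ma 0 0 h) ∩
        KahanCanard.orbitHull (KahanCanard.unfoldedField a c 0) h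
          (KahanCanard.chartTwo Mr 0 0 h)) ∧
    -- near `μ = 0` they meet the section in single points, smooth in `μ`
    ∃ (Δm Δp : ℝ → ℝ) (μ₀ dm dp : ℝ), 0 < μ₀ ∧
      ContDiffOn ℝ k Δm (c.range ∩ Set.Ioo (-μ₀) μ₀) ∧
      ContDiffOn ℝ k Δp (c.range ∩ Set.Ioo (-μ₀) μ₀) ∧
      (∀ μ ∈ c.range ∩ Set.Ioo (-μ₀) μ₀,
        KahanCanard.forwardSheet (KahanCanard.unfoldedField a c μ) h
            (KahanCanard.chartTwo Ma (c.r μ) (c.l μ) h) ∩ KahanCanard.crossSection h =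
          {Δm μ • ψ 0} ∧
        KahanCanard.backwardSheet (KahanCanard.unfoldedField a c μ) h
            (KahanCanard.chartTwo Mr (c.r μ) (c.l μ) h) ∩ KahanCanard.crossSection h =
          {Δp μ • ψ 0}) ∧
      Δm 0 • ψ 0 = KahanCanard.gamma h 0 ∧ Δp 0 • ψ 0 = KahanCanard.gamma h 0 ∧
      HasDerivWithinAt Δm dm c.range 0 ∧ HasDerivWithinAt Δp dp c.range 0 ∧
      -- the finite-sum formula, and its limit when the boundary terms vanish
      (∀ wm wp : ℤ → KahanCanard.Plane,
        KahanCanard.IsVariationalSolution a c h (Set.Iio 0) wm → wm 0 = dm • ψ 0 →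
        KahanCanard.IsVariationalSolution a c h (Set.Ici 0) wp → wp 0 = dp • ψ 0 →
        (∀ N : ℕ, 1 ≤ N →
          dm - dp = ∑ n ∈ Finset.Ico (-(N : ℤ)) N,
              ψ (n + 1) ⬝ᵥ KahanCanard.mapG a c h (KahanCanard.gamma h n) 0 +
            ψ (-N) ⬝ᵥ wm (-N) - ψ N ⬝ᵥ wp N) ∧
        (Tendsto (fun N : ℕ => ‖ψ (-N)‖ * ‖wm (-N)‖) atTop (𝓝 0) →
          Tendsto (fun N : ℕ => ‖ψ N‖ * ‖wp N‖) atTop (𝓝 0) →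
          Tendsto (fun N : ℕ => ∑ n ∈ Finset.Ico (-(N : ℤ)) N,
              ψ (n + 1) ⬝ᵥ KahanCanard.mapG a c h (KahanCanard.gamma h n) 0)
            atTop (𝓝 (dm - dp)))) ∧
      -- the infinite-sum formula under exponential decay
      (KahanCanard.DecaysExponentially ψ →
        HasSum (fun n : ℤ =>
            ψ (n + 1) ⬝ᵥ KahanCanard.mapG a c h (KahanCanard.gamma h n) 0)
          (dm - dp)) := by
  obtain ⟨nv, hv1, hv2⟩ := hvisit
  -- The height is even in time, so the visit can be moved to the time `-|nv| ≤ 0`; the repelling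
  -- side sees it at `+|nv|`.
  set n₀ := nv.natAbs with hn₀
  have hgn : gammaCurve h (-n₀) 1 = KahanCanard.gamma h nv 1 := by
    rw [KahanCanard.gamma, gammaCurve_one, gammaCurve_one, neg_sq, hn₀, Nat.cast_natAbs,
      Int.cast_abs, sq_abs]
  have hlt : gammaCurve h (-n₀) 1 < ν ^ 2 / h ^ 2 := by
    rw [hgn, lt_div_iff₀ (by positivity)]; linarith
  rw [← hgn] at hv1
  have hmem : (-n₀ : ℝ) ∈ timeRange δ ν h := ⟨by simp, hv1.le, hlt.le⟩
  obtain ⟨ga, Sa⟩ := isSide_attracting c hk hρ hδ hκ hν hh hMa hpole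
  obtain ⟨gr, Sr⟩ := isSide_repelling c hk hρ hδ hκ hν hh hMr (hv1.trans hlt) hpole
  obtain ⟨Zm, ε₁, hε₁, Zms, Zm0, hZm⟩ := Sa.exists_section_point hv1 hlt
  obtain ⟨Zp, ε₂, hε₂, Zps, Zp0, hZp⟩ := Sr.exists_section_point hv1 hlt
  have hψ0 : ψ 0 0 = 0 := (mem_crossSection hh.ne').1 hψ_orth
  have hψ1 : ψ 0 1 * ψ 0 1 = 1 := by
    simpa [dotProduct, Fin.sum_univ_two, hψ0] using hψ_norm
  -- `ψ(0)` is a unit vector along the second axis, which is `Σ`; with its sign `ψ 0 1 = ±1`, the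
  -- point `(0, x)` is `(x * ψ 0 1) • ψ 0`.
  have hpt : ∀ x : ℝ, (x * ψ 0 1) • ψ 0 = ![0, x] := fun x => by
    ext i
    fin_cases i
    · simp [hψ0]
    · simp [mul_assoc, hψ1]
  have hsub : ∀ ε, min ε₁ ε₂ ≤ ε → c.range ∩ Set.Ioo (-min ε₁ ε₂) (min ε₁ ε₂) ⊆
      c.range ∩ Set.Ioo (-ε) ε := fun ε hε =>
    Set.inter_subset_inter_right _ (Set.Ioo_subset_Ioo (neg_le_neg hε) hε)
  have hsm := hsub ε₁ (min_le_left _ _)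
  have hsp := hsub ε₂ (min_le_right _ _)
  have hε : 0 < min ε₁ ε₂ := lt_min hε₁ hε₂
  have Δms : ContDiffOn ℝ k (fun μ => Zm μ * ψ 0 1)
      (c.range ∩ Set.Ioo (-min ε₁ ε₂) (min ε₁ ε₂)) := (Zms.mono hsm).mul contDiffOn_const
  have Δps : ContDiffOn ℝ k (fun μ => Zp μ * ψ 0 1)
      (c.range ∩ Set.Ioo (-min ε₁ ε₂) (min ε₁ ε₂)) := (Zps.mono hsp).mul contDiffOn_const
  obtain ⟨dm, hdm⟩ := hasDerivWithinAt_of_contDiffOn hk hε c.zero_mem_range Δms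
  obtain ⟨dp, hdp⟩ := hasDerivWithinAt_of_contDiffOn hk hε c.zero_mem_range Δps
  have hpair : ∀ d : ℝ, ψ 0 ⬝ᵥ d • ψ 0 = d := fun d => by
    rw [dotProduct_smul, hψ_norm, smul_eq_mul, mul_one]
  refine ⟨fun n => ⟨?_, ?_⟩, fun μ => Zm μ * ψ 0 1, fun μ => Zp μ * ψ 0 1, min ε₁ ε₂, dm, dp,
    hε, Δms, Δps, fun μ hμ => ⟨?_, ?_⟩, ?_, ?_, hdm, hdp, fun wm wp hwm hwm0 hwp hwp0 => ⟨?_, ?_⟩,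
    fun hdecay => ?_⟩
  · rw [unfoldedField_zero]
    refine gamma_mem_orbitHull hpole (m := -n₀) ?_ n
    rw [KahanCanard.gamma]
    push_cast
    exact Sa.curve_mem _ hmem
  · rw [unfoldedField_zero]
    refine gamma_mem_orbitHull hpole (m := n₀) ?_ n
    have := Sr.curve_mem _ hmem
    rwa [gammaCurve_neg, neg_neg] at this
  · ext z
    rw [forwardSheet_inter_crossSection hh, hpt, Set.mem_singleton_iff]
    exact hZm μ (hsm hμ) z
  · ext z
    rw [backwardSheet_inter_crossSection hh, hpt, Set.mem_singleton_iff]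
    exact hZp μ (hsp hμ) z
  · rw [hpt, Zm0, KahanCanard.gamma, Int.cast_zero]
  · rw [hpt, Zp0, gammaCurve_neg, neg_zero, KahanCanard.gamma, Int.cast_zero]
  · intro N _
    have := hψ.finite_sum_formula hpole hwm hwp N
    rwa [hwm0, hwp0, hpair, hpair] at this
  · intro h1 h2
    have := hψ.tendsto_sum hpole hwm hwp h1 h2
    rwa [hwm0, hwp0, hpair, hpair] at this
  -- The series does not mention `w_±`, so solutions with the right initial values are constructed
  -- here; backward in time this uses the inverse linearization.
  · obtain ⟨wm, hwm, hwm0⟩ := exists_isVariationalSolution_backward a c hpole (dm • ψ 0)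
    obtain ⟨wp, hwp, hwp0⟩ := exists_isVariationalSolution_forward a c h (dp • ψ 0)
    have := hψ.hasSum hh.ne' hpole hwm hwp hdecay
    rwa [hwm0, hwp0, hpair, hpair] at this
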